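/- Let $G$ be the connected, simply connected Lie group whose Lie algebra has basis $A,B,P,Q,R,S$ and nonzero brackets $$[P,Q]=R,\quad [P,R]=S,\quad [A,P]=\tfrac12P,\quad [B,P]=-\tfrac12P,\quad [B,Q]=Q,\quad [A,R]=\tfrac12R,\quad [B,R]=\tfrac12R,\quad [A,S]=S .$$ Put $E(a,b,p)=\exp(aA)\exp(bB)\exp(pP)$, let $\mathfrak h=\mathrm{span}\{Q,R,S\}$ (an abelian ideal) and $H=\exp\mathfrak h$; let $Q^*,R^*,S^*$ be the dual basis of $\mathfrak h^*$. For $l\in\mathfrak h^*$ let $\chi_l(\exp Y)=e^{il(Y)}$ and let $\sigma_l=\mathrm{ind}_H^G\chi_l$, realized on $L^2(\mathbb R^3)$ (with $(a,b,p)\in\mathbb R^3$ standing for $E(a,b,p)$) by $$(\sigma_l(E(x)\exp Y)\xi)(h)=\chi_{\mathrm{Ad}^*(x^{-1}h)l}(\exp Y)\,\xi(x^{-1}h),$$ where $x^{-1}h$ is computed in the group $\{E(a,b,p)\}$. The same letter denotes the extension of $\sigma_l$ to the full group C*-algebra $C^*(G)$. Fix $\varepsilon\in\{1,-1\}$ and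 write $\pi_{\varepsilon(S^*-Q^*)}=\sigma_{\varepsilon(S^*-Q^*)}$. Let $\varphi:\mathbb R\to\mathbb R$ be $C^\infty$ with support in $[-1,1]$, $\varphi=1$ on $[-\frac12,\frac12]$ and $\|\varphi\|_\infty=1$, and put $\tilde\varphi_1(a,b,p)=\varphi(-e^{-b})$. For $\delta>0$ and $k\in\mathbb Z$ let $I_{\delta^2,k}=[\delta^2k,\delta^2k+\delta^2)$ and define subsets of $\mathbb R^3$ by $$S_{\delta,1}=\{e^{-a}>\delta^6\},\qquad S_{\delta,2}=\{e^{-a}\le\delta^6,\ e^{-b}<\delta\},$$ $$S_{\delta,3,k,\pm}=\{a\ge\log\delta^{-6},\ b\le\log\delta^{-1},\ p\in I_{\delta^2,k},\ \pm\varepsilon e^{-b/2}(1-\tfrac{p^2}2)>\delta^{1/2},\ \delta\le e^{-b}\le\delta^{-5/4}\},$$ $$S_{\delta,4,\pm}=\{e^{-a}<\delta^6,\ e^{-b}\ge\delta,\ e^{-b/2}|\tfrac{p^2}2-1|\le\delta^{1/2},\ \pm p\le0\},$$ $$T_{\delta,3,k}=\mathbb R\times\mathbb R\times(I_{\delta^2,k-1}\cup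 I_{\delta^2,k}\cup I_{\delta^2,k+1}).$$ Let $M_{f}$ be multiplication by $f$ on $L^2(\mathbb R^3)$ and $M_{X}=M_{1_X}$ for a set $X$. For $F\in C^*(G)$ define $$\begin{aligned}\sigma_{\varepsilon,-\varepsilon,\delta}(F)={}&\sigma_{\varepsilon S^*}(F)M_{\tilde\varphi_1}M_{S_{\delta,1}}+\sigma_{\varepsilon S^*}(F)M_{S_{\delta,2}}\\&+\sum_{k\in\mathbb Z}M_{T_{\delta,3,k}}\,\sigma_{\varepsilon(-1+\delta^4k^2/2)Q^*}(F)\,(M_{S_{\delta,3,k,+}}+M_{S_{\delta,3,k,-}})+\sum_{\pm}\sigma_{\varepsilon(\pm\sqrt2R^*-2Q^*)}(F)M_{S_{\delta,4,\pm}} .\end{aligned}$$ Then, for every $\delta>0$, the series over $k$ converges in the strong operator topology for every $F\in C^*(G)$, and $F\mapsto\sigma_{\varepsilon,-\varepsilon,\delta}(F)$ is a bounded linear map from $C^*(G)$ to the bounded operators on $L^2(\mathbb R^3)$. The number $C=\max_{m\in\mathbb Z}\#\{k\in\mathbb Z:T_{\delta,3,k}\cap T_{\delta,3,m}\neq\emptyset\}$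 does not depend on $\delta>0$, satisfies $C\le9$, and for all $\delta>0$ and $F\in C^*(G)$ $$\|\sigma_{\varepsilon,-\varepsilon,\delta}(F)\|\le2\|\sigma_{\varepsilon S^*}(F)\|+C\max\big(\|\sigma_{\varepsilon Q^*}(F)\|,\|\sigma_{-\varepsilon Q^*}(F)\|\big)+\|\sigma_{\varepsilon R^*}(F)\|+\|\sigma_{-\varepsilon R^*}(F)\| .$$ Moreover, for every $F\in C^*(G)$, $$\lim_{\delta\to0^+}\mathrm{dis}\big(\pi_{\varepsilon(S^*-Q^*)}(F)-\sigma_{\varepsilon,-\varepsilon,\delta}(F),\ \mathcal K(L^2(\mathbb R^3))\big)=0,$$ where $\mathrm{dis}(T,\mathcal K)$ is the operator norm distance of $T$ to the compact operators. -/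

import Mathlib

open MeasureTheory Filter Topology Set
open scoped ENNReal ContDiff

noncomputable section

/-! ## Unitary representations and the full group C*-algebra -/

/-- A strongly continuous unitary representation of `G` on a complex Hilbert space.
A homomorphism from a group into the monoid of linear isometries automatically takes
unitary values, since `π g` has the inverse `π g⁻¹`. -/
structure UnitaryRep (G : Type) [Group G] [TopologicalSpace G] : Type 1 where
  H : Type
  [instNormed : NormedAddCommGroup H]
  [instInner : InnerProductSpace ℂ H]
  [instComplete : CompleteSpace H]
  toHom : G →* (H →ₗᵢ[ℂ] H)
  continuous_apply : ∀ ξ : H, Continuous fun g => toHom g ξ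

attribute [instance] UnitaryRep.instNormed UnitaryRep.instInner UnitaryRep.instComplete

namespace UnitaryRep

theorem integrable_smul {G : Type} [Group G] [TopologicalSpace G] [MeasurableSpace G]
    [BorelSpace G] [SecondCountableTopology G] {μ : Measure G} (π : UnitaryRep G)
    (f : Lp ℂ 1 μ) (ξ : π.H) : Integrable (fun g => f g • π.toHom g ξ) μ := by
  have hf : Integrable (fun g => f g) μ := L1.integrable_coeFn f
  refine (hf.norm.mul_const ‖ξ‖).mono
    (hf.aestronglyMeasurable.smul (π.continuous_apply ξ).aestronglyMeasurable) ?_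
  refine Eventually.of_forall fun g => ?_
  simp [norm_smul]

theorem norm_integral_smul_le {G : Type} [Group G] [TopologicalSpace G] [MeasurableSpace G]
    {μ : Measure G} (π : UnitaryRep G) (f : Lp ℂ 1 μ) (ξ : π.H) :
    ‖∫ g, f g • π.toHom g ξ ∂μ‖ ≤ ‖f‖ * ‖ξ‖ := by
  refine (norm_integral_le_integral_norm _).trans ?_
  simp only [norm_smul, LinearIsometry.norm_map]
  rw [integral_mul_const, L1.norm_eq_integral_norm]

/-- The integrated form `π(f) ξ = ∫ f(g) π(g) ξ dg` of a unitary representation, `f ∈ L¹(G)`. -/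
def integrated {G : Type} [Group G] [TopologicalSpace G] [MeasurableSpace G]
    [BorelSpace G] [SecondCountableTopology G] (μ : Measure G) (π : UnitaryRep G)
    (f : Lp ℂ 1 μ) : π.H →L[ℂ] π.H :=
  LinearMap.mkContinuous
    { toFun := fun ξ => ∫ g, f g • π.toHom g ξ ∂μ
      map_add' := fun ξ η => by
        simp only [map_add, smul_add]
        exact integral_add (π.integrable_smul f ξ) (π.integrable_smul f η)
      map_smul' := fun c ξ => by
        simp only [map_smul, RingHom.id_apply]
        rw [← integral_smul]
        congr 1
        funext g
        exact smul_comm _ _ _ }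
    ‖f‖ (π.norm_integral_smul_le f)

theorem integrated_apply {G : Type} [Group G] [TopologicalSpace G] [MeasurableSpace G]
    [BorelSpace G] [SecondCountableTopology G] (μ : Measure G) (π : UnitaryRep G)
    (f : Lp ℂ 1 μ) (ξ : π.H) : π.integrated μ f ξ = ∫ g, f g • π.toHom g ξ ∂μ := rfl

theorem norm_integrated_le {G : Type} [Group G] [TopologicalSpace G] [MeasurableSpace G]
    [BorelSpace G] [SecondCountableTopology G] (μ : Measure G) (π : UnitaryRep G)
    (f : Lp ℂ 1 μ) : ‖π.integrated μ f‖ ≤ ‖f‖ :=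
  LinearMap.mkContinuous_norm_le _ (norm_nonneg _) _

end UnitaryRep

/-- The C*-algebra of all bounded families `(T_π)_π`, `T_π ∈ B(H_π)`, indexed by the unitary
representations of `G`, with the supremum norm. Every cyclic representation of a
second countable group lives on a separable Hilbert space, so the Hilbert spaces in `Type`
suffice to compute the maximal C*-norm. -/
abbrev RepProduct (G : Type) [Group G] [TopologicalSpace G] : Type 1 :=
  lp (fun π : UnitaryRep G => π.H →L[ℂ] π.H) ∞

/-- The universal map `f ↦ (π(f))_π` on `L¹(G)`. -/
def universalMap (G : Type) [Group G] [TopologicalSpace G] [MeasurableSpace G]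
    [BorelSpace G] [SecondCountableTopology G] (μ : Measure G) :
    Lp ℂ 1 μ →ₗ[ℂ] RepProduct G where
  toFun f := ⟨fun π => π.integrated μ f, memℓp_infty ⟨‖f‖, by
    rintro _ ⟨π, rfl⟩
    exact π.norm_integrated_le μ f⟩⟩
  map_add' f₁ f₂ := by
    apply Subtype.ext
    funext π
    apply ContinuousLinearMap.ext
    intro ξ
    change π.integrated μ (f₁ + f₂) ξ = π.integrated μ f₁ ξ + π.integrated μ f₂ ξ
    simp only [UnitaryRep.integrated_apply]
    rw [← integral_add (π.integrable_smul f₁ ξ) (π.integrable_smul f₂ ξ)]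
    refine integral_congr_ae ?_
    filter_upwards [Lp.coeFn_add f₁ f₂] with g hg
    rw [hg, Pi.add_apply, add_smul]
  map_smul' c f := by
    apply Subtype.ext
    funext π
    apply ContinuousLinearMap.ext
    intro ξ
    change π.integrated μ (c • f) ξ = c • π.integrated μ f ξ
    simp only [UnitaryRep.integrated_apply]
    rw [← integral_smul]
    refine integral_congr_ae ?_
    filter_upwards [Lp.coeFn_smul c f] with g hg
    rw [hg, Pi.smul_apply, smul_eq_mul, mul_smul]

/-- The full group C*-algebra `C*(G)` (for a left Haar measure `μ`): the completion of `L¹(G)`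
for the norm `sup_π ‖π(f)‖`, realized as the norm closure of the image of `L¹(G)` in the
C*-algebra of bounded families of operators over all unitary representations. Its product,
involution and norm are those of the ambient C*-algebra. -/
def groupCStar (G : Type) [Group G] [TopologicalSpace G] [MeasurableSpace G]
    [BorelSpace G] [SecondCountableTopology G] (μ : Measure G) :
    Submodule ℂ (RepProduct G) :=
  (LinearMap.range (universalMap G μ)).topologicalClosure

/-- The extension of a unitary representation `π` to `C*(G)`. -/
def UnitaryRep.onCStar {G : Type} [Group G] [TopologicalSpace G] [MeasurableSpace G]
    [BorelSpace G] [SecondCountableTopology G] {μ : Measure G} (π : UnitaryRep G)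
    (F : groupCStar G μ) : π.H →L[ℂ] π.H :=
  (F : RepProduct G) π

/-! ## Operators on `L²(ℝ³)` -/

abbrev R3 : Type := ℝ × ℝ × ℝ

/-- `L²(ℝ³)` with Lebesgue measure. -/
abbrev L2R3 : Type := Lp ℂ 2 (volume : Measure R3)

/-- Multiplication by an essentially bounded function on `L²(ℝ³)`
(only used for such functions; zero otherwise). -/
def mulOp (f : R3 → ℂ) : L2R3 →L[ℂ] L2R3 :=
  open Classical in
  if h : MemLp f ∞ (volume : Measure R3) then
    (ContinuousLinearMap.mul ℂ ℂ).holderL volume ∞ 2 2 h.toLp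
  else 0

theorem mulOp_coeFn {f : R3 → ℂ} (h : MemLp f ∞ (volume : Measure R3)) (ξ : L2R3) :
    mulOp f ξ =ᵐ[volume] fun x => f x * ξ x := by
  have h1 : mulOp f ξ = (ContinuousLinearMap.mul ℂ ℂ).holder 2 h.toLp ξ := by
    rw [mulOp, dif_pos h]; rfl
  rw [h1]
  filter_upwards [(ContinuousLinearMap.mul ℂ ℂ).coeFn_holder (r := 2) h.toLp ξ,
    h.coeFn_toLp] with x hx hx'
  rw [hx, hx']; rfl

/-- The multiplication operator `M_S` with the characteristic function of `S`. -/
def indOp (S : Set R3) : L2R3 →L[ℂ] L2R3 := mulOp (S.indicator fun _ => 1)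

/-- The sum of a family of operators in the strong operator topology (zero if the family
is not summable there). -/
def strongSum {ι : Type} (f : ι → L2R3 →L[ℂ] L2R3) : L2R3 →L[ℂ] L2R3 :=
  open Classical in
  if h : ∃ T : L2R3 →L[ℂ] L2R3, ∀ ξ, HasSum (fun i => f i ξ) (T ξ) then h.choose else 0

/-- The distance of an operator to the compact operators. -/
def distCompact (T : L2R3 →L[ℂ] L2R3) : ℝ :=
  Metric.infDist T {K : L2R3 →L[ℂ] L2R3 | IsCompactOperator K}

/-! ## The group

The Lie algebra has the basis `A, B, P, Q, R, S` with the nonzero brackets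
`[P,Q] = R`, `[P,R] = S`, `[A,P] = P/2`, `[B,P] = -P/2`, `[B,Q] = Q`, `[A,R] = R/2`,
`[B,R] = R/2`, `[A,S] = S`. The triple `(a,b,p)` stands for
`E(a,b,p) = exp(aA) exp(bB) exp(pP)`, and `(q,r,s)` for `exp(qQ + rR + sS)`. -/

/-- `E(a,b,p) E(a',b',p') = E(a+a', b+b', e^{(-a'+b')/2} p + p')`. -/
def eMul (x y : R3) : R3 :=
  (x.1 + y.1, x.2.1 + y.2.1, Real.exp ((-y.1 + y.2.1) / 2) * x.2.2 + y.2.2)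

/-- The coordinates of `E(a,b,p)⁻¹`. -/
def eInv (x : R3) : R3 := (-x.1, -x.2.1, -(Real.exp ((x.1 - x.2.1) / 2) * x.2.2))

/-- `Ad(E(a,b,p)⁻¹)` on the abelian ideal `𝔥` spanned by `Q, R, S`:
`Q ↦ e^{-b} (Q - p R + (p²/2) S)`, `R ↦ e^{-(a+b)/2} (R - p S)`, `S ↦ e^{-a} S`. -/
def adInv (x y : R3) : R3 :=
  (Real.exp (-x.2.1) * y.1,
   Real.exp (-(x.1 + x.2.1) / 2) * y.2.1 - Real.exp (-x.2.1) * x.2.2 * y.1,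
   Real.exp (-x.1) * y.2.2 - Real.exp (-(x.1 + x.2.1) / 2) * x.2.2 * y.2.1
     + Real.exp (-x.2.1) * (x.2.2 ^ 2 / 2) * y.1)

/-- The coadjoint action `Ad*(E(a,b,p))` on `𝔥*`, where `l = (l_Q, l_R, l_S)` stands for
`l_Q Q* + l_R R* + l_S S*`. -/
def coad (x l : R3) : R3 :=
  (Real.exp (-x.2.1) * (l.1 - x.2.2 * l.2.1 + x.2.2 ^ 2 / 2 * l.2.2),
   Real.exp (-(x.1 + x.2.1) / 2) * (l.2.1 - x.2.2 * l.2.2),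
   Real.exp (-x.1) * l.2.2)

/-- The pairing of `𝔥*` with `𝔥`. -/
def pair (l y : R3) : ℝ := l.1 * y.1 + l.2.1 * y.2.1 + l.2.2 * y.2.2

theorem pair_coad (x l y : R3) : pair (coad x l) y = pair l (adInv x y) := by
  simp only [pair, coad, adInv]; ring

theorem eMul_assoc (x y z : R3) : eMul (eMul x y) z = eMul x (eMul y z) := by
  simp only [eMul, Prod.mk.injEq]
  refine ⟨by ring, by ring, ?_⟩
  have : Real.exp ((-(y.1 + z.1) + (y.2.1 + z.2.1)) / 2)
      = Real.exp ((-z.1 + z.2.1) / 2) * Real.exp ((-y.1 + y.2.1) / 2) := by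
    rw [← Real.exp_add]; congr 1; ring
  rw [this]; ring

theorem eMul_zero (x : R3) : eMul x 0 = x := by simp [eMul]

theorem zero_eMul (x : R3) : eMul 0 x = x := by simp [eMul]

theorem eInv_eMul (x : R3) : eMul (eInv x) x = 0 := by
  have : Real.exp ((-x.1 + x.2.1) / 2) * Real.exp ((x.1 - x.2.1) / 2) = 1 := by
    rw [← Real.exp_add, ← Real.exp_zero]; congr 1; ring
  ext
  · simp [eMul, eInv]
  · simp [eMul, eInv]
  · simp only [eMul, eInv, Prod.snd_zero]
    linear_combination (-x.2.2) * this

theorem eMul_eInv (x : R3) : eMul x (eInv x) = 0 := by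
  have h := eInv_eMul (eInv x)
  have h2 : eInv (eInv x) = x := by
    calc eInv (eInv x) = eMul (eInv (eInv x)) (eMul (eInv x) x) := by
          rw [eInv_eMul, eMul_zero]
      _ = x := by rw [← eMul_assoc, h, zero_eMul]
  rwa [h2] at h

theorem adInv_zero_left (y : R3) : adInv 0 y = y := by simp [adInv]

theorem adInv_add (x y z : R3) : adInv x (y + z) = adInv x y + adInv x z := by
  ext <;> simp only [adInv, Prod.fst_add, Prod.snd_add] <;> ring

theorem adInv_zero (x : R3) : adInv x 0 = 0 := by simp [adInv]

theorem adInv_eMul (x y z : R3) : adInv (eMul x y) z = adInv y (adInv x z) := by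
  have e1 : Real.exp (-(x.2.1 + y.2.1)) = Real.exp (-x.2.1) * Real.exp (-y.2.1) := by
    rw [← Real.exp_add]; congr 1; ring
  have e2 : Real.exp (-(x.1 + y.1)) = Real.exp (-x.1) * Real.exp (-y.1) := by
    rw [← Real.exp_add]; congr 1; ring
  have e3 : Real.exp (-(x.1 + y.1 + (x.2.1 + y.2.1)) / 2)
      = Real.exp (-(x.1 + x.2.1) / 2) * Real.exp (-(y.1 + y.2.1) / 2) := by
    rw [← Real.exp_add]; congr 1; ring
  have e4 : Real.exp (-y.2.1) * Real.exp ((-y.1 + y.2.1) / 2)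
      = Real.exp (-(y.1 + y.2.1) / 2) := by
    rw [← Real.exp_add]; congr 1; ring
  have e5 : Real.exp (-(y.1 + y.2.1) / 2) * Real.exp ((-y.1 + y.2.1) / 2)
      = Real.exp (-y.1) := by
    rw [← Real.exp_add]; congr 1; ring
  ext
  · simp only [adInv, eMul, e1]; ring
  · simp only [adInv, eMul, e1, e3]
    rw [← e4]; ring
  · simp only [adInv, eMul, e1, e2, e3]
    rw [← e5, ← e4]; ring

/-- The simply connected group of the Lie algebra above: the point `(x, y)` stands for
`E(x) exp(y)`. -/
def G6 : Type := R3 × R3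

instance : TopologicalSpace G6 := inferInstanceAs (TopologicalSpace (R3 × R3))
instance : SecondCountableTopology G6 := inferInstanceAs (SecondCountableTopology (R3 × R3))
instance : MeasureSpace G6 := inferInstanceAs (MeasureSpace (R3 × R3))
instance : BorelSpace G6 := inferInstanceAs (BorelSpace (R3 × R3))

/-- The point `E(x) exp(y)`. -/
def G6.mk (x y : R3) : G6 := Prod.mk x y
def G6.x (g : G6) : R3 := Prod.fst (α := R3) (β := R3) g
def G6.y (g : G6) : R3 := Prod.snd (α := R3) (β := R3) g

theorem G6.x_mk (x y : R3) : (G6.mk x y).x = x := rfl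
theorem G6.y_mk (x y : R3) : (G6.mk x y).y = y := rfl
theorem G6.continuous_x : Continuous G6.x := (continuous_fst : Continuous (Prod.fst : R3 × R3 → R3))
theorem G6.continuous_y : Continuous G6.y := (continuous_snd : Continuous (Prod.snd : R3 × R3 → R3))

/-- `E(x) exp(y) E(x') exp(y') = E(x) E(x') exp(Ad(E(x')⁻¹) y + y')`. -/
instance : Mul G6 := ⟨fun g h => G6.mk (eMul g.x h.x) (adInv h.x g.y + h.y)⟩
instance : One G6 := ⟨G6.mk 0 0⟩
instance : Inv G6 := ⟨fun g => G6.mk (eInv g.x) (-adInv (eInv g.x) g.y)⟩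

theorem G6.ext' {g h : G6} (h1 : g.x = h.x) (h2 : g.y = h.y) : g = h := Prod.ext h1 h2
theorem G6.x_mul (g h : G6) : (g * h).x = eMul g.x h.x := rfl
theorem G6.y_mul (g h : G6) : (g * h).y = adInv h.x g.y + h.y := rfl
theorem G6.x_one : (1 : G6).x = 0 := rfl
theorem G6.y_one : (1 : G6).y = 0 := rfl
theorem G6.x_inv (g : G6) : (g⁻¹).x = eInv g.x := rfl
theorem G6.y_inv (g : G6) : (g⁻¹).y = -adInv (eInv g.x) g.y := rfl

instance : Group G6 :=
  Group.ofLeftAxioms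
    (fun g h k => G6.ext' (by simp only [G6.x_mul, eMul_assoc])
      (by simp only [G6.x_mul, G6.y_mul, adInv_add, adInv_eMul, add_assoc]))
    (fun g => G6.ext' (by simp only [G6.x_mul, G6.x_one, zero_eMul])
      (by simp only [G6.y_mul, G6.y_one, adInv_zero, zero_add]))
    (fun g => G6.ext' (by simp only [G6.x_mul, G6.x_inv, G6.x_one, eInv_eMul]) (by
      simp only [G6.y_mul, G6.y_inv, G6.y_one]
      have h : adInv g.x (-adInv (eInv g.x) g.y) + adInv g.x (adInv (eInv g.x) g.y) = 0 := by
        rw [← adInv_add, neg_add_cancel, adInv_zero]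
      rwa [← adInv_eMul, eInv_eMul, adInv_zero_left] at h))

theorem measurePreserving_eMul (x : R3) :
    MeasurePreserving (eMul x) (volume : Measure R3) volume := by
  have h1 : ∀ a : ℝ, MeasurePreserving
      (fun z : ℝ × ℝ => (x.2.1 + z.1, Real.exp ((-a + z.1) / 2) * x.2.2 + z.2)) := fun a =>
    (measurePreserving_add_left (volume : Measure ℝ) x.2.1).skew_product
      (g := fun b p => Real.exp ((-a + b) / 2) * x.2.2 + p)
      (by unfold Function.uncurry; fun_prop)
      (Eventually.of_forall fun b => (measurePreserving_add_left (volume : Measure ℝ) _).map_eq)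
  exact (measurePreserving_add_left (volume : Measure ℝ) x.1).skew_product
    (g := fun (a : ℝ) (z : ℝ × ℝ) =>
      (x.2.1 + z.1, Real.exp ((-a + z.1) / 2) * x.2.2 + z.2))
    (by unfold Function.uncurry; fun_prop)
    (Eventually.of_forall fun a => (h1 a).map_eq)

theorem measurePreserving_addR3 (z : R3) :
    MeasurePreserving (fun y : R3 => z + y) (volume : Measure R3) volume :=
  (measurePreserving_add_left (volume : Measure ℝ) z.1).prod
    ((measurePreserving_add_left (volume : Measure ℝ) z.2.1).prod
      (measurePreserving_add_left (volume : Measure ℝ) z.2.2))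

/-- Lebesgue measure in the above coordinates is a left Haar measure. -/
instance : (volume : Measure G6).IsMulLeftInvariant where
  map_mul_left_eq_self g := by
    have h := (measurePreserving_eMul g.x).skew_product (μb := volume) (μd := volume)
      (g := fun x y => adInv x g.y + y) (by unfold Function.uncurry adInv; fun_prop)
      (Eventually.of_forall fun x => (measurePreserving_addR3 (adInv x g.y)).map_eq)
    exact h.map_eq

/-- The C*-algebra `C*(G)` of the group. -/
abbrev CStarG6 : Type 1 := groupCStar G6 volume

/-! ## The representations `σ_l = ind_H^G χ_l` -/

theorem continuous_eMul : Continuous fun z : R3 × R3 => eMul z.1 z.2 := by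
  unfold eMul; fun_prop

theorem continuous_eInv : Continuous eInv := by
  unfold eInv; fun_prop

/-- The function `h ↦ χ_{Ad*(x⁻¹h) l}(y) = exp(i ⟨Ad*(x⁻¹h) l, y⟩)` for `g = E(x) exp(y)`. -/
def phase (l : R3) (g : G6) (h : R3) : ℂ :=
  Complex.exp (Complex.I * (pair (coad (eMul (eInv g.x) h) l) g.y : ℝ))

theorem norm_phase (l : R3) (g : G6) (h : R3) : ‖phase l g h‖ = 1 := by
  rw [phase, mul_comm, Complex.norm_exp_ofReal_mul_I]

theorem continuous_phase (l : R3) : Continuous fun z : G6 × R3 => phase l z.1 z.2 := by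
  have h1 : Continuous fun z : G6 × R3 => z.1.x := G6.continuous_x.comp continuous_fst
  have h2 : Continuous fun z : G6 × R3 => z.1.y := G6.continuous_y.comp continuous_fst
  unfold phase pair coad eMul eInv; fun_prop

theorem tendsto_phase (l : R3) (g₀ : G6) (h : R3) :
    Tendsto (fun g : G6 => phase l g h) (𝓝 g₀) (𝓝 (phase l g₀ h)) := by
  have h1 : Continuous fun g : G6 => ((g, h) : G6 × R3) := Continuous.prodMk_left h
  exact ((continuous_phase l).comp h1).tendsto g₀

theorem memLp_phase (l : R3) (g : G6) : MemLp (phase l g) ∞ (volume : Measure R3) := by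
  refine memLp_top_of_bound ?_ 1 (Eventually.of_forall fun h => (norm_phase l g h).le)
  exact ((continuous_phase l).comp (Continuous.prodMk continuous_const continuous_id :
    Continuous fun h : R3 => (g, h))).aestronglyMeasurable

/-- Left translation `(λ(x) ξ)(h) = ξ(x⁻¹h)` on `L²(ℝ³)`. -/
def transOp (x : R3) : L2R3 →ₗᵢ[ℂ] L2R3 :=
  Lp.compMeasurePreservingₗᵢ ℂ (eMul (eInv x)) (measurePreserving_eMul _)

theorem transOp_coeFn (x : R3) (ξ : L2R3) :
    transOp x ξ =ᵐ[volume] fun h => ξ (eMul (eInv x) h) :=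
  Lp.coeFn_compMeasurePreserving ξ (measurePreserving_eMul _)

/-- The operator `(σ_l(g) ξ)(h) = χ_{Ad*(x⁻¹h) l}(y) ξ(x⁻¹h)` for `g = E(x) exp(y)`. -/
def sigmaOp (l : R3) (g : G6) : L2R3 →ₗᵢ[ℂ] L2R3 where
  toLinearMap := (mulOp (phase l g)).toLinearMap ∘ₗ (transOp g.x).toLinearMap
  norm_map' ξ := by
    rw [← (transOp g.x).norm_map ξ, Lp.norm_def, Lp.norm_def]
    congr 1
    refine eLpNorm_congr_norm_ae ?_
    filter_upwards [mulOp_coeFn (memLp_phase l g) (transOp g.x ξ)] with h hh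
    change ‖mulOp (phase l g) (transOp g.x ξ) h‖ = _
    rw [hh, norm_mul, norm_phase, one_mul]

theorem sigmaOp_coeFn (l : R3) (g : G6) (ξ : L2R3) :
    sigmaOp l g ξ =ᵐ[volume] fun h => phase l g h * ξ (eMul (eInv g.x) h) := by
  filter_upwards [mulOp_coeFn (memLp_phase l g) (transOp g.x ξ), transOp_coeFn g.x ξ]
    with h h1 h2
  change mulOp (phase l g) (transOp g.x ξ) h = _
  rw [h1, h2]

theorem eInv_eMul_rev (x y : R3) : eInv (eMul x y) = eMul (eInv y) (eInv x) := by
  calc eInv (eMul x y)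
      = eMul (eInv (eMul x y)) (eMul (eMul x y) (eMul (eInv y) (eInv x))) := by
        rw [eMul_assoc x, ← eMul_assoc y, eMul_eInv, zero_eMul, eMul_eInv, eMul_zero]
    _ = eMul (eInv y) (eInv x) := by rw [← eMul_assoc, eInv_eMul, zero_eMul]

theorem sigmaOp_one (l : R3) : sigmaOp l 1 = 1 := by
  refine LinearIsometry.ext fun ξ => Lp.ext ?_
  filter_upwards [sigmaOp_coeFn l 1 ξ] with h hh
  have h0 : eInv 0 = 0 := by simp [eInv]
  rw [hh]
  simp only [G6.x_one, h0, zero_eMul]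
  simp [phase, pair, G6.y_one]

theorem sigmaOp_mul (l : R3) (g k : G6) : sigmaOp l (g * k) = sigmaOp l g * sigmaOp l k := by
  refine LinearIsometry.ext fun ξ => Lp.ext ?_
  have h1 := (measurePreserving_eMul (eInv g.x)).quasiMeasurePreserving.ae
    (sigmaOp_coeFn l k ξ)
  filter_upwards [sigmaOp_coeFn l (g * k) ξ, sigmaOp_coeFn l g (sigmaOp l k ξ), h1]
    with h e1 e2 e3
  change sigmaOp l (g * k) ξ h = sigmaOp l g (sigmaOp l k ξ) h
  have e4 : eMul (eInv (eMul g.x k.x)) h = eMul (eInv k.x) (eMul (eInv g.x) h) := by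
    rw [eInv_eMul_rev, eMul_assoc]
  rw [e1, e2, e3]
  rw [G6.x_mul, e4, ← mul_assoc]
  congr 1
  simp only [phase, pair_coad, G6.x_mul, G6.y_mul]
  rw [e4, ← Complex.exp_add, ← mul_add, ← Complex.ofReal_add, adInv_add, ← adInv_eMul k.x,
    ← eMul_assoc k.x, eMul_eInv, zero_eMul]
  congr 3
  simp only [pair, Prod.fst_add, Prod.snd_add]
  ring

theorem continuous_transOp (ξ : L2R3) : Continuous fun g : G6 => transOp g.x ξ := by
  have hc : Continuous fun z : G6 × R3 => eMul (eInv z.1.x) z.2 :=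
    continuous_eMul.comp ((continuous_eInv.comp (G6.continuous_x.comp continuous_fst)).prodMk continuous_snd)
  exact (continuous_const (y := ξ)).compMeasurePreservingLp (Z := G6)
    (ContinuousMap.curry ⟨_, hc⟩).continuous 
    (fun g => measurePreserving_eMul (eInv g.x)) (by norm_num)

theorem tendsto_mulOp_phase (l : R3) (g₀ : G6) (η : L2R3) :
    Tendsto (fun g : G6 => mulOp (phase l g) η) (𝓝 g₀) (𝓝 (mulOp (phase l g₀) η)) := by
  rw [tendsto_iff_norm_sub_tendsto_zero]
  have key : Tendsto (fun g : G6 => ∫⁻ h, ‖(phase l g h - phase l g₀ h) * η h‖ₑ ^ (2 : ℝ))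
      (𝓝 g₀) (𝓝 (∫⁻ _ : R3, 0)) := by
    have hη : MemLp (fun h => η h) 2 (volume : Measure R3) := Lp.memLp η
    have hm : ∀ g : G6, AEStronglyMeasurable (phase l g) (volume : Measure R3) :=
      fun g => (memLp_phase l g).aestronglyMeasurable
    refine tendsto_lintegral_filter_of_dominated_convergence'
      (fun h => (2 * ‖η h‖ₑ) ^ (2 : ℝ)) (Eventually.of_forall fun g => ?_)
      (Eventually.of_forall fun g => Eventually.of_forall fun h => ?_) ?_
      (Eventually.of_forall fun h => ?_)
    · exact ((((hm g).sub (hm g₀)).mul hη.aestronglyMeasurable).enorm).pow_const _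
    · refine ENNReal.rpow_le_rpow ?_ (by norm_num)
      rw [enorm_mul]
      gcongr
      refine (enorm_sub_le).trans ?_
      have : ∀ g : G6, ‖phase l g h‖ₑ = 1 := fun g => by
        rw [← ofReal_norm, norm_phase, ENNReal.ofReal_one]
      rw [this, this, one_add_one_eq_two]
    · have := hη.2
      rw [eLpNorm_lt_top_iff_lintegral_rpow_enorm_lt_top (by norm_num) (by norm_num)] at this
      simp only [ENNReal.mul_rpow_of_nonneg _ _ (zero_le_two : (0 : ℝ) ≤ 2)]
      rw [lintegral_const_mul' _ _ (by norm_num)]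
      exact ENNReal.mul_ne_top (by norm_num) (by simpa using this.ne)
    · have hd := (((tendsto_phase l g₀ h).sub_const (phase l g₀ h)).mul_const
        (η h)).enorm.ennrpow_const (2 : ℝ)
      rwa [sub_self, zero_mul, enorm_zero, ENNReal.zero_rpow_of_pos zero_lt_two] at hd
  have key2 := (ENNReal.tendsto_toReal (by simp)).comp
    ((ENNReal.continuous_rpow_const (y := (1 / 2 : ℝ))).tendsto _ |>.comp key)
  simp only [lintegral_zero, ENNReal.zero_rpow_of_pos (by norm_num : (0 : ℝ) < 1 / 2),
    ENNReal.toReal_zero] at key2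
  refine key2.congr fun g => ?_
  rw [Lp.norm_def, eLpNorm_eq_lintegral_rpow_enorm_toReal (by norm_num) (by norm_num)]
  simp only [Function.comp_apply, ENNReal.toReal_ofNat]
  congr 2
  refine lintegral_congr_ae ?_
  filter_upwards [Lp.coeFn_sub (mulOp (phase l g) η) (mulOp (phase l g₀) η),
    mulOp_coeFn (memLp_phase l g) η, mulOp_coeFn (memLp_phase l g₀) η] with h h1 h2 h3
  rw [h1, Pi.sub_apply, h2, h3, sub_mul]

theorem continuous_sigmaOp (l : R3) (ξ : L2R3) : Continuous fun g : G6 => sigmaOp l g ξ := by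
  rw [continuous_iff_continuousAt]
  intro g₀
  have h1 := tendsto_mulOp_phase l g₀ (transOp g₀.x ξ)
  have h2 : Tendsto (fun g : G6 => sigmaOp l g ξ - mulOp (phase l g) (transOp g₀.x ξ))
      (𝓝 g₀) (𝓝 0) := by
    rw [tendsto_zero_iff_norm_tendsto_zero]
    have h3 := tendsto_iff_norm_sub_tendsto_zero.1 ((continuous_transOp ξ).tendsto g₀)
    refine h3.congr fun g => ?_
    change _ = ‖mulOp (phase l g) (transOp g.x ξ) - mulOp (phase l g) (transOp g₀.x ξ)‖
    rw [← map_sub, Lp.norm_def, Lp.norm_def]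
    congr 1
    refine eLpNorm_congr_norm_ae ?_
    filter_upwards [mulOp_coeFn (memLp_phase l g) (transOp g.x ξ - transOp g₀.x ξ)] with h hh
    rw [hh, norm_mul, norm_phase, one_mul]
  have h4 := h2.add h1
  simp only [sub_add_cancel, zero_add] at h4
  exact h4

/-- The representation `σ_l = ind_H^G χ_l`, `l ∈ 𝔥*`, realized on `L²(G/H) = L²(ℝ³)`. -/
def sigmaRep (l : R3) : UnitaryRep G6 where
  H := L2R3
  toHom := { toFun := sigmaOp l, map_one' := sigmaOp_one l, map_mul' := sigmaOp_mul l }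
  continuous_apply := continuous_sigmaOp l

/-- The operator `σ_l(F)` on `L²(ℝ³)`, for `F ∈ C*(G)`. -/
def sigma (l : R3) (F : CStarG6) : L2R3 →L[ℂ] L2R3 := (sigmaRep l).onCStar F

/-! ## The regions and the operators `σ_{ε,-ε,δ}(F)` -/

/-- The interval `I_{c,k} = [ck, ck + c)`. -/
def Iset (c : ℝ) (k : ℤ) : Set ℝ := Ico (c * k) (c * k + c)

def Jset (δ : ℝ) (k : ℤ) : Set R3 :=
  Ici (Real.log (1 / δ ^ 6)) ×ˢ Iic (Real.log (1 / δ)) ×ˢ Iset (δ ^ 2) k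

def Lset (δ : ℝ) (k : ℤ) : Set R3 := univ ×ˢ univ ×ˢ Iset (δ ^ 2) k

def S1 (δ : ℝ) : Set R3 := {x | δ ^ 6 < Real.exp (-x.1)}

def S2 (δ : ℝ) : Set R3 := {x | Real.exp (-x.1) ≤ δ ^ 6 ∧ Real.exp (-x.2.1) < δ}

def S3plus (ε δ : ℝ) (k : ℤ) : Set R3 :=
  Jset δ k ∩ {x | δ ^ (1 / 2 : ℝ) < ε * Real.exp (-x.2.1 / 2) * (1 - x.2.2 ^ 2 / 2) ∧
    δ ≤ Real.exp (-x.2.1) ∧ Real.exp (-x.2.1) ≤ 1 / δ ^ (5 / 4 : ℝ)}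

def S3minus (ε δ : ℝ) (k : ℤ) : Set R3 :=
  Jset δ k ∩ {x | ε * Real.exp (-x.2.1 / 2) * (1 - x.2.2 ^ 2 / 2) < -δ ^ (1 / 2 : ℝ) ∧
    δ ≤ Real.exp (-x.2.1) ∧ Real.exp (-x.2.1) ≤ 1 / δ ^ (5 / 4 : ℝ)}

/-- The region `S_{δ,4,±}`; the sign is `τ = ±1`. -/
def S4 (τ δ : ℝ) : Set R3 :=
  {x | Real.exp (-x.1) < δ ^ 6 ∧ δ ≤ Real.exp (-x.2.1) ∧
    Real.exp (-x.2.1 / 2) * |x.2.2 ^ 2 / 2 - 1| ≤ δ ^ (1 / 2 : ℝ) ∧ τ * x.2.2 ≤ 0}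

/-- `T_{δ,3,k} = L_{δ,k-1} ∪ L_{δ,k} ∪ L_{δ,k+1}`. -/
def T3 (δ : ℝ) (k : ℤ) : Set R3 := Lset δ (k - 1) ∪ Lset δ k ∪ Lset δ (k + 1)

/-- The terms of the series `σ_{δ,3}(F)`. -/
def sigma3Term (ε δ : ℝ) (F : CStarG6) (k : ℤ) : L2R3 →L[ℂ] L2R3 :=
  indOp (T3 δ k) ∘L sigma (ε * (-1 + δ ^ 4 * (k : ℝ) ^ 2 / 2), 0, 0) F ∘L
    (indOp (S3plus ε δ k) + indOp (S3minus ε δ k))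

/-- `σ_{δ,4,±}(F) = σ_{ε(±√2 R* - 2Q*)}(F) ∘ M_{δ,4,±}`; the sign is `τ = ±1`. -/
def sigma4 (ε τ δ : ℝ) (F : CStarG6) : L2R3 →L[ℂ] L2R3 :=
  sigma (ε * -2, ε * (τ * √2), 0) F ∘L indOp (S4 τ δ)

/-- The operator `σ_{ε,-ε,δ}(F)`. -/
def sigmaDelta (ε : ℝ) (φ : ℝ → ℝ) (δ : ℝ) (F : CStarG6) : L2R3 →L[ℂ] L2R3 :=
  sigma (0, 0, ε) F ∘L mulOp (fun x => (φ (-Real.exp (-x.2.1)) : ℂ)) ∘L indOp (S1 δ)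
  + sigma (0, 0, ε) F ∘L indOp (S2 δ)
  + strongSum (sigma3Term ε δ F)
  + sigma4 ε 1 δ F + sigma4 ε (-1) δ F

end

noncomputable section

/-! ## Multiplication operators -/

/-! Everything rests on a factorisation. If F is the indicator of a rectangle {E(x) exp(y) : x ∈ A,
y ∈ B}, integrating over y first gives σ_l(F) = Λ_A M_ψ, where Λ_A = ∫_A λ(x) dx does not depend on
l and ψ(u) is the Fourier transform of 1_B at Ad*(u)l (`sigma_ofL1_indicator`). When δ is small
compared with the size of A, the operator σ_{ε,-ε,δ}(F) factors through the same Λ_A, with a symbol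
defined region by region (`sigmaDelta_rect`). The outer cutoffs to T_{δ,3,k} then disappear, because
left translation by x ∈ A moves S_{δ,3,k} by at most one strip in the p direction (`eMul_mem_T3`).
So the difference to be estimated is Λ_A M_θ.

If θ is bounded with bounded support, Λ_A M_θ has a square integrable kernel and is compact
(`isCompactOperator_transInt_mulOp`). Hence its distance to the compact operators is at most ‖Λ_A‖
times an essential bound of |θ| outside a ball, and it suffices that |θ| ≤ η there. The Fourier
transform of 1_B is Lipschitz and vanishes at infinity, so two symbols agree up to η wherever the
two functionals on the orbits are close or are both large. This is checked on each region, starting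
from Ad*(E(a,b,p)) ε(S*-Q*) = ε(e^{-b}(p²/2-1), -e^{-(a+b)/2}p, e^{-a})
(`exists_norm_sub_symbolDelta_le`).

The span of indicators of bounded rectangles is dense in L¹(G), which is dense in C*(G), and
‖σ_{ε,-ε,δ}(F)‖ ≤ 7‖F‖ for every δ, so the limit extends to all F.

For the norm estimate, right translation by E(a,a,p) is unitary and intertwines σ_l with
σ_{Ad*(E(a,a,p))l}. This reduces all functionals in the definition to ±Q*, ±R*, εS* and 0, and σ_0
is a strong limit along multiples of Q*. The series over k splits into three series whose terms have
orthogonal ranges and orthogonal initial spaces (`exists_hasSum_blocks`). -/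

theorem memLp_top_of_measurable {f : R3 → ℂ} (hf : Measurable f) {C : ℝ} (hC : ∀ x, ‖f x‖ ≤ C) :
    MemLp f ∞ (volume : Measure R3) :=
  memLp_top_of_bound hf.aestronglyMeasurable C (Eventually.of_forall hC)

theorem norm_indicator_one_le (S : Set R3) (x : R3) : ‖S.indicator (fun _ => (1 : ℂ)) x‖ ≤ 1 := by
  by_cases h : x ∈ S <;> simp [h]

theorem memLp_top_indicator {S : Set R3} (hS : MeasurableSet S) :
    MemLp (S.indicator fun _ => (1 : ℂ)) ∞ (volume : Measure R3) :=
  memLp_top_of_measurable (measurable_const.indicator hS) (norm_indicator_one_le S)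

theorem mulOp_congr {f g : R3 → ℂ} (hf : MemLp f ∞ (volume : Measure R3))
    (h : f =ᵐ[volume] g) : mulOp f = mulOp g := by
  have hg : MemLp g ∞ (volume : Measure R3) := (memLp_congr_ae h).1 hf
  refine ContinuousLinearMap.ext fun ξ => Lp.ext ?_
  filter_upwards [mulOp_coeFn hf ξ, mulOp_coeFn hg ξ, h] with x h1 h2 h3
  rw [h1, h2, h3]

theorem mulOp_mulOp {f g : R3 → ℂ} (hf : MemLp f ∞ (volume : Measure R3))
    (hg : MemLp g ∞ (volume : Measure R3)) : mulOp f ∘L mulOp g = mulOp (fun x => f x * g x) := by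
  have hfg : MemLp (fun x => f x * g x) ∞ (volume : Measure R3) := hg.mul hf
  refine ContinuousLinearMap.ext fun ξ => Lp.ext ?_
  filter_upwards [mulOp_coeFn hf (mulOp g ξ), mulOp_coeFn hg ξ, mulOp_coeFn hfg ξ] with x h1 h2 h3
  rw [ContinuousLinearMap.comp_apply, h1, h2, h3, mul_assoc]

theorem mulOp_add {f g : R3 → ℂ} (hf : MemLp f ∞ (volume : Measure R3))
    (hg : MemLp g ∞ (volume : Measure R3)) : mulOp f + mulOp g = mulOp (fun x => f x + g x) := by
  have hfg : MemLp (fun x => f x + g x) ∞ (volume : Measure R3) := hf.add hg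
  refine ContinuousLinearMap.ext fun ξ => Lp.ext ?_
  filter_upwards [mulOp_coeFn hf ξ, mulOp_coeFn hg ξ, mulOp_coeFn hfg ξ,
    Lp.coeFn_add (mulOp f ξ) (mulOp g ξ)] with x h1 h2 h3 h4
  rw [add_apply, h4, Pi.add_apply, h1, h2, h3, add_mul]

theorem mulOp_sub {f g : R3 → ℂ} (hf : MemLp f ∞ (volume : Measure R3))
    (hg : MemLp g ∞ (volume : Measure R3)) : mulOp f - mulOp g = mulOp (fun x => f x - g x) := by
  have hfg : MemLp (fun x => f x - g x) ∞ (volume : Measure R3) := hf.sub hg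
  refine ContinuousLinearMap.ext fun ξ => Lp.ext ?_
  filter_upwards [mulOp_coeFn hf ξ, mulOp_coeFn hg ξ, mulOp_coeFn hfg ξ,
    Lp.coeFn_sub (mulOp f ξ) (mulOp g ξ)] with x h1 h2 h3 h4
  rw [sub_apply, h4, Pi.sub_apply, h1, h2, h3, sub_mul]

theorem norm_mulOp_le {f : R3 → ℂ} (hf : MemLp f ∞ (volume : Measure R3)) {C : ℝ} (hC0 : 0 ≤ C)
    (hC : ∀ᵐ x, ‖f x‖ ≤ C) : ‖mulOp f‖ ≤ C := by
  refine ContinuousLinearMap.opNorm_le_bound _ hC0 fun ξ => ?_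
  refine Lp.norm_le_mul_norm_of_ae_le_mul ?_
  filter_upwards [mulOp_coeFn hf ξ, hC] with x h1 h2
  rw [h1, norm_mul]
  gcongr

theorem indOp_coeFn {S : Set R3} (hS : MeasurableSet S) (ξ : L2R3) :
    indOp S ξ =ᵐ[volume] fun x => S.indicator (fun _ => (1 : ℂ)) x * ξ x :=
  mulOp_coeFn (memLp_top_indicator hS) ξ

theorem norm_indOp_le {S : Set R3} (hS : MeasurableSet S) : ‖indOp S‖ ≤ 1 :=
  norm_mulOp_le (memLp_top_indicator hS) zero_le_one
    (Eventually.of_forall (norm_indicator_one_le S))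

theorem indOp_add {S T : Set R3} (hS : MeasurableSet S) (hT : MeasurableSet T)
    (h : Disjoint S T) : indOp S + indOp T = indOp (S ∪ T) := by
  rw [indOp, indOp, mulOp_add (memLp_top_indicator hS) (memLp_top_indicator hT), indOp,
    indicator_union_of_disjoint h]

theorem indOp_comp {S T : Set R3} (hS : MeasurableSet S) (hT : MeasurableSet T) :
    indOp S ∘L indOp T = indOp (S ∩ T) := by
  rw [indOp, indOp, mulOp_mulOp (memLp_top_indicator hS) (memLp_top_indicator hT), indOp]
  congr 1
  funext x
  by_cases h1 : x ∈ S <;> by_cases h2 : x ∈ T <;> simp [h1, h2]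

theorem indOp_empty : indOp ∅ = 0 := by
  refine ContinuousLinearMap.ext fun ξ => Lp.ext ?_
  filter_upwards [indOp_coeFn MeasurableSet.empty ξ, Lp.coeFn_zero ℂ 2 (volume : Measure R3)]
    with x h1 h2
  rw [h1, zero_apply, h2]
  simp

theorem inner_indOp_indOp {S T : Set R3} (hS : MeasurableSet S) (hT : MeasurableSet T)
    (h : Disjoint S T) (ξ η : L2R3) : inner ℂ (indOp S ξ) (indOp T η) = 0 := by
  rw [L2.inner_def]
  refine integral_eq_zero_of_ae ?_
  filter_upwards [indOp_coeFn hS ξ, indOp_coeFn hT η] with x h1 h2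
  rw [h1, h2]
  by_cases hx : x ∈ S
  · simp [disjoint_left.1 h hx]
  · simp [hx]

/-! ## Orthogonal series -/

theorem norm_sq_sum_of_orthogonal {ι H : Type*} [NormedAddCommGroup H] [InnerProductSpace ℂ H]
    {v : ι → H} (hv : Pairwise fun i j => inner ℂ (v i) (v j) = 0) (s : Finset ι) :
    ‖∑ i ∈ s, v i‖ ^ 2 = ∑ i ∈ s, ‖v i‖ ^ 2 := by
  classical
  induction s using Finset.induction_on with
  | empty => simp
  | insert i s hi ih =>
    rw [Finset.sum_insert hi, Finset.sum_insert hi, ← ih, sq, sq, sq]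
    refine norm_add_sq_eq_norm_sq_add_norm_sq_of_inner_eq_zero (𝕜 := ℂ) _ _ ?_
    rw [inner_sum]
    exact Finset.sum_eq_zero fun j hj => hv (ne_of_mem_of_not_mem hj hi).symm

/-- Pythagoras turns the Cauchy criterion for the squared norms into the one for the vectors. -/
theorem summable_of_orthogonal {ι H : Type*} [NormedAddCommGroup H] [InnerProductSpace ℂ H]
    [CompleteSpace H] {v : ι → H} (hv : Pairwise fun i j => inner ℂ (v i) (v j) = 0)
    (hs : Summable fun i => ‖v i‖ ^ 2) : Summable v := by
  rw [summable_iff_vanishing_norm] at hs ⊢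
  intro e he
  obtain ⟨s, h⟩ := hs (e ^ 2) (by positivity)
  refine ⟨s, fun t ht => ?_⟩
  have h1 := h t ht
  rw [← norm_sq_sum_of_orthogonal hv, Real.norm_of_nonneg (by positivity)] at h1
  exact lt_of_pow_lt_pow_left₀ 2 he.le h1

section Blocks

variable {ι : Type}

/-- Bessel's inequality: the finite sum of the projections is the projection onto the union of the
sets. -/
theorem sum_norm_sq_indOp_le {S : ι → Set R3} (hS : ∀ i, MeasurableSet (S i))
    (hd : Pairwise fun i j => Disjoint (S i) (S j)) (ξ : L2R3) (s : Finset ι) :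
    ∑ i ∈ s, ‖indOp (S i) ξ‖ ^ 2 ≤ ‖ξ‖ ^ 2 := by
  have h1 : ∑ i ∈ s, indOp (S i) ξ = indOp (⋃ i ∈ s, S i) ξ := by
    classical
    induction s using Finset.induction_on with
    | empty => simp [indOp_empty]
    | insert i s hi ih =>
      rw [Finset.sum_insert hi, ih, ← add_apply,
        indOp_add (hS i) (Finset.measurableSet_biUnion _ fun j _ => hS j), Finset.set_biUnion_insert]
      exact disjoint_iUnion₂_right.2 fun j hj => hd (ne_of_mem_of_not_mem hj hi).symm
  rw [← norm_sq_sum_of_orthogonal fun i j hij => inner_indOp_indOp (hS i) (hS j) (hd hij) ξ ξ, h1]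
  gcongr
  refine ((indOp _).le_opNorm ξ).trans ?_
  have := norm_indOp_le (Finset.measurableSet_biUnion s fun j _ => hS j)
  nlinarith [norm_nonneg ξ]

/-- The summands have pairwise orthogonal ranges and see pairwise orthogonal parts of ξ. The squared
norm of the sum is therefore at most m² ∑ ‖1_{S_i} ξ‖² ≤ m² ‖ξ‖², so the bound m does not grow with
the number of blocks. -/
theorem exists_hasSum_blocks {L S : ι → Set R3} (hL : ∀ i, MeasurableSet (L i))
    (hLd : Pairwise fun i j => Disjoint (L i) (L j)) (hS : ∀ i, MeasurableSet (S i))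
    (hSd : Pairwise fun i j => Disjoint (S i) (S j)) {A : ι → L2R3 →L[ℂ] L2R3} {m : ℝ}
    (hA : ∀ i, ‖A i‖ ≤ m) (hm : 0 ≤ m) :
    ∃ T : L2R3 →L[ℂ] L2R3, ‖T‖ ≤ m ∧
      ∀ ξ, HasSum (fun i => indOp (L i) (A i (indOp (S i) ξ))) (T ξ) := by
  have horth (ξ : L2R3) : Pairwise fun i j =>
      inner ℂ (indOp (L i) (A i (indOp (S i) ξ))) (indOp (L j) (A j (indOp (S j) ξ))) = 0 :=
    fun i j hij => inner_indOp_indOp (hL i) (hL j) (hLd hij) _ _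
  have hterm (ξ : L2R3) (i : ι) :
      ‖indOp (L i) (A i (indOp (S i) ξ))‖ ^ 2 ≤ m ^ 2 * ‖indOp (S i) ξ‖ ^ 2 := by
    rw [← mul_pow]
    gcongr
    have h1 := (indOp (L i)).le_of_opNorm_le (norm_indOp_le (hL i)) (A i (indOp (S i) ξ))
    have h2 := (A i).le_of_opNorm_le (hA i) (indOp (S i) ξ)
    linarith
  have hfin (ξ : L2R3) (s : Finset ι) :
      ∑ i ∈ s, ‖indOp (L i) (A i (indOp (S i) ξ))‖ ^ 2 ≤ (m * ‖ξ‖) ^ 2 := by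
    refine (Finset.sum_le_sum fun i _ => hterm ξ i).trans ?_
    rw [← Finset.mul_sum, mul_pow]
    gcongr
    exact sum_norm_sq_indOp_le hS hSd ξ s
  have hsum (ξ : L2R3) : Summable fun i => indOp (L i) (A i (indOp (S i) ξ)) :=
    summable_of_orthogonal (horth ξ)
      (summable_of_sum_le (fun i => by positivity) (hfin ξ))
  have hbound (ξ : L2R3) : ‖∑' i, indOp (L i) (A i (indOp (S i) ξ))‖ ≤ m * ‖ξ‖ := by
    refine le_of_tendsto (hsum ξ).hasSum.norm (Eventually.of_forall fun s => ?_)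
    refine le_of_sq_le_sq ?_ (by positivity)
    rw [norm_sq_sum_of_orthogonal (horth ξ)]
    exact hfin ξ s
  refine ⟨LinearMap.mkContinuous
    { toFun := fun ξ => ∑' i, indOp (L i) (A i (indOp (S i) ξ))
      map_add' := fun ξ η => by
        simp only [map_add]
        exact (hsum ξ).tsum_add (hsum η)
      map_smul' := fun c ξ => by
        simp only [map_smul, RingHom.id_apply]
        exact (hsum ξ).tsum_const_smul c } m hbound,
    LinearMap.mkContinuous_norm_le _ hm _, fun ξ => (hsum ξ).hasSum⟩

theorem hasSum_indOp [Countable ι] {S : ι → Set R3} (hS : ∀ i, MeasurableSet (S i))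
    (hd : Pairwise fun i j => Disjoint (S i) (S j)) (ξ : L2R3) :
    HasSum (fun i => indOp (S i) ξ) (indOp (⋃ i, S i) ξ) := by
  have hsum : Summable fun i => indOp (S i) ξ :=
    summable_of_orthogonal (fun i j hij => inner_indOp_indOp (hS i) (hS j) (hd hij) ξ ξ)
      (summable_of_sum_le (fun i => by positivity) (sum_norm_sq_indOp_le hS hd ξ))
  set ζ := ∑' i, indOp (S i) ξ with hζ
  have hU : MeasurableSet (⋃ i, S i) := MeasurableSet.iUnion hS
  -- The sum ζ is identified by its restrictions: it equals ξ on every S_i and 0 off their union.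
  -- Countability of the index set lets these a.e. statements be combined.
  have h1 (i : ι) : indOp (S i) ζ = indOp (S i) ξ := by
    rw [hζ, (indOp (S i)).map_tsum hsum, tsum_eq_single i]
    · rw [← ContinuousLinearMap.comp_apply, indOp_comp (hS i) (hS i), inter_self]
    · intro j hj
      rw [← ContinuousLinearMap.comp_apply, indOp_comp (hS i) (hS j),
        (hd hj.symm).inter_eq, indOp_empty, zero_apply]
  have h2 : indOp (⋃ i, S i)ᶜ ζ = 0 := by
    rw [hζ, (indOp _).map_tsum hsum]
    have h0 (i : ι) : indOp (⋃ i, S i)ᶜ (indOp (S i) ξ) = 0 := by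
      rw [← ContinuousLinearMap.comp_apply, indOp_comp hU.compl (hS i),
        (disjoint_compl_left_iff_subset.2 (subset_iUnion S i)).inter_eq, indOp_empty, zero_apply]
    simp only [h0, tsum_zero]
  have h3 : ζ = indOp (⋃ i, S i) ξ := by
    refine Lp.ext ?_
    have h4 : ∀ᵐ x, ∀ i, (S i).indicator (fun _ => (1 : ℂ)) x * ζ x
        = (S i).indicator (fun _ => (1 : ℂ)) x * ξ x := by
      refine ae_all_iff.2 fun i => ?_
      filter_upwards [indOp_coeFn (hS i) ζ, indOp_coeFn (hS i) ξ] with x e1 e2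
      rw [← e1, ← e2, h1]
    filter_upwards [h4, indOp_coeFn hU.compl ζ, indOp_coeFn hU ξ,
      Lp.coeFn_zero ℂ 2 (volume : Measure R3)] with x e1 e2 e3 e4
    rw [e3]
    by_cases hx : x ∈ ⋃ i, S i
    · obtain ⟨i, hi⟩ := mem_iUnion.1 hx
      have := e1 i
      simp only [indicator_of_mem hi, one_mul] at this
      simp [indicator_of_mem hx, this]
    · rw [h2, e4] at e2
      simp only [indicator_of_mem (mem_compl hx), one_mul, Pi.zero_apply] at e2
      simp [indicator_of_notMem hx, ← e2]
  rw [← h3]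
  exact hsum.hasSum

end Blocks

/-! ## The extension of `σ_l` to the C*-algebra -/

/-- The extension of `σ_l` to `C*(G)` as a bounded linear map. -/
def sigmaCLM (l : R3) : CStarG6 →L[ℂ] (L2R3 →L[ℂ] L2R3) :=
  LinearMap.mkContinuous
    { toFun := fun F => sigma l F
      map_add' := fun _ _ => rfl
      map_smul' := fun _ _ => rfl } 1 (fun F => by
        rw [one_mul]
        exact lp.norm_apply_le_norm ENNReal.top_ne_zero (F : RepProduct G6) (sigmaRep l))

theorem norm_sigma_le (l : R3) (F : CStarG6) : ‖sigma l F‖ ≤ ‖F‖ :=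
  lp.norm_apply_le_norm ENNReal.top_ne_zero (F : RepProduct G6) (sigmaRep l)

theorem norm_universalMap_le (f : Lp ℂ 1 (volume : Measure G6)) :
    ‖universalMap G6 volume f‖ ≤ ‖f‖ :=
  lp.norm_le_of_forall_le (norm_nonneg f) fun π => π.norm_integrated_le volume f

/-- The canonical map `L¹(G) → C*(G)`. -/
def ofL1 : Lp ℂ 1 (volume : Measure G6) →L[ℂ] CStarG6 :=
  LinearMap.mkContinuous
    ((universalMap G6 volume).codRestrict (groupCStar G6 volume) fun f =>
      Submodule.le_topologicalClosure _ (LinearMap.mem_range_self _ f)) 1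
    (fun f => by rw [one_mul]; exact norm_universalMap_le f)

theorem sigma_ofL1_apply (l : R3) (f : Lp ℂ 1 (volume : Measure G6)) (ξ : L2R3) :
    sigma l (ofL1 f) ξ = ∫ g, f g • sigmaOp l g ξ := rfl

theorem integrable_smul_sigmaOp (l : R3) (f : Lp ℂ 1 (volume : Measure G6)) (ξ : L2R3) :
    Integrable (fun g => f g • sigmaOp l g ξ) volume :=
  (sigmaRep l).integrable_smul f ξ

theorem denseRange_ofL1 : DenseRange ofL1 := by
  intro F
  have hF : (F : RepProduct G6) ∈ closure (range (universalMap G6 (volume : Measure G6))) := F.2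
  rw [Metric.mem_closure_iff] at hF ⊢
  intro e he
  obtain ⟨_, ⟨f, rfl⟩, h⟩ := hF e he
  exact ⟨ofL1 f, mem_range_self f, h⟩

/-! ### Right translations and comparison of the norms of σ_l along orbits -/

/-- Right translation by an element `E(a,a,p)`, which preserves Lebesgue measure. -/
theorem measurePreserving_eMul_right (a p : ℝ) :
    MeasurePreserving (fun h => eMul h (a, a, p)) (volume : Measure R3) volume := by
  have h : (fun h => eMul h (a, a, p)) = fun h : R3 => (a, a, p) + h := by
    funext h
    ext <;> simp [eMul, add_comm]
  rw [h]
  exact measurePreserving_addR3 _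

/-- The operator of right translation by `E(a,a,p)`. -/
def rightTrans (a p : ℝ) : L2R3 →ₗᵢ[ℂ] L2R3 :=
  Lp.compMeasurePreservingₗᵢ ℂ (fun h => eMul h (a, a, p)) (measurePreserving_eMul_right a p)

theorem rightTrans_coeFn (a p : ℝ) (ξ : L2R3) :
    rightTrans a p ξ =ᵐ[volume] fun h => ξ (eMul h (a, a, p)) :=
  Lp.coeFn_compMeasurePreserving ξ (measurePreserving_eMul_right a p)

theorem rightTrans_rightTrans_neg (a p : ℝ) (ξ : L2R3) :
    rightTrans a p (rightTrans (-a) (-p) ξ) = ξ := by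
  refine Lp.ext ?_
  have h1 := (measurePreserving_eMul_right a p).quasiMeasurePreserving.ae
    (rightTrans_coeFn (-a) (-p) ξ)
  filter_upwards [rightTrans_coeFn a p (rightTrans (-a) (-p) ξ), h1] with h e1 e2
  rw [e1, e2, eMul_assoc]
  have : eMul (a, a, p) (-a, -a, -p) = 0 := by
    ext <;> simp [eMul]
  rw [this, eMul_zero]

/-- Dual to `adInv_eMul`; the coordinates are read off by pairing with Q, R and S. -/
theorem coad_coad (x y l : R3) : coad x (coad y l) = coad (eMul x y) l := by
  have h (z : R3) : pair (coad x (coad y l)) z = pair (coad (eMul x y) l) z := by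
    rw [pair_coad, pair_coad, pair_coad, adInv_eMul]
  have h1 := h (1, 0, 0)
  have h2 := h (0, 1, 0)
  have h3 := h (0, 0, 1)
  simp only [pair, mul_one, mul_zero, add_zero, zero_add] at h1 h2 h3
  exact Prod.ext h1 (Prod.ext h2 h3)

/-- Left and right translations commute, and the phases match because Ad*(x⁻¹h) Ad*(E) l =
Ad*(x⁻¹hE) l. -/
theorem sigmaOp_rightTrans (a p : ℝ) (l : R3) (g : G6) (ξ : L2R3) :
    sigmaOp (coad (a, a, p) l) g (rightTrans a p ξ) = rightTrans a p (sigmaOp l g ξ) := by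
  refine Lp.ext ?_
  have h1 := (measurePreserving_eMul_right a p).quasiMeasurePreserving.ae (sigmaOp_coeFn l g ξ)
  have h2 := (measurePreserving_eMul (eInv g.x)).quasiMeasurePreserving.ae (rightTrans_coeFn a p ξ)
  filter_upwards [sigmaOp_coeFn (coad (a, a, p) l) g (rightTrans a p ξ),
    rightTrans_coeFn a p (sigmaOp l g ξ), h1, h2] with h e1 e2 e3 e4
  rw [e1, e2, e3, e4, phase, phase, coad_coad, eMul_assoc]

theorem sigma_rightTrans (a p : ℝ) (l : R3) (F : CStarG6) :
    sigma (coad (a, a, p) l) F ∘L (rightTrans a p).toContinuousLinearMap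
      = (rightTrans a p).toContinuousLinearMap ∘L sigma l F := by
  refine denseRange_ofL1.induction_on (p := fun F => sigma (coad (a, a, p) l) F ∘L
    (rightTrans a p).toContinuousLinearMap
      = (rightTrans a p).toContinuousLinearMap ∘L sigma l F) F ?_ fun f => ?_
  · refine isClosed_eq ?_ ?_
    · exact ((sigmaCLM (coad (a, a, p) l)).continuous).clm_comp continuous_const
    · exact continuous_const.clm_comp (sigmaCLM l).continuous
  · refine ContinuousLinearMap.ext fun ξ => ?_
    simp only [ContinuousLinearMap.comp_apply, LinearIsometry.coe_toContinuousLinearMap,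
      sigma_ofL1_apply]
    have h := (rightTrans a p).toContinuousLinearMap.integral_comp_comm
      (integrable_smul_sigmaOp l f ξ)
    simp only [LinearIsometry.coe_toContinuousLinearMap, map_smul] at h
    rw [← h]
    simp only [sigmaOp_rightTrans]

theorem norm_sigma_coad_le (a p : ℝ) (l : R3) (F : CStarG6) :
    ‖sigma (coad (a, a, p) l) F‖ ≤ ‖sigma l F‖ := by
  refine ContinuousLinearMap.opNorm_le_bound _ (norm_nonneg _) fun ξ => ?_
  have h := congrArg (fun T => T (rightTrans (-a) (-p) ξ)) (sigma_rightTrans a p l F)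
  simp only [ContinuousLinearMap.comp_apply, LinearIsometry.coe_toContinuousLinearMap,
    rightTrans_rightTrans_neg] at h
  rw [h, LinearIsometry.norm_map, ← (rightTrans (-a) (-p)).norm_map ξ]
  exact ContinuousLinearMap.le_opNorm _ _

/-- All positive multiples of cQ* lie on one orbit of the subgroup {E(a,a,0)}, whose right
translations are unitary. -/
theorem norm_sigma_smul_Q_le (c d : ℝ) (hd : 0 < d) (F : CStarG6) :
    ‖sigma (d * c, 0, 0) F‖ ≤ ‖sigma (c, 0, 0) F‖ := by
  have h : ((d * c, 0, 0) : R3) = coad (-Real.log d, -Real.log d, 0) (c, 0, 0) := by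
    simp [coad, Real.exp_log hd]
  rw [h]
  exact norm_sigma_coad_le _ _ _ F

/-- Scaling l amounts to scaling the 𝔥-coordinate of the group element, so continuity of c ↦
σ_{cl}(g)ξ follows from strong continuity of the single representation σ_l. -/
theorem sigmaOp_smul (c : ℝ) (l : R3) (g : G6) (ξ : L2R3) :
    sigmaOp (c • l) g ξ = sigmaOp l (G6.mk g.x (c • g.y)) ξ := by
  refine Lp.ext ?_
  filter_upwards [sigmaOp_coeFn (c • l) g ξ, sigmaOp_coeFn l (G6.mk g.x (c • g.y)) ξ] with h e1 e2
  rw [e1, e2, G6.x_mk]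
  congr 1
  simp only [phase, pair_coad, G6.x_mk, G6.y_mk]
  simp only [pair, adInv, Prod.smul_fst, Prod.smul_snd, smul_eq_mul]
  congr 3
  ring

theorem tendsto_sigma_smul_ofL1 (l : R3) (f : Lp ℂ 1 (volume : Measure G6)) (ξ : L2R3) :
    Tendsto (fun c : ℝ => sigma (c • l) (ofL1 f) ξ) (𝓝 0) (𝓝 (sigma 0 (ofL1 f) ξ)) := by
  simp only [sigma_ofL1_apply]
  refine tendsto_integral_filter_of_dominated_convergence (fun g => ‖f g‖ * ‖ξ‖)
    (Eventually.of_forall fun c => (integrable_smul_sigmaOp _ f ξ).aestronglyMeasurable)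
    (Eventually.of_forall fun c => Eventually.of_forall fun g => ?_)
    ((L1.integrable_coeFn f).norm.mul_const _) (Eventually.of_forall fun g => ?_)
  · rw [norm_smul, LinearIsometry.norm_map]
  · refine Tendsto.const_smul ?_ (f g)
    have hc : Continuous fun c : ℝ => G6.mk g.x (c • g.y) :=
      (continuous_const.prodMk (continuous_id.smul continuous_const) :
        Continuous fun c : ℝ => ((g.x, c • g.y) : R3 × R3))
    have h := ((continuous_sigmaOp l ξ).comp hc).tendsto 0
    simp only [Function.comp_def, ← sigmaOp_smul] at h
    rwa [zero_smul] at h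

/-- On L¹(G), σ_0 is the strong limit of σ_{dcQ*} as d → 0+. These operators have norms bounded by
that of σ_{cQ*}, and the bound survives a strong limit. -/
theorem norm_sigma_zero_le (c : ℝ) (F : CStarG6) : ‖sigma 0 F‖ ≤ ‖sigma (c, 0, 0) F‖ := by
  refine denseRange_ofL1.induction_on (p := fun F => ‖sigma 0 F‖ ≤ ‖sigma (c, 0, 0) F‖) F
    ?_ fun f => ?_
  · exact isClosed_le (sigmaCLM 0).continuous.norm (sigmaCLM (c, 0, 0)).continuous.norm
  · refine ContinuousLinearMap.opNorm_le_bound _ (norm_nonneg _) fun ξ => ?_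
    refine le_of_tendsto ((tendsto_sigma_smul_ofL1 (c, 0, 0) f ξ).mono_left
      (nhdsWithin_le_nhds (s := Ioi 0))).norm ?_
    filter_upwards [self_mem_nhdsWithin] with d hd
    refine ContinuousLinearMap.le_of_opNorm_le _ ?_ ξ
    have := norm_sigma_smul_Q_le c d hd (ofL1 f)
    simpa using this

/-- The functionals ε(-1+δ⁴k²/2)Q* of the series can be positive, negative or zero multiples of εQ*.
The sign of cε selects the half-line, and zero is the limiting case. -/
theorem norm_sigma_Q_le {ε : ℝ} (hε : ε = 1 ∨ ε = -1) (c : ℝ) (F : CStarG6) :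
    ‖sigma (c, 0, 0) F‖ ≤ max ‖sigma (ε, 0, 0) F‖ ‖sigma (-ε, 0, 0) F‖ := by
  rcases lt_trichotomy (c * ε) 0 with h | h | h
  · refine le_trans ?_ (le_max_right _ _)
    have := norm_sigma_smul_Q_le (-ε) (-(c * ε)) (by linarith) F
    have e : -(c * ε) * -ε = c := by rcases hε with rfl | rfl <;> ring
    rwa [e] at this
  · have : c = 0 := by rcases hε with rfl | rfl <;> linarith
    rw [this]
    exact (norm_sigma_zero_le ε F).trans (le_max_left _ _)
  · refine le_trans ?_ (le_max_left _ _)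
    have := norm_sigma_smul_Q_le ε (c * ε) h F
    have e : c * ε * ε = c := by rcases hε with rfl | rfl <;> ring
    rwa [e] at this

theorem norm_sigma_RQ_le {ε τ : ℝ} (hτ : τ = 1 ∨ τ = -1) (F : CStarG6) :
    ‖sigma (ε * -2, ε * (τ * √2), 0) F‖ ≤ ‖sigma (0, τ * ε, 0) F‖ := by
  have h : ((ε * -2, ε * (τ * √2), 0) : R3)
      -- With e^{-b} = e^{-(a+b)/2} = √2 and p = τ√2, the Q-coordinate is -√2·τ√2·τε = -2ε and the
      -- R-coordinate is √2·τε.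
      = coad (-Real.log √2, -Real.log √2, τ * √2) (0, τ * ε, 0) := by
    have h2 : (0 : ℝ) < √2 := by positivity
    have h3 : √2 * √2 = 2 := Real.mul_self_sqrt (by norm_num)
    have h4 : -(-Real.log √2 + -Real.log √2) / 2 = Real.log √2 := by ring
    simp only [coad, neg_neg, h4, Real.exp_log h2]
    ext
    · rcases hτ with rfl | rfl <;> dsimp only <;> linear_combination ε * h3
    · dsimp only; ring
    · simp
  rw [h]
  exact norm_sigma_coad_le _ _ _ F

/-! ## The regions -/

theorem mem_Iset_iff {c : ℝ} (hc : 0 < c) (k : ℤ) (p : ℝ) : p ∈ Iset c k ↔ ⌊p / c⌋ = k := by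
  rw [Int.floor_eq_iff, Iset, mem_Ico, le_div_iff₀ hc, div_lt_iff₀ hc]
  constructor <;> rintro ⟨h1, h2⟩ <;> constructor <;> linarith

theorem measurableSet_Iset (c : ℝ) (k : ℤ) : MeasurableSet (Iset c k) := measurableSet_Ico

theorem mem_Lset_iff {δ : ℝ} (hδ : 0 < δ) (k : ℤ) (x : R3) :
    x ∈ Lset δ k ↔ ⌊x.2.2 / δ ^ 2⌋ = k := by
  rw [← mem_Iset_iff (by positivity)]
  simp [Lset]

theorem measurableSet_Lset (δ : ℝ) (k : ℤ) : MeasurableSet (Lset δ k) :=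
  MeasurableSet.univ.prod (MeasurableSet.univ.prod (measurableSet_Iset _ k))

theorem disjoint_Lset {δ : ℝ} (hδ : 0 < δ) {j k : ℤ} (h : j ≠ k) :
    Disjoint (Lset δ j) (Lset δ k) := by
  rw [disjoint_left]
  intro x hx hx'
  rw [mem_Lset_iff hδ] at hx hx'
  exact h (hx.symm.trans hx')

theorem mem_T3_iff {δ : ℝ} (hδ : 0 < δ) (k : ℤ) (x : R3) :
    x ∈ T3 δ k ↔ ⌊x.2.2 / δ ^ 2⌋ = k - 1 ∨ ⌊x.2.2 / δ ^ 2⌋ = k ∨ ⌊x.2.2 / δ ^ 2⌋ = k + 1 := by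
  rw [T3, mem_union, mem_union, mem_Lset_iff hδ, mem_Lset_iff hδ, mem_Lset_iff hδ, or_assoc]

theorem measurableSet_T3 (δ : ℝ) (k : ℤ) : MeasurableSet (T3 δ k) :=
  ((measurableSet_Lset δ _).union (measurableSet_Lset δ _)).union (measurableSet_Lset δ _)

/-- T_{δ,3,k} consists of the strips k-1, k, k+1, so a strip common to the indices k and m exists
exactly when |k-m| ≤ 2. -/
theorem T3_inter_nonempty_iff {δ : ℝ} (hδ : 0 < δ) (k m : ℤ) :
    (T3 δ k ∩ T3 δ m).Nonempty ↔ k ∈ Icc (m - 2) (m + 2) := by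
  constructor
  · rintro ⟨x, h1, h2⟩
    rw [mem_T3_iff hδ] at h1 h2
    rw [mem_Icc]
    omega
  · intro h
    rw [mem_Icc] at h
    have key (j : ℤ) : ⌊((0, 0, δ ^ 2 * j) : R3).2.2 / δ ^ 2⌋ = j := by
      rw [mul_div_cancel_left₀ _ (by positivity), Int.floor_intCast]
    have h2 : ∃ j, (j = k - 1 ∨ j = k ∨ j = k + 1) ∧ (j = m - 1 ∨ j = m ∨ j = m + 1) := by
      rcases lt_trichotomy k m with h3 | h3 | h3
      · exact ⟨k + 1, by omega⟩
      · exact ⟨k, by omega⟩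
      · exact ⟨k - 1, by omega⟩
    obtain ⟨j, hj1, hj2⟩ := h2
    refine ⟨(0, 0, δ ^ 2 * j), ?_, ?_⟩
    · rw [mem_T3_iff hδ, key]; exact hj1
    · rw [mem_T3_iff hδ, key]; exact hj2

theorem encard_T3_inter_nonempty {δ : ℝ} (hδ : 0 < δ) (m : ℤ) :
    {k : ℤ | (T3 δ k ∩ T3 δ m).Nonempty}.encard = ((5 : ℕ) : ℕ∞) := by
  have h : {k : ℤ | (T3 δ k ∩ T3 δ m).Nonempty} = (Finset.Icc (m - 2) (m + 2) : Finset ℤ) := by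
    ext k
    simp [T3_inter_nonempty_iff hδ]
  rw [h, Set.encard_coe_eq_coe_finsetCard, Int.card_Icc]
  congr 1
  omega

theorem indOp_T3 {δ : ℝ} (hδ : 0 < δ) (k : ℤ) :
    indOp (T3 δ k) = indOp (Lset δ (k - 1)) + indOp (Lset δ k) + indOp (Lset δ (k + 1)) := by
  rw [indOp_add (measurableSet_Lset _ _) (measurableSet_Lset _ _) (disjoint_Lset hδ (by omega)),
    indOp_add ((measurableSet_Lset _ _).union (measurableSet_Lset _ _)) (measurableSet_Lset _ _)
      ((disjoint_Lset hδ (by omega)).union_left (disjoint_Lset hδ (by omega))), T3]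

theorem measurableSet_Jset (δ : ℝ) (k : ℤ) : MeasurableSet (Jset δ k) :=
  measurableSet_Ici.prod (measurableSet_Iic.prod (measurableSet_Iset _ k))

theorem measurableSet_S3plus (ε δ : ℝ) (k : ℤ) : MeasurableSet (S3plus ε δ k) := by
  rw [S3plus, ofPred_and, ofPred_and]
  refine (measurableSet_Jset δ k).inter (((measurableSet_lt ?_ ?_)).inter
    ((measurableSet_le ?_ ?_).inter (measurableSet_le ?_ ?_))) <;> fun_prop

theorem measurableSet_S3minus (ε δ : ℝ) (k : ℤ) : MeasurableSet (S3minus ε δ k) := by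
  rw [S3minus, ofPred_and, ofPred_and]
  refine (measurableSet_Jset δ k).inter (((measurableSet_lt ?_ ?_)).inter
    ((measurableSet_le ?_ ?_).inter (measurableSet_le ?_ ?_))) <;> fun_prop

theorem measurableSet_S1 (δ : ℝ) : MeasurableSet (S1 δ) :=
  measurableSet_lt (by fun_prop) (by fun_prop)

theorem measurableSet_S2 (δ : ℝ) : MeasurableSet (S2 δ) := by
  rw [S2, ofPred_and]
  refine (measurableSet_le ?_ ?_).inter (measurableSet_lt ?_ ?_) <;> fun_prop

theorem measurableSet_S4 (τ δ : ℝ) : MeasurableSet (S4 τ δ) := by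
  rw [S4, ofPred_and, ofPred_and, ofPred_and]
  refine (measurableSet_lt ?_ ?_).inter ((measurableSet_le ?_ ?_).inter
    ((measurableSet_le ?_ ?_).inter (measurableSet_le ?_ ?_))) <;> fun_prop

/-- The region `S_{δ,3,k} = S_{δ,3,k,+} ∪ S_{δ,3,k,-}`. -/
def S3 (ε δ : ℝ) (k : ℤ) : Set R3 := S3plus ε δ k ∪ S3minus ε δ k

theorem measurableSet_S3 (ε δ : ℝ) (k : ℤ) : MeasurableSet (S3 ε δ k) :=
  (measurableSet_S3plus ε δ k).union (measurableSet_S3minus ε δ k)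

theorem disjoint_S3plus_S3minus (ε : ℝ) {δ : ℝ} (hδ : 0 < δ) (k : ℤ) :
    Disjoint (S3plus ε δ k) (S3minus ε δ k) := by
  rw [disjoint_left]
  rintro x ⟨-, h1, -⟩ ⟨-, h2, -⟩
  have : 0 < δ ^ (1 / 2 : ℝ) := by positivity
  linarith

theorem S3_subset_Lset (ε δ : ℝ) (k : ℤ) : S3 ε δ k ⊆ Lset δ k := by
  rintro x (⟨h, -⟩ | ⟨h, -⟩) <;> exact ⟨trivial, trivial, h.2.2⟩

theorem disjoint_S3 (ε : ℝ) {δ : ℝ} (hδ : 0 < δ) {j k : ℤ} (h : j ≠ k) :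
    Disjoint (S3 ε δ j) (S3 ε δ k) :=
  (disjoint_Lset hδ h).mono (S3_subset_Lset ε δ j) (S3_subset_Lset ε δ k)

theorem sigma3Term_eq (ε : ℝ) {δ : ℝ} (hδ : 0 < δ) (F : CStarG6) (k : ℤ) :
    sigma3Term ε δ F k = indOp (T3 δ k) ∘L
      sigma (ε * (-1 + δ ^ 4 * (k : ℝ) ^ 2 / 2), 0, 0) F ∘L indOp (S3 ε δ k) := by
  rw [sigma3Term, indOp_add (measurableSet_S3plus ε δ k) (measurableSet_S3minus ε δ k)
    (disjoint_S3plus_S3minus ε hδ k), S3]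

/-! ## Convergence and boundedness -/

instance : SMul ℂ CStarG6 :=
  (groupCStar G6 volume).module.toDistribMulAction.toMulAction.toSMul

theorem sigma_add (l : R3) (F F' : CStarG6) : sigma l (F + F') = sigma l F + sigma l F' := rfl

theorem sigma_smul (l : R3) (c : ℂ) (F : CStarG6) : sigma l (c • F) = c • sigma l F :=
  (sigmaCLM l).map_smul c F

theorem strongSum_eq {ι : Type} {f : ι → L2R3 →L[ℂ] L2R3} {T : L2R3 →L[ℂ] L2R3}
    (h : ∀ ξ, HasSum (fun i => f i ξ) (T ξ)) : strongSum f = T := by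
  have h' : ∃ T : L2R3 →L[ℂ] L2R3, ∀ ξ, HasSum (fun i => f i ξ) (T ξ) := ⟨T, h⟩
  rw [strongSum, dif_pos h']
  exact ContinuousLinearMap.ext fun ξ => (h'.choose_spec ξ).unique (h ξ)

/-- Each T_{δ,3,k} is the disjoint union of the strips with index k-1, k and k+1. For a fixed offset
j the strips k+j are disjoint as k varies, so each of the three resulting series is of block type
and contributes the maximum once. -/
theorem exists_hasSum_sigma3Term {ε : ℝ} (hε : ε = 1 ∨ ε = -1) {δ : ℝ} (hδ : 0 < δ)
    (F : CStarG6) : ∃ T : L2R3 →L[ℂ] L2R3,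
      ‖T‖ ≤ 3 * max ‖sigma (ε, 0, 0) F‖ ‖sigma (-ε, 0, 0) F‖ ∧
      ∀ ξ, HasSum (fun k => sigma3Term ε δ F k ξ) (T ξ) := by
  set m := max ‖sigma (ε, 0, 0) F‖ ‖sigma (-ε, 0, 0) F‖
  have hm : 0 ≤ m := (norm_nonneg _).trans (le_max_left _ _)
  have key (j : ℤ) := exists_hasSum_blocks (L := fun k => Lset δ (k + j)) (S := S3 ε δ)
    (A := fun k : ℤ => sigma (ε * (-1 + δ ^ 4 * (k : ℝ) ^ 2 / 2), 0, 0) F)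
    (fun k => measurableSet_Lset δ _) (fun i k hik => disjoint_Lset hδ (by omega))
    (measurableSet_S3 ε δ) (fun i k hik => disjoint_S3 ε hδ hik)
    (fun k => norm_sigma_Q_le hε _ F) hm
  obtain ⟨T₁, hT₁, h₁⟩ := key (-1)
  obtain ⟨T₂, hT₂, h₂⟩ := key 0
  obtain ⟨T₃, hT₃, h₃⟩ := key 1
  refine ⟨T₁ + T₂ + T₃, ?_, fun ξ => ?_⟩
  · refine (norm_add₃_le).trans ?_
    linarith
  · have h (k : ℤ) : sigma3Term ε δ F k ξ = indOp (Lset δ (k + -1)) (sigma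
        (ε * (-1 + δ ^ 4 * (k : ℝ) ^ 2 / 2), 0, 0) F (indOp (S3 ε δ k) ξ))
        + indOp (Lset δ (k + 0)) (sigma
          (ε * (-1 + δ ^ 4 * (k : ℝ) ^ 2 / 2), 0, 0) F (indOp (S3 ε δ k) ξ))
        + indOp (Lset δ (k + 1)) (sigma
          (ε * (-1 + δ ^ 4 * (k : ℝ) ^ 2 / 2), 0, 0) F (indOp (S3 ε δ k) ξ)) := by
      rw [sigma3Term_eq ε hδ, indOp_T3 hδ, ← sub_eq_add_neg, add_zero]
      rfl
    simp only [h]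
    exact ((h₁ ξ).add (h₂ ξ)).add (h₃ ξ)

theorem hasSum_sigma3Term {ε : ℝ} (hε : ε = 1 ∨ ε = -1) {δ : ℝ} (hδ : 0 < δ) (F : CStarG6)
    (ξ : L2R3) : HasSum (fun k => sigma3Term ε δ F k ξ) (strongSum (sigma3Term ε δ F) ξ) := by
  obtain ⟨T, -, hT⟩ := exists_hasSum_sigma3Term hε hδ F
  rw [strongSum_eq hT]
  exact hT ξ

theorem norm_strongSum_sigma3Term_le {ε : ℝ} (hε : ε = 1 ∨ ε = -1) {δ : ℝ} (hδ : 0 < δ)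
    (F : CStarG6) : ‖strongSum (sigma3Term ε δ F)‖
      ≤ 3 * max ‖sigma (ε, 0, 0) F‖ ‖sigma (-ε, 0, 0) F‖ := by
  obtain ⟨T, hm, hT⟩ := exists_hasSum_sigma3Term hε hδ F
  rwa [strongSum_eq hT]

theorem norm_comp_indOp_le (T : L2R3 →L[ℂ] L2R3) {S : Set R3} (hS : MeasurableSet S) :
    ‖T ∘L indOp S‖ ≤ ‖T‖ :=
  (ContinuousLinearMap.opNorm_comp_le _ _).trans
    (mul_le_of_le_one_right (norm_nonneg _) (norm_indOp_le hS))

theorem memLp_top_cutoff {φ : ℝ → ℝ} (hφ : Continuous φ) (hφ_le : ∀ x, |φ x| ≤ 1) :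
    MemLp (fun x : R3 => (φ (-Real.exp (-x.2.1)) : ℂ)) ∞ volume :=
  memLp_top_of_measurable (C := 1)
    (Complex.continuous_ofReal.comp (hφ.comp (by fun_prop))).measurable
    fun x => by simpa using hφ_le _

theorem norm_sigmaDelta_le {ε : ℝ} (hε : ε = 1 ∨ ε = -1) {φ : ℝ → ℝ} (hφ : Continuous φ)
    (hφ_le : ∀ x, |φ x| ≤ 1) {δ : ℝ} (hδ : 0 < δ) (F : CStarG6) :
    ‖sigmaDelta ε φ δ F‖ ≤ 2 * ‖sigma (0, 0, ε) F‖
      + 3 * max ‖sigma (ε, 0, 0) F‖ ‖sigma (-ε, 0, 0) F‖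
      + (‖sigma (0, ε, 0) F‖ + ‖sigma (0, -ε, 0) F‖) := by
  have h1 : ‖sigma (0, 0, ε) F ∘L mulOp (fun x => (φ (-Real.exp (-x.2.1)) : ℂ)) ∘L indOp (S1 δ)‖
      ≤ ‖sigma (0, 0, ε) F‖ := by
    refine (ContinuousLinearMap.opNorm_comp_le _ _).trans
      (mul_le_of_le_one_right (norm_nonneg _) ?_)
    refine (norm_comp_indOp_le _ (measurableSet_S1 δ)).trans ?_
    exact norm_mulOp_le (memLp_top_cutoff hφ hφ_le) zero_le_one
      (Eventually.of_forall fun x => by simpa using hφ_le _)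
  have h2 : ‖sigma (0, 0, ε) F ∘L indOp (S2 δ)‖ ≤ ‖sigma (0, 0, ε) F‖ :=
    norm_comp_indOp_le _ (measurableSet_S2 δ)
  have h3 := norm_strongSum_sigma3Term_le hε hδ F
  have h4 (τ : ℝ) (hτ : τ = 1 ∨ τ = -1) : ‖sigma4 ε τ δ F‖ ≤ ‖sigma (0, τ * ε, 0) F‖ :=
    (norm_comp_indOp_le _ (measurableSet_S4 τ δ)).trans (norm_sigma_RQ_le hτ F)
  have h5 := h4 1 (Or.inl rfl)
  have h6 := h4 (-1) (Or.inr rfl)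
  rw [one_mul] at h5
  rw [neg_one_mul] at h6
  refine (norm_add_le_of_le (norm_add_le_of_le (norm_add_le_of_le (norm_add_le_of_le h1 h2) h3)
    h5) h6).trans ?_
  linarith

/-- A bound independent of δ, as needed for the density argument; 7 = 2 + 3 + 2. -/
theorem norm_sigmaDelta_le_mul {ε : ℝ} (hε : ε = 1 ∨ ε = -1) {φ : ℝ → ℝ} (hφ : Continuous φ)
    (hφ_le : ∀ x, |φ x| ≤ 1) {δ : ℝ} (hδ : 0 < δ) (F : CStarG6) :
    ‖sigmaDelta ε φ δ F‖ ≤ 7 * ‖F‖ := by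
  refine (norm_sigmaDelta_le hε hφ hφ_le hδ F).trans ?_
  have h1 := max_le (norm_sigma_le (ε, 0, 0) F) (norm_sigma_le (-ε, 0, 0) F)
  linarith [norm_sigma_le (0, 0, ε) F, norm_sigma_le (0, ε, 0) F, norm_sigma_le (0, -ε, 0) F]

theorem strongSum_sigma3Term_add {ε : ℝ} (hε : ε = 1 ∨ ε = -1) {δ : ℝ} (hδ : 0 < δ)
    (F F' : CStarG6) : strongSum (sigma3Term ε δ (F + F'))
      = strongSum (sigma3Term ε δ F) + strongSum (sigma3Term ε δ F') := by
  refine strongSum_eq fun ξ => ?_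
  have h := (hasSum_sigma3Term hε hδ F ξ).add (hasSum_sigma3Term hε hδ F' ξ)
  have e (k : ℤ) : sigma3Term ε δ (F + F') k ξ
      = sigma3Term ε δ F k ξ + sigma3Term ε δ F' k ξ := by
    simp only [sigma3Term_eq ε hδ, sigma_add, ContinuousLinearMap.comp_apply, add_apply, map_add]
  simp only [e]
  exact h

theorem strongSum_sigma3Term_smul {ε : ℝ} (hε : ε = 1 ∨ ε = -1) {δ : ℝ} (hδ : 0 < δ)
    (c : ℂ) (F : CStarG6) :
    strongSum (sigma3Term ε δ (c • F)) = c • strongSum (sigma3Term ε δ F) := by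
  refine strongSum_eq fun ξ => ?_
  have h := (hasSum_sigma3Term hε hδ F ξ).const_smul c
  have e (k : ℤ) : sigma3Term ε δ (c • F) k ξ = c • sigma3Term ε δ F k ξ := by
    simp only [sigma3Term_eq ε hδ, sigma_smul, ContinuousLinearMap.comp_apply,
      smul_apply, map_smul]
  simp only [e]
  exact h

/-- The map `F ↦ σ_{ε,-ε,δ}(F)` as a bounded linear map. -/
def sigmaDeltaCLM {ε : ℝ} (hε : ε = 1 ∨ ε = -1) {φ : ℝ → ℝ} (hφ : Continuous φ)
    (hφ_le : ∀ x, |φ x| ≤ 1) {δ : ℝ} (hδ : 0 < δ) : CStarG6 →L[ℂ] (L2R3 →L[ℂ] L2R3) :=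
  LinearMap.mkContinuous
    { toFun := sigmaDelta ε φ δ
      map_add' := fun F F' => by
        simp only [sigmaDelta, sigma4, sigma_add, strongSum_sigma3Term_add hε hδ,
          ContinuousLinearMap.add_comp]
        abel
      map_smul' := fun c F => by
        simp only [sigmaDelta, sigma4, sigma_smul, strongSum_sigma3Term_smul hε hδ,
          ContinuousLinearMap.smul_comp, RingHom.id_apply, smul_add] } 7
    (norm_sigmaDelta_le_mul hε hφ hφ_le hδ)

/-! ## Operators of functions of product type -/

theorem continuous_transOp_R3 (ξ : L2R3) : Continuous fun x : R3 => transOp x ξ :=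
  (continuous_transOp ξ).comp (Continuous.prodMk_left 0 : Continuous fun x : R3 => (x, (0 : R3)))

theorem integrableOn_transOp {A : Set R3} (hA : volume A ≠ ⊤) (ξ : L2R3) :
    IntegrableOn (fun x => transOp x ξ) A volume :=
  Measure.integrableOn_of_bounded hA (continuous_transOp_R3 ξ).aestronglyMeasurable
    (M := ‖ξ‖) (Eventually.of_forall fun x => ((transOp x).norm_map ξ).le)

/-- The operator `∫_A λ(x) dx`. -/
def transInt {A : Set R3} (hA : volume A ≠ ⊤) : L2R3 →L[ℂ] L2R3 :=
  LinearMap.mkContinuous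
    { toFun := fun ξ => ∫ x in A, transOp x ξ
      map_add' := fun ξ η => by
        simp only [map_add]
        exact integral_add (integrableOn_transOp hA ξ) (integrableOn_transOp hA η)
      map_smul' := fun c ξ => by
        simp only [map_smul, RingHom.id_apply]
        exact integral_smul c _ } (volume.real A) (fun ξ => by
        rw [mul_comm]
        exact norm_setIntegral_le_of_norm_le_const hA.lt_top
          fun x _ => ((transOp x).norm_map ξ).le)

theorem transInt_apply {A : Set R3} (hA : volume A ≠ ⊤) (ξ : L2R3) :
    transInt hA ξ = ∫ x in A, transOp x ξ := rfl

/-! ### The Fourier transform of 1_B and the factorisation for rectangles -/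

/-- The Fourier transform of the characteristic function of `B`. -/
def charInt (B : Set R3) (l : R3) : ℂ := ∫ y in B, Complex.exp (Complex.I * (pair l y : ℝ))

theorem norm_charInt_le {B : Set R3} (hB : volume B ≠ ⊤) (l : R3) :
    ‖charInt B l‖ ≤ volume.real B := by
  have h := norm_setIntegral_le_of_norm_le_const (μ := volume) hB.lt_top
    (f := fun y => Complex.exp (Complex.I * (pair l y : ℝ))) (C := 1)
    (fun y _ => (Complex.norm_exp_I_mul_ofReal _).le)
  rwa [one_mul] at h

theorem abs_pair_le (l y : R3) : |pair l y| ≤ 3 * ‖l‖ * ‖y‖ := by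
  have a1 (z : R3) : |z.1| ≤ ‖z‖ := norm_fst_le z
  have a2 (z : R3) : |z.2.1| ≤ ‖z‖ := (norm_fst_le z.2).trans (norm_snd_le z)
  have a3 (z : R3) : |z.2.2| ≤ ‖z‖ := (norm_snd_le z.2).trans (norm_snd_le z)
  have h1 : |l.1 * y.1| ≤ ‖l‖ * ‖y‖ := by
    rw [abs_mul]; gcongr <;> exact a1 _
  have h2 : |l.2.1 * y.2.1| ≤ ‖l‖ * ‖y‖ := by
    rw [abs_mul]; gcongr <;> exact a2 _
  have h3 : |l.2.2 * y.2.2| ≤ ‖l‖ * ‖y‖ := by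
    rw [abs_mul]; gcongr <;> exact a3 _
  refine (abs_add_three _ _ _).trans ?_
  linarith

/-- The Lipschitz bound comes from |e^{is} - 1| ≤ |s| and the boundedness of B. -/
theorem norm_charInt_sub_le {B : Set R3} (hB : volume B ≠ ⊤) {R : ℝ} (hR : ∀ y ∈ B, ‖y‖ ≤ R)
    (l l' : R3) : ‖charInt B l - charInt B l'‖ ≤ 3 * R * volume.real B * ‖l - l'‖ := by
  have hint (l : R3) : IntegrableOn (fun y => Complex.exp (Complex.I * (pair l y : ℝ))) B volume := by
    refine Measure.integrableOn_of_bounded hB (Continuous.aestronglyMeasurable ?_) (M := 1)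
      (Eventually.of_forall fun y => (Complex.norm_exp_I_mul_ofReal _).le)
    unfold pair; fun_prop
  rw [charInt, charInt, ← integral_sub (hint l) (hint l')]
  refine (norm_setIntegral_le_of_norm_le_const hB.lt_top (C := 3 * ‖l - l'‖ * R)
    fun y hy => ?_).trans (le_of_eq (by ring))
  have h1 : Complex.exp (Complex.I * (pair l y : ℝ)) - Complex.exp (Complex.I * (pair l' y : ℝ))
      = Complex.exp (Complex.I * (pair l' y : ℝ))
        * (Complex.exp (Complex.I * (pair (l - l') y : ℝ)) - 1) := by
    rw [mul_sub, ← Complex.exp_add, mul_one, ← mul_add, ← Complex.ofReal_add]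
    congr 4
    simp only [pair, Prod.fst_sub, Prod.snd_sub]
    ring
  rw [h1, norm_mul, Complex.norm_exp_I_mul_ofReal, one_mul]
  refine Real.norm_exp_I_mul_ofReal_sub_one_le.trans ((abs_pair_le _ _).trans ?_)
  gcongr
  exact hR y hy

theorem continuous_charInt {B : Set R3} (hB : volume B ≠ ⊤) : Continuous (charInt B) := by
  refine continuous_of_dominated (bound := fun _ => 1) (fun l => ?_)
    (fun l => Eventually.of_forall fun y => (Complex.norm_exp_I_mul_ofReal _).le)
    (integrableOn_const hB) (Eventually.of_forall fun y => ?_)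
  · refine Continuous.aestronglyMeasurable ?_
    unfold pair; fun_prop
  · unfold pair; fun_prop

instance : (volume : Measure (ℝ × ℝ)).IsAddHaarMeasure :=
  inferInstanceAs ((volume : Measure ℝ).prod (volume : Measure ℝ)).IsAddHaarMeasure

instance : (volume : Measure R3).IsAddHaarMeasure :=
  inferInstanceAs ((volume : Measure ℝ).prod (volume : Measure (ℝ × ℝ))).IsAddHaarMeasure

/-- The functional `y ↦ ⟨l, y⟩` on `𝔥`. -/
def pairCLM (l : R3) : StrongDual ℝ R3 :=
  l.1 • ContinuousLinearMap.fst ℝ ℝ (ℝ × ℝ)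
    + l.2.1 • ContinuousLinearMap.fst ℝ ℝ ℝ ∘L ContinuousLinearMap.snd ℝ ℝ (ℝ × ℝ)
    + l.2.2 • ContinuousLinearMap.snd ℝ ℝ ℝ ∘L ContinuousLinearMap.snd ℝ ℝ (ℝ × ℝ)

theorem pairCLM_apply (l y : R3) : pairCLM l y = pair l y := rfl

theorem norm_le_norm_pairCLM (l : R3) : ‖l‖ ≤ ‖pairCLM l‖ := by
  have h (y : R3) (hy : ‖y‖ = 1) : |pair l y| ≤ ‖pairCLM l‖ := by
    have := (pairCLM l).le_opNorm y
    rwa [hy, mul_one] at this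
  refine norm_prod_le_iff.2 ⟨?_, norm_prod_le_iff.2 ⟨?_, ?_⟩⟩
  · simpa [pair] using h (1, 0, 0) (by simp [Prod.norm_def])
  · simpa [pair] using h (0, 1, 0) (by simp [Prod.norm_def])
  · simpa [pair] using h (0, 0, 1) (by simp [Prod.norm_def])

/-- The Riemann–Lebesgue lemma on ℝ³. -/
theorem exists_norm_charInt_le {B : Set R3} (hB : MeasurableSet B) {η : ℝ} (hη : 0 < η) :
    ∃ M : ℝ, ∀ l : R3, M ≤ ‖l‖ → ‖charInt B l‖ ≤ η := by
  have h := tendsto_integral_exp_smul_cocompact (B.indicator fun _ => (1 : ℂ))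
    (volume : Measure R3)
  rw [← Metric.cobounded_eq_cocompact] at h
  have h2 := (hasBasis_cobounded_norm.tendsto_iff Metric.nhds_basis_closedBall).1 h η hη
  obtain ⟨r, -, hr⟩ := h2
  -- The factor 2π and the sign in -(2π)⁻¹ convert e^{i⟨l,y⟩} to the normalisation of
  -- `Real.fourierChar`.
  refine ⟨2 * Real.pi * r, fun l hl => ?_⟩
  have h3 := hr (-(2 * Real.pi)⁻¹ • pairCLM l) (by
    change r ≤ _
    rw [norm_smul, norm_neg, norm_inv, Real.norm_of_nonneg (by positivity),
      ← div_eq_inv_mul, le_div_iff₀ (by positivity)]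
    linarith [norm_le_norm_pairCLM l])
  rw [mem_closedBall_zero_iff] at h3
  suffices h4 : charInt B l = ∫ v, Real.fourierChar (-(-(2 * Real.pi)⁻¹ • pairCLM l) v) •
      B.indicator (fun _ => (1 : ℂ)) v by
    rw [h4]
    exact h3
  rw [charInt, ← integral_indicator hB]
  refine integral_congr_ae (Eventually.of_forall fun y => ?_)
  by_cases hy : y ∈ B
  · simp only [indicator_of_mem hy, Circle.smul_def, Real.fourierChar_apply, smul_eq_mul, mul_one]
    congr 1
    rw [smul_apply, pairCLM_apply, mul_comm]
    congr 2
    have : (Real.pi : ℝ) ≠ 0 := Real.pi_ne_zero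
    simp only [smul_eq_mul]
    field_simp
  · simp [indicator_of_notMem hy]

theorem sigmaOp_mk (l x y : R3) (ξ : L2R3) :
    sigmaOp l (G6.mk x y) ξ = transOp x (sigmaOp l (G6.mk 0 y) ξ) := by
  have h1 : G6.mk x y = G6.mk x 0 * G6.mk 0 y := G6.ext' (by simp [G6.x_mul, G6.x_mk, eMul_zero])
    (by simp [G6.y_mul, G6.x_mk, G6.y_mk, adInv_zero])
  rw [h1, sigmaOp_mul]
  change sigmaOp l (G6.mk x 0) (sigmaOp l (G6.mk 0 y) ξ) = _
  refine Lp.ext ?_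
  filter_upwards [sigmaOp_coeFn l (G6.mk x 0) (sigmaOp l (G6.mk 0 y) ξ),
    transOp_coeFn x (sigmaOp l (G6.mk 0 y) ξ)] with h e1 e2
  rw [e1, e2]
  simp [phase, G6.x_mk, G6.y_mk, pair]

theorem sigmaOp_mk_zero_coeFn (l y : R3) (ξ : L2R3) :
    sigmaOp l (G6.mk 0 y) ξ =ᵐ[volume]
      fun u => Complex.exp (Complex.I * (pair (coad u l) y : ℝ)) * ξ u := by
  filter_upwards [sigmaOp_coeFn l (G6.mk 0 y) ξ] with u hu
  have h0 : eInv 0 = 0 := by simp [eInv]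
  rw [hu, G6.x_mk, phase, G6.x_mk, h0, zero_eMul, G6.y_mk]

theorem continuous_coad (l : R3) : Continuous fun u => coad u l := by
  unfold coad; fun_prop

theorem memLp_charInt_coad {B : Set R3} (hB : volume B ≠ ⊤) (l : R3) :
    MemLp (fun u => charInt B (coad u l)) ∞ (volume : Measure R3) :=
  memLp_top_of_measurable ((continuous_charInt hB).comp (continuous_coad l)).measurable
    fun _ => norm_charInt_le hB _

theorem continuous_sigmaOp_mk (l : R3) (ξ : L2R3) :
    Continuous fun z : R3 × R3 => sigmaOp l (G6.mk z.1 z.2) ξ :=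
  continuous_sigmaOp l ξ

theorem integrableOn_sigmaOp_mk_zero (l : R3) {B : Set R3} (hB : volume B ≠ ⊤) (ξ : L2R3) :
    IntegrableOn (fun y => sigmaOp l (G6.mk 0 y) ξ) B volume :=
  Measure.integrableOn_of_bounded hB
    ((continuous_sigmaOp_mk l ξ).comp (Continuous.prodMk_right (0 : R3))).aestronglyMeasurable
    (M := ‖ξ‖) (Eventually.of_forall fun _ => ((sigmaOp l _).norm_map ξ).le)

/-- The elements exp(y) act by multiplication operators, so their integral over B is multiplication
by the integral of the phases. The exchange of integrals is Fubini's theorem in the weak form ⟨η,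
·⟩. -/
theorem setIntegral_sigmaOp_mk_zero (l : R3) {B : Set R3} (hB : volume B ≠ ⊤) (ξ : L2R3) :
    ∫ y in B, sigmaOp l (G6.mk 0 y) ξ = mulOp (fun u => charInt B (coad u l)) ξ := by
  refine ext_inner_left ℂ fun η => ?_
  have : IsFiniteMeasure (volume.restrict B) := ⟨by simpa using hB.lt_top⟩
  rw [← integral_inner (integrableOn_sigmaOp_mk_zero l hB ξ), L2.inner_def]
  have h1 (y : R3) : inner ℂ η (sigmaOp l (G6.mk 0 y) ξ)
      = ∫ u, Complex.exp (Complex.I * (pair (coad u l) y : ℝ)) * inner ℂ (η u) (ξ u) := by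
    rw [L2.inner_def]
    refine integral_congr_ae ?_
    filter_upwards [sigmaOp_mk_zero_coeFn l y ξ] with u hu
    rw [hu, ← smul_eq_mul, inner_smul_right]
  simp only [h1]
  rw [integral_integral_swap]
  · refine integral_congr_ae ?_
    filter_upwards [mulOp_coeFn (memLp_charInt_coad hB l) ξ] with u hu
    rw [hu, integral_mul_const, ← smul_eq_mul (charInt B _), inner_smul_right]
    rfl
  · have h2 : Integrable (fun z : R3 × R3 => inner ℂ (η z.2) (ξ z.2))
        ((volume.restrict B).prod volume) :=
      (L2.integrable_inner (𝕜 := ℂ) η ξ).comp_snd _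
    refine h2.bdd_mul (c := 1) (Continuous.aestronglyMeasurable ?_)
      (Eventually.of_forall fun z => (Complex.norm_exp_I_mul_ofReal _).le)
    unfold pair coad; fun_prop

/-- The set of all `E(x) exp(y)` with `x ∈ A` and `y ∈ B`. -/
def rect (A B : Set R3) : Set G6 := {g | g.x ∈ A ∧ g.y ∈ B}

theorem volume_rect (A B : Set R3) : volume (rect A B) = volume A * volume B :=
  Measure.prod_prod A B

theorem measurableSet_rect {A B : Set R3} (hA : MeasurableSet A) (hB : MeasurableSet B) :
    MeasurableSet (rect A B) :=
  (hA.prod hB : MeasurableSet (A ×ˢ B : Set (R3 × R3)))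

/-- The functional l enters only through the multiplier on the right. This is what reduces the
comparison of different σ_l to a comparison of functions of u. -/
theorem sigma_ofL1_indicator (l : R3) {A B : Set R3} (hA : volume A ≠ ⊤) (hB : volume B ≠ ⊤)
    (hs : MeasurableSet (rect A B)) (hv : volume (rect A B) ≠ ⊤) :
    sigma l (ofL1 (indicatorConstLp 1 hs hv (1 : ℂ)))
      = transInt hA ∘L mulOp (fun u => charInt B (coad u l)) := by
  refine ContinuousLinearMap.ext fun ξ => ?_
  rw [sigma_ofL1_apply, ContinuousLinearMap.comp_apply, ← setIntegral_sigmaOp_mk_zero l hB,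
    transInt_apply]
  have h1 : ∫ g, (indicatorConstLp 1 hs hv (1 : ℂ) : Lp ℂ 1 (volume : Measure G6)) g
      • sigmaOp l g ξ = ∫ g in rect A B, sigmaOp l g ξ := by
    rw [← integral_indicator hs]
    refine integral_congr_ae ?_
    filter_upwards [indicatorConstLp_coeFn (hs := hs) (hμs := hv) (c := (1 : ℂ)) (p := 1)] with g hg
    rw [hg]
    by_cases h : g ∈ rect A B <;> simp [h]
  have h2 : ∫ g in rect A B, sigmaOp l g ξ
      = ∫ z in A ×ˢ B, sigmaOp l (G6.mk z.1 z.2) ξ ∂((volume : Measure R3).prod volume) := rfl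
  rw [h1, h2, setIntegral_prod]
  · refine integral_congr_ae (Eventually.of_forall fun x => ?_)
    have h3 := (transOp x).toContinuousLinearMap.integral_comp_comm
      (integrableOn_sigmaOp_mk_zero l hB ξ)
    simp only [LinearIsometry.coe_toContinuousLinearMap, ← sigmaOp_mk] at h3
    exact h3
  · exact Measure.integrableOn_of_bounded hv (continuous_sigmaOp_mk l ξ).aestronglyMeasurable
      (M := ‖ξ‖) (Eventually.of_forall fun _ => ((sigmaOp l _).norm_map ξ).le)

/-! ## Compactness -/

/-- The operator `ξ ↦ ∫ ξ(u) Φ(u) du` for a square integrable vector valued function `Φ`. -/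
def kernelOp {H : Type*} [NormedAddCommGroup H] [InnerProductSpace ℂ H] [CompleteSpace H] :
    Lp H 2 (volume : Measure R3) →L[ℂ] L2R3 →L[ℂ] H :=
  ((ContinuousLinearMap.lsmul ℂ ℂ : ℂ →L[ℂ] H →L[ℂ] H).lpPairing volume 2 2).flip

theorem kernelOp_apply {H : Type*} [NormedAddCommGroup H] [InnerProductSpace ℂ H]
    [CompleteSpace H] (Φ : Lp H 2 (volume : Measure R3)) (ξ : L2R3) :
    kernelOp Φ ξ = ∫ u, ξ u • Φ u :=
  (ContinuousLinearMap.lsmul ℂ ℂ : ℂ →L[ℂ] H →L[ℂ] H).lpPairing_eq_integral ξ Φ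

/-- An indicator times a fixed vector gives an operator of rank at most one. Sums and norm limits of
such operators are compact, and these Φ generate L²(ℝ³; H). -/
theorem isCompactOperator_kernelOp {H : Type*} [NormedAddCommGroup H] [InnerProductSpace ℂ H]
    [CompleteSpace H] (Φ : Lp H 2 (volume : Measure R3)) : IsCompactOperator (kernelOp Φ) := by
  refine Lp.induction (p := 2) (by norm_num)
    (motive := fun Φ : Lp H 2 (volume : Measure R3) => IsCompactOperator (kernelOp Φ)) ?_ ?_ ?_ Φ
  · intro c s hs hμs
    have h : kernelOp (Lp.simpleFunc.indicatorConst 2 hs hμs.ne c : Lp H 2 (volume : Measure R3))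
        = ContinuousLinearMap.toSpanSingleton ℂ c ∘L
          kernelOp (indicatorConstLp 2 hs hμs.ne (1 : ℂ)) := by
      refine ContinuousLinearMap.ext fun ξ => ?_
      rw [Lp.simpleFunc.coe_indicatorConst, ContinuousLinearMap.comp_apply, kernelOp_apply,
        kernelOp_apply, ContinuousLinearMap.toSpanSingleton_apply, ← integral_smul_const]
      refine integral_congr_ae ?_
      filter_upwards [indicatorConstLp_coeFn (hs := hs) (hμs := hμs.ne) (c := c) (p := 2),
        indicatorConstLp_coeFn (hs := hs) (hμs := hμs.ne) (c := (1 : ℂ)) (p := 2)] with u h1 h2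
      rw [h1, h2]
      by_cases hu : u ∈ s <;> simp [hu]
    rw [h]
    exact (isCompactOperator_of_locallyCompactSpace_rng
      (ContinuousLinearMap.toSpanSingleton ℂ c)).comp_clm _
  · intro f g hf hg _ h1 h2
    rw [map_add]
    exact h1.add h2
  · exact isClosed_setOfPred_isCompactOperator.preimage kernelOp.continuous

/-- In a second countable space the balls generate the Borel sets, so measurability of all the
distances suffices. It is applied to the columns of the kernel, whose distances to a fixed vector
are parametric integrals. -/
theorem stronglyMeasurable_of_norm_sub {α E : Type*} [MeasurableSpace α] [NormedAddCommGroup E]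
    [SecondCountableTopology E] {f : α → E} (hf : ∀ v, Measurable fun x => ‖f x - v‖) :
    StronglyMeasurable f := by
  borelize E
  have hb : TopologicalSpace.IsTopologicalBasis {s : Set E | ∃ v r, s = Metric.ball v r} := by
    refine TopologicalSpace.isTopologicalBasis_of_isOpen_of_nhds ?_ fun a u ha hu => ?_
    · rintro _ ⟨v, r, rfl⟩
      exact Metric.isOpen_ball
    · obtain ⟨r, hr, h⟩ := Metric.isOpen_iff.1 hu a ha
      exact ⟨_, ⟨a, r, rfl⟩, Metric.mem_ball_self hr, h⟩
  refine Measurable.stronglyMeasurable ?_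
  rw [BorelSpace.measurable_eq (α := E), hb.borel_eq_generateFrom]
  refine measurable_generateFrom ?_
  rintro _ ⟨v, r, rfl⟩
  have : f ⁻¹' Metric.ball v r = {x | ‖f x - v‖ < r} := by
    ext x
    simp [dist_eq_norm]
  rw [this]
  exact measurableSet_lt (hf v) measurable_const

theorem stronglyMeasurable_indicatorConstLp_fiber {E : Set (R3 × R3)} (hE : MeasurableSet E)
    (hm : ∀ u, MeasurableSet {h | (u, h) ∈ E}) (hv : ∀ u, volume {h | (u, h) ∈ E} ≠ ⊤) :
    StronglyMeasurable fun u => indicatorConstLp 2 (hm u) (hv u) (1 : ℂ) := by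
  have : Fact ((2 : ℝ≥0∞) ≠ ⊤) := ⟨by norm_num⟩
  refine stronglyMeasurable_of_norm_sub fun f => ?_
  have h (u : R3) : ‖indicatorConstLp 2 (hm u) (hv u) (1 : ℂ) - f‖
      = ((∫⁻ h, ‖E.indicator (fun _ => (1 : ℂ)) (u, h) - f h‖ₑ ^ (2 : ℝ)) ^ (1 / 2 : ℝ)).toReal := by
    rw [Lp.norm_def, eLpNorm_eq_lintegral_rpow_enorm_toReal (by norm_num) (by norm_num)]
    simp only [ENNReal.toReal_ofNat]
    congr 2
    refine lintegral_congr_ae ?_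
    filter_upwards [Lp.coeFn_sub (indicatorConstLp 2 (hm u) (hv u) (1 : ℂ)) f,
      indicatorConstLp_coeFn (hs := hm u) (hμs := hv u) (c := (1 : ℂ)) (p := 2)] with h h1 h2
    rw [h1, Pi.sub_apply, h2]
    by_cases hh : (u, h) ∈ E <;> simp [hh]
  simp only [h]
  refine ((Measurable.lintegral_prod_right' (f := fun z : R3 × R3 =>
    ‖E.indicator (fun _ => (1 : ℂ)) z - f z.2‖ₑ ^ (2 : ℝ)) ?_).pow_const _).ennreal_toReal
  exact (((measurable_const.indicator hE).sub
    ((Lp.stronglyMeasurable f).measurable.comp measurable_snd)).enorm).pow_const _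

/-! ### The kernel of Λ_A and compactness of Λ_A M_θ -/

/-- The density of Lebesgue measure under right translation by `E(u)`. -/
def rightDensity (u : R3) : ℝ := Real.exp ((u.1 - u.2.1) / 2)

theorem rightDensity_pos (u : R3) : 0 < rightDensity u := Real.exp_pos _

/-- Right translation shifts a and b and acts on p by p ↦ cp + u_p with c = e^{(-a+b)/2} for u =
(a,b,u_p), so the density is 1/c. -/
theorem map_eMul_right (u : R3) : Measure.map (fun x => eMul x u) (volume : Measure R3)
    = ENNReal.ofReal (rightDensity u) • volume := by
  set c := Real.exp ((-u.1 + u.2.1) / 2) with hc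
  have hc0 : c ≠ 0 := (Real.exp_pos _).ne'
  have h3 : Measure.map (fun p : ℝ => c * p + u.2.2) volume
      = ENNReal.ofReal (rightDensity u) • volume := by
    have h4 : Measure.map (fun p : ℝ => c * p + u.2.2) volume
        = Measure.map (fun p : ℝ => p + u.2.2) (Measure.map (fun p : ℝ => c * p) volume) := by
      rw [Measure.map_map (by fun_prop) (by fun_prop)]
      rfl
    rw [h4, Real.map_volume_mul_left hc0, Measure.map_smul, map_add_right_eq_self, rightDensity,
      hc, ← Real.exp_neg, abs_of_pos (Real.exp_pos _)]
    congr 4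
    ring
  have h2 : Measure.map (Prod.map (fun b : ℝ => b + u.2.1) (fun p : ℝ => c * p + u.2.2)) volume
      = ENNReal.ofReal (rightDensity u) • (volume : Measure (ℝ × ℝ)) := by
    rw [Measure.volume_eq_prod, ← Measure.map_prod_map _ _ (by fun_prop) (by fun_prop), h3,
      map_add_right_eq_self, Measure.prod_smul_right]
  have h1 : (fun x => eMul x u) = Prod.map (fun a : ℝ => a + u.1)
      (Prod.map (fun b : ℝ => b + u.2.1) (fun p : ℝ => c * p + u.2.2)) := rfl
  rw [h1, Measure.volume_eq_prod, ← Measure.map_prod_map _ _ (by fun_prop) (by fun_prop), h2,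
    map_add_right_eq_self, Measure.prod_smul_right]

theorem measurable_eMul_right (u : R3) : Measurable fun x => eMul x u := by
  unfold eMul; fun_prop

/-- The set of pairs `(u, h)` with `h u⁻¹ ∈ A`. -/
def quotSet (A : Set R3) : Set (R3 × R3) := {z | eMul z.2 (eInv z.1) ∈ A}

theorem measurableSet_quotSet {A : Set R3} (hA : MeasurableSet A) : MeasurableSet (quotSet A) := by
  refine Continuous.measurable (f := fun z : R3 × R3 => eMul z.2 (eInv z.1)) ?_ hA
  unfold eMul eInv; fun_prop

theorem measurableSet_quotSet_fiber {A : Set R3} (hA : MeasurableSet A) (u : R3) :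
    MeasurableSet {h | (u, h) ∈ quotSet A} :=
  measurable_eMul_right (eInv u) hA

theorem volume_quotSet_fiber {A : Set R3} (hA : MeasurableSet A) (u : R3) :
    volume {h | (u, h) ∈ quotSet A} = ENNReal.ofReal (rightDensity (eInv u)) * volume A := by
  rw [← smul_eq_mul, ← Measure.smul_apply, ← map_eMul_right,
    Measure.map_apply (measurable_eMul_right _) hA]
  rfl

theorem volume_quotSet_fiber_ne_top {A : Set R3} (hA : MeasurableSet A) (hv : volume A ≠ ⊤)
    (u : R3) : volume {h | (u, h) ∈ quotSet A} ≠ ⊤ := by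
  rw [volume_quotSet_fiber hA]
  exact ENNReal.mul_ne_top ENNReal.ofReal_ne_top hv

theorem continuous_rightDensity : Continuous rightDensity := by
  unfold rightDensity; fun_prop

/-- The columns of the integral kernel of `transInt`. -/
def column {A : Set R3} (hA : MeasurableSet A) (hv : volume A ≠ ⊤) (u : R3) : L2R3 :=
  (rightDensity u : ℂ) • indicatorConstLp 2 (measurableSet_quotSet_fiber hA u)
    (volume_quotSet_fiber_ne_top hA hv u) (1 : ℂ)

theorem stronglyMeasurable_column {A : Set R3} (hA : MeasurableSet A) (hv : volume A ≠ ⊤) :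
    StronglyMeasurable (column hA hv) :=
  (Complex.continuous_ofReal.comp continuous_rightDensity).stronglyMeasurable.smul
    (stronglyMeasurable_indicatorConstLp_fiber (measurableSet_quotSet hA) _ _)

theorem norm_column {A : Set R3} (hA : MeasurableSet A) (hv : volume A ≠ ⊤) (u : R3) :
    ‖column hA hv u‖ = rightDensity u * (rightDensity (eInv u) * volume.real A) ^ (1 / 2 : ℝ) := by
  rw [column, norm_smul, norm_indicatorConstLp (by norm_num) (by norm_num), Measure.real,
    volume_quotSet_fiber hA, ENNReal.toReal_mul, ENNReal.toReal_ofReal (rightDensity_pos _).le,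
    Complex.norm_real, Real.norm_of_nonneg (rightDensity_pos _).le, norm_one, one_mul]
  rfl

theorem continuous_norm_column {A : Set R3} (hA : MeasurableSet A) (hv : volume A ≠ ⊤) :
    Continuous fun u => ‖column hA hv u‖ := by
  simp only [norm_column]
  refine continuous_rightDensity.mul (Continuous.rpow_const ?_ fun _ => Or.inr (by norm_num))
  exact (continuous_rightDensity.comp continuous_eInv).mul continuous_const

/-- The substitution h = xu. The density in `column` is the one that makes ∫ ξ(u) column(u) du equal
to Λ_A ξ, in the weak sense. -/
theorem inner_column {A : Set R3} (hA : MeasurableSet A) (hv : volume A ≠ ⊤) (u : R3) (η : L2R3) :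
    inner ℂ η (column hA hv u) = ∫ x in A, inner ℂ (η (eMul x u)) (1 : ℂ) := by
  have h1 : inner ℂ η (column hA hv u)
      = (rightDensity u : ℂ) * ∫ h in {h | (u, h) ∈ quotSet A}, inner ℂ (η h) (1 : ℂ) := by
    rw [column, inner_smul_right, L2.inner_def, ← integral_indicator (measurableSet_quotSet_fiber hA u)]
    congr 1
    refine integral_congr_ae ?_
    filter_upwards [indicatorConstLp_coeFn (hs := measurableSet_quotSet_fiber hA u)
      (hμs := volume_quotSet_fiber_ne_top hA hv u) (c := (1 : ℂ)) (p := 2)] with h hh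
    rw [hh]
    by_cases hu : (u, h) ∈ quotSet A <;> simp [hu]
  have h2 : ∫ x in A, inner ℂ (η (eMul x u)) (1 : ℂ)
      = ∫ x, {h | (u, h) ∈ quotSet A}.indicator (fun h => inner ℂ (η h) (1 : ℂ)) (eMul x u) := by
    rw [← integral_indicator hA]
    refine integral_congr_ae (Eventually.of_forall fun x => ?_)
    have hx : (u, eMul x u) ∈ quotSet A ↔ x ∈ A := by
      rw [quotSet, mem_ofPred_eq, eMul_assoc, eMul_eInv, eMul_zero]
    by_cases h : x ∈ A
    · simp [h, hx.2 h]
    · simp [h, mt hx.1 h]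
  have hmeas : StronglyMeasurable
      ({h | (u, h) ∈ quotSet A}.indicator fun h => inner ℂ (η h) (1 : ℂ)) :=
    ((Lp.stronglyMeasurable η).inner stronglyMeasurable_const).indicator
      (measurableSet_quotSet_fiber hA u)
  rw [h1, h2, ← integral_map (measurable_eMul_right u).aemeasurable hmeas.aestronglyMeasurable,
    map_eMul_right, integral_smul_measure, integral_indicator (measurableSet_quotSet_fiber hA u),
    ENNReal.toReal_ofReal (rightDensity_pos _).le, Complex.real_smul]

theorem inner_transOp (x : R3) (η ζ : L2R3) :
    inner ℂ η (transOp x ζ) = ∫ u, inner ℂ (η (eMul x u)) (ζ u) := by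
  have h0 : eInv (eInv x) = x := by
    calc eInv (eInv x) = eMul (eInv (eInv x)) (eMul (eInv x) x) := by rw [eInv_eMul, eMul_zero]
      _ = x := by rw [← eMul_assoc, eInv_eMul, zero_eMul]
  have h1 : transOp (eInv x) (transOp x ζ) = ζ := by
    refine Lp.ext ?_
    have h2 := (measurePreserving_eMul (eInv (eInv x))).quasiMeasurePreserving.ae
      (transOp_coeFn x ζ)
    filter_upwards [transOp_coeFn (eInv x) (transOp x ζ), h2] with h e1 e2
    rw [e1, e2, h0, ← eMul_assoc, eInv_eMul, zero_eMul]
  rw [← (transOp (eInv x)).inner_map_map η, h1, L2.inner_def]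
  refine integral_congr_ae ?_
  filter_upwards [transOp_coeFn (eInv x) η] with u hu
  rw [hu, h0]

theorem integrable_inner_eMul {A : Set R3} (hA : volume A ≠ ⊤) (η ζ : L2R3) :
    Integrable (fun z : R3 × R3 => inner ℂ (η (eMul z.1 z.2)) (ζ z.2))
      ((volume.restrict A).prod volume) := by
  have : IsFiniteMeasure (volume.restrict A) := ⟨by simpa using hA.lt_top⟩
  have hsq (ζ : L2R3) : Integrable (fun z : R3 × R3 => ‖ζ z.2‖ ^ 2)
      ((volume.restrict A).prod volume) :=
    ((Lp.memLp ζ).integrable_norm_pow (by norm_num)).comp_snd _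
  -- The shear (x,u) ↦ (x,xu) preserves the measure, so |η(xu)|² is integrable together with
  -- |η(u)|², and the product is dominated by a sum of squares.
  have hmp : MeasurePreserving (fun z : R3 × R3 => (z.1, eMul z.1 z.2))
      ((volume.restrict A).prod volume) ((volume.restrict A).prod volume) :=
    (MeasurePreserving.id _).skew_product continuous_eMul.measurable
      (Eventually.of_forall fun x => (measurePreserving_eMul x).map_eq)
  have h1 := hmp.integrable_comp_of_integrable (hsq η)
  refine (h1.add (hsq ζ)).mono' ?_ (Eventually.of_forall fun z => ?_)
  · exact (((Lp.stronglyMeasurable η).comp_measurable continuous_eMul.measurable).inner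
      ((Lp.stronglyMeasurable ζ).comp_measurable measurable_snd)).aestronglyMeasurable
  · refine (norm_inner_le_norm _ _).trans ?_
    simp only [Pi.add_apply, Function.comp_apply]
    nlinarith [sq_nonneg (‖η (eMul z.1 z.2)‖ - ‖ζ z.2‖), sq_nonneg ‖η (eMul z.1 z.2)‖,
      sq_nonneg ‖ζ z.2‖]

/-- Λ_A M_θ is the operator with the columns θ(u) column(u). The norm of `column` is continuous,
hence bounded on the ball that carries θ, so these columns are square integrable. -/
theorem isCompactOperator_transInt_mulOp {A : Set R3} (hA : MeasurableSet A) (hv : volume A ≠ ⊤)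
    {θ : R3 → ℂ} (hθ : Measurable θ) {C : ℝ} (hC : ∀ u, ‖θ u‖ ≤ C) {R : ℝ}
    (hR : ∀ u, R < ‖u‖ → θ u = 0) : IsCompactOperator (transInt hv ∘L mulOp θ) := by
  have hmem : MemLp (fun u => θ u • column hA hv u) 2 (volume : Measure R3) := by
    obtain ⟨M, hM⟩ := (isCompact_closedBall (0 : R3) R).exists_bound_of_continuousOn
      (continuous_norm_column hA hv).continuousOn
    have h1 : (fun u => θ u • column hA hv u)
        = (Metric.closedBall 0 R).indicator fun u => θ u • column hA hv u := by
      funext u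
      by_cases hu : u ∈ Metric.closedBall (0 : R3) R
      · rw [indicator_of_mem hu]
      · rw [indicator_of_notMem hu, hR u (by simpa using hu), zero_smul]
    have : IsFiniteMeasure ((volume : Measure R3).restrict (Metric.closedBall 0 R)) :=
      ⟨by simpa using (isCompact_closedBall (0 : R3) R).measure_lt_top⟩
    rw [h1, memLp_indicator_iff_restrict Metric.isClosed_closedBall.measurableSet]
    refine MemLp.of_bound (hθ.stronglyMeasurable.smul
      (stronglyMeasurable_column hA hv)).aestronglyMeasurable (C * M) ?_
    refine (ae_restrict_iff' Metric.isClosed_closedBall.measurableSet).2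
      (Eventually.of_forall fun u hu => ?_)
    have := hM u hu
    rw [norm_norm] at this
    rw [norm_smul]
    exact mul_le_mul (hC u) this (norm_nonneg _) ((norm_nonneg _).trans (hC u))
  have hθm := memLp_top_of_measurable hθ hC
  suffices h : transInt hv ∘L mulOp θ = kernelOp hmem.toLp by
    rw [h]
    exact isCompactOperator_kernelOp _
  refine ContinuousLinearMap.ext fun ξ => ext_inner_left ℂ fun η => ?_
  have hint : Integrable (fun u => ξ u • hmem.toLp _ u) (volume : Measure R3) :=
    memLp_one_iff_integrable.1 ((Lp.memLp (hmem.toLp _)).smul (Lp.memLp ξ))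
  rw [ContinuousLinearMap.comp_apply, transInt_apply, kernelOp_apply,
    ← integral_inner (integrableOn_transOp hv _)]
  refine Eq.trans ?_ (integral_inner (𝕜 := ℂ) hint η)
  simp only [inner_transOp]
  rw [integral_integral_swap (integrable_inner_eMul hv η (mulOp θ ξ))]
  refine integral_congr_ae ?_
  filter_upwards [mulOp_coeFn hθm ξ, hmem.coeFn_toLp] with u h1 h2
  rw [h2, h1, inner_smul_right, inner_smul_right, inner_column, ← integral_const_mul,
    ← integral_const_mul]
  refine integral_congr_ae (Eventually.of_forall fun x => ?_)
  simp only [RCLike.inner_apply]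
  ring

/-! ## Comparison of the coadjoint orbits on the regions -/

theorem coad_eq (a b p : ℝ) (l : R3) : coad (a, b, p) l
    = (Real.exp (-b / 2) ^ 2 * (l.1 - p * l.2.1 + p ^ 2 / 2 * l.2.2),
      Real.exp (-a / 2) * Real.exp (-b / 2) * (l.2.1 - p * l.2.2),
      Real.exp (-a / 2) ^ 2 * l.2.2) := by
  rw [← Real.exp_add, ← Real.exp_nat_mul, ← Real.exp_nat_mul, coad]
  have h1 : ((2 : ℕ) : ℝ) * (-b / 2) = -b := by push_cast; ring
  have h2 : ((2 : ℕ) : ℝ) * (-a / 2) = -a := by push_cast; ring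
  have h3 : -(a + b) / 2 = -a / 2 + -b / 2 := by ring
  rw [h1, h2, h3]

theorem exp_neg_eq_sq (a : ℝ) : Real.exp (-a) = Real.exp (-a / 2) ^ 2 := by
  rw [← Real.exp_nat_mul]
  congr 1
  push_cast
  ring

theorem norm_R3_le {x y z ρ : ℝ} (hx : |x| ≤ ρ) (hy : |y| ≤ ρ) (hz : |z| ≤ ρ) :
    ‖((x, y, z) : R3)‖ ≤ ρ :=
  norm_prod_le_iff.2 ⟨hx, norm_prod_le_iff.2 ⟨hy, hz⟩⟩

theorem le_norm_R3_fst {M x y z : ℝ} (h : M ≤ |x|) : M ≤ ‖((x, y, z) : R3)‖ :=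
  h.trans (norm_fst_le ((x, y, z) : R3))

theorem le_norm_R3_snd {M x y z : ℝ} (h : M ≤ |y|) : M ≤ ‖((x, y, z) : R3)‖ :=
  h.trans ((norm_fst_le ((y, z) : ℝ × ℝ)).trans (norm_snd_le ((x, y, z) : R3)))

theorem le_norm_R3_thd {M x y z : ℝ} (h : M ≤ |z|) : M ≤ ‖((x, y, z) : R3)‖ :=
  h.trans ((norm_snd_le ((y, z) : ℝ × ℝ)).trans (norm_snd_le ((x, y, z) : R3)))

section Symbols

variable {ε : ℝ} {ψ : R3 → ℂ} {η M ρ : ℝ}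

/-- Outside a ball one of four things happens: e^{-a} is large, e^{-b} is small, e^{-b} is large, or
e^{-(a+b)/2}|p| is large. The radius R may depend on δ, because a compact operator is removed
separately for each δ. -/
theorem norm_symbol_sub_le_of_S1 (hε : ε = 1 ∨ ε = -1) (hη : 0 < η) (hM : 1 ≤ M) (hρ : 0 < ρ)
    (hψM : ∀ l, M ≤ ‖l‖ → ‖ψ l‖ ≤ η / 2) (hψρ : ∀ l l', ‖l - l'‖ ≤ ρ → ‖ψ l - ψ l'‖ ≤ η)
    {φ : ℝ → ℝ} (hφ_supp : tsupport φ ⊆ Icc (-1) 1)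
    (hφ_one : ∀ x ∈ Icc (-(1 / 2) : ℝ) (1 / 2), φ x = 1) (hφ_le : ∀ x, |φ x| ≤ 1)
    {δ : ℝ} (hδ : 0 < δ) : ∃ R : ℝ, ∀ u : R3, R < ‖u‖ → u ∈ S1 δ →
      ‖ψ (coad u (-ε, 0, ε)) - ψ (coad u (0, 0, ε)) * (φ (-Real.exp (-u.2.1)) : ℂ)‖ ≤ η := by
  have hεabs : |ε| = 1 := by rcases hε with rfl | rfl <;> simp
  -- For e^{-b} ≤ m the cutoff φ is 1 and the functionals differ by at most ρ. For e^{-b} ≥ M' the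
  -- cutoff is 0, and M' is chosen so that e^{-b}/2 ≥ M and, since e^{-a} > δ⁶, also e^{-a}e^{-b} ≥
  -- M².
  set m := min ρ (1 / 2) with hm
  have hm0 : 0 < m := lt_min hρ (by norm_num)
  set M' := 2 * M + M ^ 2 / δ ^ 6 with hM'
  have hM'0 : 2 * M ≤ M' := by rw [hM']; linarith [show 0 ≤ M ^ 2 / δ ^ 6 by positivity]
  have hM'1 : M ^ 2 ≤ M' * δ ^ 6 := by
    rw [hM', add_mul, div_mul_cancel₀ _ (by positivity)]
    have : 0 ≤ 2 * M * δ ^ 6 := by positivity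
    linarith
  -- The sum of the bounds for |a|, |b| and |p| that hold when all the other cases fail.
  refine ⟨|Real.log M| + |Real.log (δ ^ 6)| + (|Real.log M'| + |Real.log m|)
    + √(M ^ 2 / (δ ^ 6 * m)), ?_⟩
  rintro ⟨a, b, p⟩ hu h1
  change δ ^ 6 < Real.exp (-a) at h1
  change ‖ψ (coad (a, b, p) (-ε, 0, ε)) - ψ (coad (a, b, p) (0, 0, ε)) * (φ (-Real.exp (-b)) : ℂ)‖ ≤ η
  have hsmall (h0 : M ≤ ‖coad (a, b, p) (-ε, 0, ε)‖) (h1 : M ≤ ‖coad (a, b, p) (0, 0, ε)‖) :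
      ‖ψ (coad (a, b, p) (-ε, 0, ε)) - ψ (coad (a, b, p) (0, 0, ε)) * (φ (-Real.exp (-b)) : ℂ)‖
        ≤ η := by
    refine (norm_sub_le _ _).trans ?_
    rw [norm_mul, Complex.norm_real, Real.norm_eq_abs]
    have e1 := hψM _ h0
    have e2 := hψM _ h1
    have e3 := mul_le_mul e2 (hφ_le (-Real.exp (-b))) (abs_nonneg _) (by linarith)
    linarith
  have hmid (hp : M ^ 2 ≤ Real.exp (-a) * Real.exp (-b) * p ^ 2) :
      M ≤ |Real.exp (-a / 2) * Real.exp (-b / 2) * (0 - p * ε)| := by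
    refine le_of_sq_le_sq ?_ (abs_nonneg _)
    rw [sq_abs]
    have : ε ^ 2 = 1 := by rw [← sq_abs, hεabs, one_pow]
    rw [exp_neg_eq_sq a, exp_neg_eq_sq b] at hp
    calc M ^ 2 ≤ _ := hp
      _ = Real.exp (-a / 2) ^ 2 * Real.exp (-b / 2) ^ 2 * (p ^ 2 * ε ^ 2) := by rw [this, mul_one]
      _ = _ := by ring
  by_cases ha : M ≤ Real.exp (-a)
  · have e : M ≤ |Real.exp (-a / 2) ^ 2 * ε| := by
      rwa [abs_mul, hεabs, mul_one, ← exp_neg_eq_sq, abs_of_pos (Real.exp_pos _)]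
    refine hsmall ?_ ?_ <;> rw [coad_eq] <;> exact le_norm_R3_thd e
  by_cases hb : Real.exp (-b) ≤ m
  · rw [hφ_one _ ⟨by linarith [min_le_right ρ (1 / 2)], by linarith [Real.exp_pos (-b)]⟩,
      Complex.ofReal_one, mul_one]
    refine hψρ _ _ ?_
    rw [coad_eq, coad_eq]
    refine norm_R3_le ?_ ?_ ?_
    · have : Real.exp (-b / 2) ^ 2 * (-ε - p * 0 + p ^ 2 / 2 * ε)
          - Real.exp (-b / 2) ^ 2 * (0 - p * 0 + p ^ 2 / 2 * ε) = -(Real.exp (-b) * ε) := by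
        rw [exp_neg_eq_sq b]; ring
      dsimp only
      rw [this, abs_neg, abs_mul, hεabs, mul_one, abs_of_pos (Real.exp_pos _)]
      exact hb.trans (min_le_left _ _)
    · simpa using hρ.le
    · simpa using hρ.le
  by_cases hb' : M' ≤ Real.exp (-b)
  · have : φ (-Real.exp (-b)) = 0 := by
      refine image_eq_zero_of_notMem_tsupport fun h => ?_
      linarith [(hφ_supp h).1]
    rw [this, Complex.ofReal_zero, mul_zero, sub_zero]
    refine (hψM _ ?_).trans (by linarith)
    rw [coad_eq]
    -- Where |p| ≤ 1 the Q-coordinate is at least e^{-b}/2 in absolute value; where |p| > 1 the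
    -- R-coordinate is large.
    by_cases hp : p ^ 2 ≤ 1
    · refine le_norm_R3_fst ?_
      dsimp only
      have e : Real.exp (-b / 2) ^ 2 * (-ε - p * 0 + p ^ 2 / 2 * ε)
          = -(ε * (Real.exp (-b) * (1 - p ^ 2 / 2))) := by
        rw [exp_neg_eq_sq b]; ring
      rw [e, abs_neg, abs_mul, hεabs, one_mul]
      refine le_trans ?_ (le_abs_self _)
      nlinarith
    · refine le_norm_R3_snd (hmid ?_)
      push Not at hp
      have e1 : M' * δ ^ 6 ≤ Real.exp (-a) * Real.exp (-b) := by
        rw [mul_comm]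
        gcongr
      have : 0 < Real.exp (-a) * Real.exp (-b) := by positivity
      nlinarith
  · by_cases hp : M ^ 2 ≤ Real.exp (-a) * Real.exp (-b) * p ^ 2
    · refine hsmall ?_ ?_ <;> rw [coad_eq] <;> exact le_norm_R3_snd (hmid hp)
    · exfalso
      push Not at ha hb hb' hp
      have la1 : -a < Real.log M := by rwa [Real.lt_log_iff_exp_lt (by linarith)]
      have la2 : Real.log (δ ^ 6) < -a := by rwa [Real.log_lt_iff_lt_exp (by positivity)]
      have lb1 : -b < Real.log M' := by rwa [Real.lt_log_iff_exp_lt (by linarith)]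
      have lb2 : Real.log m < -b := by rwa [Real.log_lt_iff_lt_exp hm0]
      have lp : |p| ≤ √(M ^ 2 / (δ ^ 6 * m)) := by
        refine Real.abs_le_sqrt ?_
        rw [le_div_iff₀ (by positivity), mul_comm]
        refine le_trans ?_ hp.le
        gcongr
      have ha' : |a| ≤ |Real.log M| + |Real.log (δ ^ 6)| := by
        rw [abs_le]
        constructor
        · linarith [le_abs_self (Real.log M), abs_nonneg (Real.log (δ ^ 6))]
        · linarith [neg_abs_le (Real.log (δ ^ 6)), abs_nonneg (Real.log M)]
      have hb'' : |b| ≤ |Real.log M'| + |Real.log m| := by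
        rw [abs_le]
        constructor
        · linarith [le_abs_self (Real.log M'), abs_nonneg (Real.log m)]
        · linarith [neg_abs_le (Real.log m), abs_nonneg (Real.log M')]
      refine absurd hu (not_lt.2 (norm_R3_le ?_ ?_ ?_))
      · linarith [abs_nonneg b, abs_nonneg p]
      · linarith [abs_nonneg a, abs_nonneg p]
      · linarith [abs_nonneg a, abs_nonneg b]

/-- Dropping -εQ* changes only the Q-coordinate, and by e^{-b} < δ. -/
theorem norm_symbol_sub_le_of_S2 (hε : ε = 1 ∨ ε = -1)
    (hψρ : ∀ l l', ‖l - l'‖ ≤ ρ → ‖ψ l - ψ l'‖ ≤ η) {δ : ℝ} (hδ : 0 < δ) (hδρ : δ ≤ ρ)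
    {u : R3} (hu : u ∈ S2 δ) : ‖ψ (coad u (-ε, 0, ε)) - ψ (coad u (0, 0, ε))‖ ≤ η := by
  have hεabs : |ε| = 1 := by rcases hε with rfl | rfl <;> simp
  have hρ : 0 < ρ := hδ.trans_le hδρ
  obtain ⟨a, b, p⟩ := u
  have hb : Real.exp (-b) < δ := hu.2
  refine hψρ _ _ ?_
  rw [coad_eq, coad_eq]
  refine norm_R3_le ?_ ?_ ?_
  · have : Real.exp (-b / 2) ^ 2 * (-ε - p * 0 + p ^ 2 / 2 * ε)
        - Real.exp (-b / 2) ^ 2 * (0 - p * 0 + p ^ 2 / 2 * ε) = -(Real.exp (-b) * ε) := by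
      rw [exp_neg_eq_sq b]; ring
    dsimp only
    rw [this, abs_neg, abs_mul, hεabs, mul_one, abs_of_pos (Real.exp_pos _)]
    linarith
  · simpa using hρ.le
  · simpa using hρ.le

/-- The functional ε(τ√2R* - 2Q*) replaces p²/2 - 1 by its tangent line at the zero p = -τ√2. With s
= e^{-b/2}, t = e^{-a/2} and w = s(p+τ√2), the coordinates differ in absolute value by w²/2, t|w|
and t². Writing δ = g⁴ makes all the powers of δ integral powers of g. -/
theorem norm_symbol_sub_le_of_S4 (hε : ε = 1 ∨ ε = -1)
    (hψρ : ∀ l l', ‖l - l'‖ ≤ ρ → ‖ψ l - ψ l'‖ ≤ η) {g : ℝ} (hg : 0 < g) (hg2 : g ≤ 1 / 2)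
    (hgρ : g ≤ ρ) {τ : ℝ} (hτ : τ = 1 ∨ τ = -1) {u : R3} (hu : u ∈ S4 τ (g ^ 4)) :
    ‖ψ (coad u (-ε, 0, ε)) - ψ (coad u (ε * -2, ε * (τ * √2), 0))‖ ≤ η := by
  have hεabs : |ε| = 1 := by rcases hε with rfl | rfl <;> simp
  have hτ2 : τ ^ 2 = 1 := by rcases hτ with rfl | rfl <;> norm_num
  have hρ : 0 < ρ := hg.trans_le hgρ
  obtain ⟨a, b, p⟩ := u
  obtain ⟨h1, -, h3, h4⟩ := hu
  have hroot : (g ^ 4) ^ (1 / 2 : ℝ) = g ^ 2 := by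
    rw [← Real.sqrt_eq_rpow, show g ^ 4 = (g ^ 2) ^ 2 by ring, Real.sqrt_sq (by positivity)]
  dsimp only at h1 h3 h4
  rw [hroot] at h3
  rw [exp_neg_eq_sq] at h1
  set s := Real.exp (-b / 2) with hs
  set t := Real.exp (-a / 2) with ht
  have hs0 : 0 < s := Real.exp_pos _
  have ht0 : 0 < t := Real.exp_pos _
  have hr : √2 ^ 2 = 2 := Real.sq_sqrt (by norm_num)
  have hr0 : (0 : ℝ) < √2 := by positivity
  -- Since p²/2 - 1 = (p+τ√2)(p-τ√2)/2 and τp ≤ 0 keeps the second factor at least √2 in absolute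
  -- value, smallness of the product passes to w.
  have hw : (s * (p + τ * √2)) ^ 2 ≤ 2 * g ^ 4 := by
    have e1 : (s * (p ^ 2 / 2 - 1)) ^ 2 ≤ (g ^ 2) ^ 2 := by
      rw [← sq_abs (s * (p ^ 2 / 2 - 1)), abs_mul, abs_of_pos hs0]
      gcongr
    have e2 : 2 ≤ (p - τ * √2) ^ 2 := by
      have : (p - τ * √2) ^ 2 = p ^ 2 - 2 * (τ * p) * √2 + τ ^ 2 * √2 ^ 2 := by ring
      rw [this, hτ2, hr]
      nlinarith [sq_nonneg p]
    have e3 : (s * (p ^ 2 / 2 - 1)) ^ 2 = (s * (p + τ * √2)) ^ 2 * (p - τ * √2) ^ 2 / 4 := by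
      have : p ^ 2 / 2 - 1 = (p + τ * √2) * (p - τ * √2) / 2 := by
        have : (p + τ * √2) * (p - τ * √2) = p ^ 2 - τ ^ 2 * √2 ^ 2 := by ring
        rw [this, hτ2, hr]; ring
      rw [this]; ring
    nlinarith [sq_nonneg (s * (p + τ * √2))]
  have hg4 : g ^ 4 ≤ ρ := by
    have : g ^ 4 ≤ g ^ 1 := pow_le_pow_of_le_one hg.le (by linarith) (by norm_num)
    linarith
  have ht2 : t ^ 2 ≤ g ^ 4 := by
    have : (g ^ 4) ^ 6 ≤ (g ^ 4) ^ 1 :=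
      pow_le_pow_of_le_one (by positivity) (pow_le_one₀ hg.le (by linarith)) (by norm_num)
    linarith
  refine hψρ _ _ ?_
  rw [coad_eq, coad_eq]
  refine norm_R3_le ?_ ?_ ?_ <;> dsimp only
  · have : s ^ 2 * (-ε - p * 0 + p ^ 2 / 2 * ε)
        - s ^ 2 * (ε * -2 - p * (ε * (τ * √2)) + p ^ 2 / 2 * 0)
        = ε * ((s * (p + τ * √2)) ^ 2 / 2) := by
      have : (s * (p + τ * √2)) ^ 2 = s ^ 2 * (p ^ 2 + 2 * p * τ * √2 + τ ^ 2 * √2 ^ 2) := by ring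
      rw [this, hτ2, hr]; ring
    rw [this, abs_mul, hεabs, one_mul, abs_of_nonneg (by positivity)]
    linarith
  · have : t * s * (0 - p * ε) - t * s * (ε * (τ * √2) - p * 0)
        = -(ε * (t * (s * (p + τ * √2)))) := by ring
    rw [this, abs_neg, abs_mul, hεabs, one_mul]
    refine abs_le_of_sq_le_sq ?_ hρ.le
    rw [mul_pow]
    calc t ^ 2 * (s * (p + τ * √2)) ^ 2 ≤ g ^ 4 * (2 * g ^ 4) := by gcongr
      _ = 2 * g ^ 6 * g ^ 2 := by ring
      _ ≤ 1 * g ^ 2 := by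
        gcongr
        have : g ^ 6 ≤ (1 / 2) ^ 6 := by gcongr
        norm_num at this
        linarith
      _ ≤ ρ ^ 2 := by rw [one_mul]; gcongr
  · have : t ^ 2 * ε - t ^ 2 * 0 = ε * t ^ 2 := by ring
    rw [this, abs_mul, hεabs, one_mul, abs_of_nonneg (by positivity)]
    linarith

/-- Here q stands for the left endpoint of the interval of length δ² = g⁸ containing p. Freezing p
at q moves the Q-coordinate by e^{-b}|p²-q²|/2, which e^{-b} ≤ g⁻⁵ controls unless e^{-b}p² is
large; the R- and S-coordinates are killed by e^{-a} ≤ g²⁴. -/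
theorem norm_symbol_sub_le_of_S3 (hε : ε = 1 ∨ ε = -1) (hM : 1 ≤ M)
    (hψM : ∀ l, M ≤ ‖l‖ → ‖ψ l‖ ≤ η / 2) (hψρ : ∀ l l', ‖l - l'‖ ≤ ρ → ‖ψ l - ψ l'‖ ≤ η)
    {g : ℝ} (hg : 0 < g) (hg2 : g ≤ 1 / 2) (hgρ : 16 * M * g ≤ ρ) {a b p q : ℝ}
    (ha : Real.exp (-a) ≤ (g ^ 4) ^ 6) (hb : Real.exp (-b) * g ^ 5 ≤ 1)
    (hq : q ≤ p) (hpq : p ≤ q + g ^ 8) :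
    ‖ψ (coad (a, b, p) (-ε, 0, ε)) - ψ (coad (a, b, p) (ε * (-1 + q ^ 2 / 2), 0, 0))‖ ≤ η := by
  have hεabs : |ε| = 1 := by rcases hε with rfl | rfl <;> simp
  have hρ : 0 < ρ := lt_of_lt_of_le (by positivity) hgρ
  have hg1 : g ≤ 1 := by linarith
  rw [exp_neg_eq_sq] at ha hb
  rw [coad_eq, coad_eq]
  set s := Real.exp (-b / 2) with hs
  set t := Real.exp (-a / 2) with ht
  have hs0 : 0 < s := Real.exp_pos _
  have ht0 : 0 < t := Real.exp_pos _
  dsimp only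
  have hgp (n : ℕ) (hn : 1 ≤ n) : g ^ n ≤ g := by
    have := pow_le_pow_of_le_one hg.le hg1 hn
    rwa [pow_one] at this
  have hg8 : g ^ 8 ≤ 1 / 4 := by
    have := pow_le_pow_of_le_one hg.le hg1 (show 2 ≤ 8 by norm_num)
    nlinarith
  have hdiff : |p ^ 2 - q ^ 2| ≤ g ^ 8 * (2 * |p| + g ^ 8) := by
    have : p ^ 2 - q ^ 2 = (p - q) * (2 * p - (p - q)) := by ring
    rw [this, abs_mul, abs_of_nonneg (by linarith : 0 ≤ p - q)]
    refine mul_le_mul (by linarith) ?_ (abs_nonneg _) (by positivity)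
    refine (abs_sub _ _).trans ?_
    rw [abs_mul, abs_two, abs_of_nonneg (by linarith : 0 ≤ p - q)]
    linarith
  -- In this case both Q-coordinates exceed M, so both symbols are small. The threshold 8 gives q²/2
  -- - 1 ≥ p²/4 - 1 ≥ p²/8.
  by_cases hlarge : 8 < p ^ 2 ∧ 8 * M < s ^ 2 * p ^ 2
  · obtain ⟨hp8, hp⟩ := hlarge
    have hq2 : p ^ 2 / 2 ≤ q ^ 2 := by
      have e1 : g ^ 8 * (2 * |p| + g ^ 8) ≤ p ^ 2 / 2 := by
        have e2 : 2 ≤ |p| := by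
          refine le_of_sq_le_sq ?_ (abs_nonneg _)
          rw [sq_abs]; linarith
        have e3 : |p| ^ 2 = p ^ 2 := sq_abs p
        nlinarith [show 0 ≤ g ^ 8 by positivity]
      linarith [le_abs_self (p ^ 2 - q ^ 2)]
    refine (norm_sub_le _ _).trans ?_
    have h1 : M ≤ |s ^ 2 * (-ε - p * 0 + p ^ 2 / 2 * ε)| := by
      have : s ^ 2 * (-ε - p * 0 + p ^ 2 / 2 * ε) = ε * (s ^ 2 * (p ^ 2 / 2 - 1)) := by ring
      rw [this, abs_mul, hεabs, one_mul]
      refine le_trans ?_ (le_abs_self _)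
      nlinarith [sq_nonneg s]
    have h2 : M ≤ |s ^ 2 * (ε * (-1 + q ^ 2 / 2) - p * 0 + p ^ 2 / 2 * 0)| := by
      have : s ^ 2 * (ε * (-1 + q ^ 2 / 2) - p * 0 + p ^ 2 / 2 * 0)
          = ε * (s ^ 2 * (q ^ 2 / 2 - 1)) := by ring
      rw [this, abs_mul, hεabs, one_mul]
      refine le_trans ?_ (le_abs_self _)
      nlinarith [sq_nonneg s]
    linarith [hψM _ (le_norm_R3_fst (y := t * s * (0 - p * ε)) (z := t ^ 2 * ε) h1),
      hψM _ (le_norm_R3_fst (y := t * s * (0 - p * 0)) (z := t ^ 2 * 0) h2)]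
  · have hs8 : s ^ 2 * g ^ 8 ≤ g ^ 3 := by
      calc s ^ 2 * g ^ 8 = s ^ 2 * g ^ 5 * g ^ 3 := by ring
        _ ≤ 1 * g ^ 3 := by gcongr
        _ = g ^ 3 := one_mul _
    have hsp : (s ^ 2 * p ^ 2) * g ^ 8 ≤ 8 * M * g ^ 3 := by
      rcases le_or_gt (p ^ 2) 8 with h | h
      · calc s ^ 2 * p ^ 2 * g ^ 8 = s ^ 2 * g ^ 8 * p ^ 2 := by ring
          _ ≤ g ^ 3 * 8 := by gcongr
          _ = 8 * g ^ 3 := mul_comm _ _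
          _ ≤ 8 * M * g ^ 3 := by gcongr; linarith
      · have h' : s ^ 2 * p ^ 2 ≤ 8 * M := by
          by_contra hc
          exact hlarge ⟨h, by linarith⟩
        calc s ^ 2 * p ^ 2 * g ^ 8 ≤ 8 * M * g ^ 8 := by gcongr
          _ ≤ 8 * M * g ^ 3 := by
            have := pow_le_pow_of_le_one hg.le hg1 (show 3 ≤ 8 by norm_num)
            gcongr
    -- The geometric mean of `hs8` and `hsp`, with 8M ≤ 9M² because M ≥ 1.
    have hprod : s ^ 2 * g ^ 8 * |p| ≤ 3 * M * g ^ 3 := by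
      refine abs_le_of_sq_le_sq' ?_ (by positivity) |>.2
      calc (s ^ 2 * g ^ 8 * |p|) ^ 2 = (s ^ 2 * g ^ 8) * (s ^ 2 * |p| ^ 2 * g ^ 8) := by ring
        _ = (s ^ 2 * g ^ 8) * (s ^ 2 * p ^ 2 * g ^ 8) := by rw [sq_abs]
        _ ≤ g ^ 3 * (8 * M * g ^ 3) := by gcongr
        _ = 8 * M * (g ^ 3) ^ 2 := by ring
        _ ≤ 9 * M ^ 2 * (g ^ 3) ^ 2 :=
          mul_le_mul_of_nonneg_right (by nlinarith) (by positivity)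
        _ = (3 * M * g ^ 3) ^ 2 := by ring
    have hg3 := hgp 3 (by norm_num)
    refine hψρ _ _ (norm_R3_le ?_ ?_ ?_) <;> dsimp only
    · have : s ^ 2 * (-ε - p * 0 + p ^ 2 / 2 * ε)
          - s ^ 2 * (ε * (-1 + q ^ 2 / 2) - p * 0 + p ^ 2 / 2 * 0)
          = ε * (s ^ 2 * ((p ^ 2 - q ^ 2) / 2)) := by ring
      rw [this, abs_mul, hεabs, one_mul, abs_mul, abs_of_nonneg (sq_nonneg s), abs_div, abs_two]
      have e1 : s ^ 2 * (|p ^ 2 - q ^ 2| / 2) ≤ s ^ 2 * (g ^ 8 * (2 * |p| + g ^ 8) / 2) := by gcongr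
      have e2 : s ^ 2 * g ^ 8 * g ^ 8 ≤ g ^ 3 * 1 := by gcongr; linarith
      have e3 : M * g ^ 3 ≤ M * g := by gcongr
      have e4 : 1 * g ≤ M * g := by gcongr
      linarith
    · have : t * s * (0 - p * ε) - t * s * (0 - p * 0) = -(ε * (t * s * p)) := by ring
      rw [this, abs_neg, abs_mul, hεabs, one_mul]
      refine abs_le_of_sq_le_sq ?_ hρ.le
      calc (t * s * p) ^ 2 = t ^ 2 * (s ^ 2 * p ^ 2) := by ring
        _ ≤ (g ^ 4) ^ 6 * (s ^ 2 * p ^ 2) := by gcongr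
        _ = g ^ 16 * (s ^ 2 * p ^ 2 * g ^ 8) := by ring
        _ ≤ 1 * (8 * M * g ^ 3) := by
          gcongr
          exact pow_le_one₀ hg.le hg1
        _ ≤ (16 * M * g) ^ 2 := by
          have e1 : g ^ 3 ≤ g ^ 2 := pow_le_pow_of_le_one hg.le hg1 (by norm_num)
          have e2 : M ≤ M ^ 2 := by nlinarith
          have e3 : M * g ^ 3 ≤ M ^ 2 * g ^ 2 := by gcongr
          nlinarith [show 0 ≤ M ^ 2 * g ^ 2 by positivity]
        _ ≤ ρ ^ 2 := by gcongr
    · have : t ^ 2 * ε - t ^ 2 * 0 = ε * t ^ 2 := by ring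
      rw [this, abs_mul, hεabs, one_mul, abs_of_nonneg (by positivity)]
      have e1 := hgp 24 (by norm_num)
      have e2 : (g ^ 4) ^ 6 = g ^ 24 := by ring
      have e4 : 1 * g ≤ M * g := by gcongr
      linarith

/-- For e^{-b} ≥ δ^{-5/4} = g⁻⁵ and p away from ±√2 in the sense of `hp`, the approximating operator
has no term, so the original symbol must itself be small. The Q-coordinate squared is
e^{-b}·(e^{-b/2}|p²/2-1|)² ≥ g⁻⁵g⁴ = 1/g ≥ M². -/
theorem norm_symbol_le_of_large (hε : ε = 1 ∨ ε = -1)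
    (hψM : ∀ l, M ≤ ‖l‖ → ‖ψ l‖ ≤ η / 2)
    {g : ℝ} (hg : 0 < g) (hgM : M ^ 2 * g ≤ 1) {a b p : ℝ}
    (hb : 1 ≤ Real.exp (-b) * g ^ 5) (hp : g ^ 2 ≤ Real.exp (-b / 2) * |p ^ 2 / 2 - 1|) :
    ‖ψ (coad (a, b, p) (-ε, 0, ε))‖ ≤ η / 2 := by
  have hεabs : |ε| = 1 := by rcases hε with rfl | rfl <;> simp
  rw [exp_neg_eq_sq] at hb
  refine hψM _ ?_
  rw [coad_eq]
  set s := Real.exp (-b / 2) with hs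
  have hs0 : 0 < s := Real.exp_pos _
  refine le_norm_R3_fst ?_
  dsimp only
  have : s ^ 2 * (-ε - p * 0 + p ^ 2 / 2 * ε) = ε * (s ^ 2 * (p ^ 2 / 2 - 1)) := by ring
  rw [this, abs_mul, hεabs, one_mul]
  refine le_of_sq_le_sq ?_ (abs_nonneg _)
  have h1 : (g ^ 2) ^ 2 ≤ (s * |p ^ 2 / 2 - 1|) ^ 2 := by gcongr
  have h2 : M ^ 2 * g ^ 5 ≤ g ^ 4 := by
    calc M ^ 2 * g ^ 5 = M ^ 2 * g * g ^ 4 := by ring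
      _ ≤ 1 * g ^ 4 := by gcongr
      _ = g ^ 4 := one_mul _
  have h3 : |s ^ 2 * (p ^ 2 / 2 - 1)| ^ 2 * g ^ 5
      = (s ^ 2 * g ^ 5) * (s * |p ^ 2 / 2 - 1|) ^ 2 := by
    rw [mul_pow s, sq_abs, sq_abs]; ring
  have h4 : M ^ 2 * g ^ 5 ≤ |s ^ 2 * (p ^ 2 / 2 - 1)| ^ 2 * g ^ 5 := by
    rw [h3]
    nlinarith [sq_nonneg (s * |p ^ 2 / 2 - 1|)]
  exact le_of_mul_le_mul_right h4 (by positivity)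

end Symbols

/-! ## Localisation -/

/-- The union of the regions `S_{δ,3,k}`. -/
def S3total (δ : ℝ) : Set R3 := {u | Real.exp (-u.1) ≤ δ ^ 6 ∧ δ ≤ Real.exp (-u.2.1) ∧
  δ ^ (1 / 2 : ℝ) < Real.exp (-u.2.1 / 2) * |u.2.2 ^ 2 / 2 - 1| ∧
  Real.exp (-u.2.1) ≤ 1 / δ ^ (5 / 4 : ℝ)}

theorem mem_S3_iff {ε : ℝ} (hε : ε = 1 ∨ ε = -1) {δ : ℝ} (hδ : 0 < δ) (k : ℤ) (u : R3) :
    u ∈ S3 ε δ k ↔ u ∈ S3total δ ∧ ⌊u.2.2 / δ ^ 2⌋ = k := by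
  have ha : Real.log (1 / δ ^ 6) ≤ u.1 ↔ Real.exp (-u.1) ≤ δ ^ 6 := by
    rw [one_div, Real.log_inv, ← Real.le_log_iff_exp_le (by positivity), neg_le]
  have hb : u.2.1 ≤ Real.log (1 / δ) ↔ δ ≤ Real.exp (-u.2.1) := by
    rw [one_div, Real.log_inv, ← Real.log_le_iff_le_exp hδ, le_neg]
  have hc : (δ ^ (1 / 2 : ℝ) < ε * Real.exp (-u.2.1 / 2) * (1 - u.2.2 ^ 2 / 2) ∨
      ε * Real.exp (-u.2.1 / 2) * (1 - u.2.2 ^ 2 / 2) < -δ ^ (1 / 2 : ℝ)) ↔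
      δ ^ (1 / 2 : ℝ) < Real.exp (-u.2.1 / 2) * |u.2.2 ^ 2 / 2 - 1| := by
    have h1 : Real.exp (-u.2.1 / 2) * |u.2.2 ^ 2 / 2 - 1|
        = |ε * Real.exp (-u.2.1 / 2) * (1 - u.2.2 ^ 2 / 2)| := by
      have : |ε| = 1 := by rcases hε with rfl | rfl <;> simp
      rw [abs_mul, abs_mul, this, one_mul, abs_of_pos (Real.exp_pos _), abs_sub_comm]
    rw [h1, lt_abs, lt_neg]
  have hJ : u ∈ Jset δ k ↔ Real.exp (-u.1) ≤ δ ^ 6 ∧ δ ≤ Real.exp (-u.2.1) ∧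
      ⌊u.2.2 / δ ^ 2⌋ = k := by
    rw [← ha, ← hb, ← mem_Iset_iff (by positivity)]
    rfl
  simp only [S3, S3plus, S3minus, S3total, mem_union, mem_inter_iff, mem_ofPred_eq, hJ, ← hc]
  tauto

theorem iUnion_S3 {ε : ℝ} (hε : ε = 1 ∨ ε = -1) {δ : ℝ} (hδ : 0 < δ) :
    ⋃ k, S3 ε δ k = S3total δ := by
  ext u
  simp [mem_S3_iff hε hδ]

theorem measurableSet_S3total {δ : ℝ} (hδ : 0 < δ) : MeasurableSet (S3total δ) := by
  -- The union does not depend on the sign, so ε = 1 may be used.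
  rw [← iUnion_S3 (Or.inl rfl) hδ]
  exact MeasurableSet.iUnion (measurableSet_S3 1 δ)

/-- Left translation by x shifts p by e^{(b-a)/2} x_p. On S_{δ,3,k} one has e^{b-a} ≤ δ⁵, so the
shift is at most δ^{5/2}R ≤ δ², the width of one strip. -/
theorem eMul_mem_T3 {ε : ℝ} (hε : ε = 1 ∨ ε = -1) {δ : ℝ} (hδ : 0 < δ) {R : ℝ}
    (hR : δ * R ^ 2 ≤ 1) {x u : R3} (hx : ‖x‖ ≤ R) {k : ℤ} (hu : u ∈ S3 ε δ k) :
    eMul x u ∈ T3 δ k := by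
  obtain ⟨⟨h1, h2, -⟩, h3⟩ := (mem_S3_iff hε hδ k u).1 hu
  set e := Real.exp ((-u.1 + u.2.1) / 2) with he
  have he2 : e ^ 2 * δ ≤ δ ^ 6 := by
    have h4 : e ^ 2 * Real.exp (-u.2.1) = Real.exp (-u.1) := by
      rw [he, ← Real.exp_nat_mul, ← Real.exp_add]
      congr 1
      push_cast
      ring
    calc e ^ 2 * δ ≤ e ^ 2 * Real.exp (-u.2.1) := by gcongr
      _ ≤ δ ^ 6 := h4.trans_le h1
  have hxp : |x.2.2| ≤ R := ((norm_snd_le x.2).trans (norm_snd_le x)).trans hx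
  have hshift : |e * x.2.2| ≤ δ ^ 2 := by
    refine abs_le_of_sq_le_sq ?_ (by positivity)
    have h5 : x.2.2 ^ 2 ≤ R ^ 2 := by
      rw [← sq_abs]
      gcongr
    have h6 : (e * x.2.2) ^ 2 * δ ≤ (δ ^ 2) ^ 2 * δ := by
      calc (e * x.2.2) ^ 2 * δ = (e ^ 2 * δ) * x.2.2 ^ 2 := by ring
        _ ≤ δ ^ 6 * R ^ 2 := by gcongr
        _ = (δ ^ 2) ^ 2 * δ * (δ * R ^ 2) := by ring
        _ ≤ (δ ^ 2) ^ 2 * δ * 1 := by gcongr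
        _ = (δ ^ 2) ^ 2 * δ := mul_one _
    exact le_of_mul_le_mul_right h6 hδ
  rw [mem_T3_iff hδ]
  have hδ2 : 0 < δ ^ 2 := by positivity
  have h7 : (eMul x u).2.2 / δ ^ 2 = e * x.2.2 / δ ^ 2 + u.2.2 / δ ^ 2 := by
    rw [← add_div]
    rfl
  have h8 : |e * x.2.2 / δ ^ 2| ≤ 1 := by
    rw [abs_div, abs_of_pos hδ2, div_le_one hδ2]
    exact hshift
  rw [abs_le] at h8
  obtain ⟨f1, f2⟩ := Int.floor_eq_iff.1 h3
  have g1 : k - 1 ≤ ⌊(eMul x u).2.2 / δ ^ 2⌋ := by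
    rw [Int.le_floor, h7]
    push_cast
    linarith
  have g2 : ⌊(eMul x u).2.2 / δ ^ 2⌋ < k + 2 := by
    rw [Int.floor_lt, h7]
    push_cast
    linarith
  omega

/-- The supports of all the translates under the integral lie in T_{δ,3,k}, so the outer cutoff does
nothing. -/
theorem indOp_T3_transInt_indOp_S3 {ε : ℝ} (hε : ε = 1 ∨ ε = -1) {δ : ℝ} (hδ : 0 < δ)
    {A : Set R3} (hAm : MeasurableSet A) (hA : volume A ≠ ⊤) {R : ℝ} (hAR : ∀ x ∈ A, ‖x‖ ≤ R)
    (hR : δ * R ^ 2 ≤ 1) (k : ℤ) (ξ : L2R3) :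
    indOp (T3 δ k) (transInt hA (indOp (S3 ε δ k) ξ)) = transInt hA (indOp (S3 ε δ k) ξ) := by
  rw [transInt_apply, ← ContinuousLinearMap.integral_comp_comm _ (integrableOn_transOp hA _)]
  refine setIntegral_congr_fun hAm fun x hx => Lp.ext ?_
  have h1 := (measurePreserving_eMul (eInv x)).quasiMeasurePreserving.ae
    (indOp_coeFn (measurableSet_S3 ε δ k) ξ)
  filter_upwards [indOp_coeFn (measurableSet_T3 δ k) (transOp x (indOp (S3 ε δ k) ξ)),
    transOp_coeFn x (indOp (S3 ε δ k) ξ), h1] with h e1 e2 e3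
  rw [e1, e2, e3]
  by_cases hu : eMul (eInv x) h ∈ S3 ε δ k
  · have hh := eMul_mem_T3 hε hδ hR (hAR x hx) hu
    rw [← eMul_assoc, eMul_eInv, zero_eMul] at hh
    rw [indicator_of_mem hh, one_mul]
  · rw [indicator_of_notMem hu, zero_mul, mul_zero]

/-! ## The symbol of the difference -/

/-- The piecewise constant approximation of `l ∈ 𝔥*` on the regions `S_{δ,3,k}`. -/
def stepFunctional (ε δ : ℝ) (u : R3) : R3 :=
  (ε * (-1 + δ ^ 4 * (⌊u.2.2 / δ ^ 2⌋ : ℝ) ^ 2 / 2), 0, 0)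

theorem measurable_stepSymbol (ε δ : ℝ) {B : Set R3} (hB : volume B ≠ ⊤) :
    Measurable fun u => charInt B (coad u (stepFunctional ε δ u)) := by
  have h1 : Continuous fun z : R3 × R3 => coad z.1 z.2 := by
    unfold coad; fun_prop
  have h2 : Measurable fun u : R3 => (⌊u.2.2 / δ ^ 2⌋ : ℝ) :=
    measurable_from_top.comp (Int.measurable_floor.comp (by fun_prop))
  have h3 : Measurable (stepFunctional ε δ) := by
    unfold stepFunctional
    fun_prop
  exact (continuous_charInt hB).measurable.comp (h1.measurable.comp (measurable_id.prodMk h3))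

theorem memLp_stepSymbol (ε δ : ℝ) {B : Set R3} (hB : volume B ≠ ⊤) :
    MemLp (fun u => charInt B (coad u (stepFunctional ε δ u))) ∞ (volume : Measure R3) :=
  memLp_top_of_measurable (measurable_stepSymbol ε δ hB) fun _ => norm_charInt_le hB _

/-- The symbol of `σ_{ε,-ε,δ}`. -/
def symbolDelta (ε : ℝ) (φ : ℝ → ℝ) (δ : ℝ) (B : Set R3) (u : R3) : ℂ :=
  charInt B (coad u (0, 0, ε)) * ((φ (-Real.exp (-u.2.1)) : ℂ) * (S1 δ).indicator (fun _ => 1) u)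
  + charInt B (coad u (0, 0, ε)) * (S2 δ).indicator (fun _ => 1) u
  + (S3total δ).indicator (fun _ => 1) u * charInt B (coad u (stepFunctional ε δ u))
  + charInt B (coad u (ε * -2, ε * (1 * √2), 0)) * (S4 1 δ).indicator (fun _ => 1) u
  + charInt B (coad u (ε * -2, ε * (-1 * √2), 0)) * (S4 (-1) δ).indicator (fun _ => 1) u

theorem memLp_charInt_coad_mul_indicator {B : Set R3} (hB : volume B ≠ ⊤) (l : R3) {S : Set R3}
    (hS : MeasurableSet S) :
    MemLp (fun u => charInt B (coad u l) * S.indicator (fun _ => 1) u) ∞ (volume : Measure R3) :=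
  (memLp_top_indicator hS).mul (memLp_charInt_coad hB l)

/-- With the outer cutoffs gone, Λ_A comes out of the series, and the restrictions to the disjoint
S_{δ,3,k} add up to the restriction to their union. On S_{δ,3,k} the floor in `stepFunctional`
equals k. -/
theorem strongSum_sigma3Term_rect {ε : ℝ} (hε : ε = 1 ∨ ε = -1) {δ : ℝ} (hδ : 0 < δ)
    {A B : Set R3} (hAm : MeasurableSet A) (hA : volume A ≠ ⊤) (hB : volume B ≠ ⊤) {R : ℝ}
    (hAR : ∀ x ∈ A, ‖x‖ ≤ R) (hR : δ * R ^ 2 ≤ 1)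
    (hs : MeasurableSet (rect A B)) (hv : volume (rect A B) ≠ ⊤) :
    strongSum (sigma3Term ε δ (ofL1 (indicatorConstLp 1 hs hv (1 : ℂ))))
      = transInt hA ∘L mulOp (fun u => (S3total δ).indicator (fun _ => 1) u
        * charInt B (coad u (stepFunctional ε δ u))) := by
  rw [← mulOp_mulOp (memLp_top_indicator (measurableSet_S3total hδ)) (memLp_stepSymbol ε δ hB)]
  refine strongSum_eq fun ξ => ?_
  have h1 (k : ℤ) : mulOp (fun u => charInt B
      (coad u (ε * (-1 + δ ^ 4 * (k : ℝ) ^ 2 / 2), 0, 0))) ∘L indOp (S3 ε δ k)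
      = indOp (S3 ε δ k) ∘L mulOp (fun u => charInt B (coad u (stepFunctional ε δ u))) := by
    rw [indOp, mulOp_mulOp (memLp_charInt_coad hB _) (memLp_top_indicator (measurableSet_S3 ε δ k)),
      mulOp_mulOp (memLp_top_indicator (measurableSet_S3 ε δ k)) (memLp_stepSymbol ε δ hB)]
    congr 1
    funext u
    by_cases hu : u ∈ S3 ε δ k
    · rw [indicator_of_mem hu, mul_one, one_mul, stepFunctional, ((mem_S3_iff hε hδ k u).1 hu).2]
    · rw [indicator_of_notMem hu, mul_zero, zero_mul]
  have h2 (k : ℤ) : sigma3Term ε δ (ofL1 (indicatorConstLp 1 hs hv (1 : ℂ))) k ξ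
      = transInt hA (indOp (S3 ε δ k)
        (mulOp (fun u => charInt B (coad u (stepFunctional ε δ u))) ξ)) := by
    have h3 := congrArg (fun T => T ξ) (h1 k)
    simp only [ContinuousLinearMap.comp_apply] at h3
    rw [sigma3Term_eq ε hδ, sigma_ofL1_indicator _ hA hB, ContinuousLinearMap.comp_apply,
      ContinuousLinearMap.comp_apply, ContinuousLinearMap.comp_apply, h3,
      indOp_T3_transInt_indOp_S3 hε hδ hAm hA hAR hR]
  simp only [h2]
  have h4 := hasSum_indOp (measurableSet_S3 ε δ) (fun i j hij => disjoint_S3 ε hδ hij)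
    (mulOp (fun u => charInt B (coad u (stepFunctional ε δ u))) ξ)
  rw [iUnion_S3 hε hδ] at h4
  exact (transInt hA).hasSum h4

theorem memLp_cutoff_indicator {φ : ℝ → ℝ} (hφ : Continuous φ) (hφ_le : ∀ x, |φ x| ≤ 1) (δ : ℝ) :
    MemLp (fun u : R3 => (φ (-Real.exp (-u.2.1)) : ℂ) * (S1 δ).indicator (fun _ => 1) u) ∞
      (volume : Measure R3) :=
  (memLp_top_indicator (measurableSet_S1 δ)).mul (memLp_top_cutoff hφ hφ_le)

theorem memLp_symbolDelta (ε : ℝ) {φ : ℝ → ℝ} (hφ : Continuous φ) (hφ_le : ∀ x, |φ x| ≤ 1)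
    {δ : ℝ} (hδ : 0 < δ) {B : Set R3} (hB : volume B ≠ ⊤) :
    MemLp (symbolDelta ε φ δ B) ∞ (volume : Measure R3) :=
  (((((memLp_cutoff_indicator hφ hφ_le δ).mul (memLp_charInt_coad hB _)).add
    (memLp_charInt_coad_mul_indicator hB _ (measurableSet_S2 δ))).add
    ((memLp_stepSymbol ε δ hB).mul (memLp_top_indicator (measurableSet_S3total hδ)))).add
    (memLp_charInt_coad_mul_indicator hB _ (measurableSet_S4 1 δ))).add
    (memLp_charInt_coad_mul_indicator hB _ (measurableSet_S4 (-1) δ))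

theorem mulOp_add_five {f₁ f₂ f₃ f₄ f₅ : R3 → ℂ} (h₁ : MemLp f₁ ∞ (volume : Measure R3))
    (h₂ : MemLp f₂ ∞ (volume : Measure R3)) (h₃ : MemLp f₃ ∞ (volume : Measure R3))
    (h₄ : MemLp f₄ ∞ (volume : Measure R3)) (h₅ : MemLp f₅ ∞ (volume : Measure R3)) :
    mulOp f₁ + mulOp f₂ + mulOp f₃ + mulOp f₄ + mulOp f₅
      = mulOp (fun x => f₁ x + f₂ x + f₃ x + f₄ x + f₅ x) := by
  have h₁₂ : MemLp (fun x => f₁ x + f₂ x) ∞ (volume : Measure R3) := h₁.add h₂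
  have h₁₃ : MemLp (fun x => f₁ x + f₂ x + f₃ x) ∞ (volume : Measure R3) := h₁₂.add h₃
  have h₁₄ : MemLp (fun x => f₁ x + f₂ x + f₃ x + f₄ x) ∞ (volume : Measure R3) := h₁₃.add h₄
  rw [mulOp_add h₁ h₂, mulOp_add h₁₂ h₃, mulOp_add h₁₃ h₄, mulOp_add h₁₄ h₅]

theorem sigmaDelta_rect {ε : ℝ} (hε : ε = 1 ∨ ε = -1) {φ : ℝ → ℝ} (hφ : Continuous φ)
    (hφ_le : ∀ x, |φ x| ≤ 1) {δ : ℝ} (hδ : 0 < δ)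
    {A B : Set R3} (hAm : MeasurableSet A) (hA : volume A ≠ ⊤) (hB : volume B ≠ ⊤) {R : ℝ}
    (hAR : ∀ x ∈ A, ‖x‖ ≤ R) (hR : δ * R ^ 2 ≤ 1)
    (hs : MeasurableSet (rect A B)) (hv : volume (rect A B) ≠ ⊤) :
    sigmaDelta ε φ δ (ofL1 (indicatorConstLp 1 hs hv (1 : ℂ)))
      = transInt hA ∘L mulOp (symbolDelta ε φ δ B) := by
  have m0 := memLp_charInt_coad hB (0, 0, ε)
  have mφ := memLp_top_cutoff hφ hφ_le
  have i1 := memLp_top_indicator (measurableSet_S1 δ)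
  have i2 := memLp_top_indicator (measurableSet_S2 δ)
  have i4 (τ : ℝ) := memLp_top_indicator (measurableSet_S4 τ δ)
  have m4 (τ : ℝ) := memLp_charInt_coad hB (ε * -2, ε * (τ * √2), 0)
  have key := mulOp_add_five ((memLp_cutoff_indicator hφ hφ_le δ).mul m0) (i2.mul m0)
    ((memLp_stepSymbol ε δ hB).mul (memLp_top_indicator (measurableSet_S3total hδ)))
    ((i4 1).mul (m4 1)) ((i4 (-1)).mul (m4 (-1)))
  change _ = mulOp (symbolDelta ε φ δ B) at key
  rw [← key, sigmaDelta, sigma4, sigma4, strongSum_sigma3Term_rect hε hδ hAm hA hB hAR hR]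
  simp only [sigma_ofL1_indicator _ hA hB, ContinuousLinearMap.comp_add,
    ContinuousLinearMap.comp_assoc]
  rw [indOp, indOp, indOp, indOp, mulOp_mulOp mφ i1,
    mulOp_mulOp m0 (memLp_cutoff_indicator hφ hφ_le δ), mulOp_mulOp m0 i2,
    mulOp_mulOp (m4 1) (i4 1), mulOp_mulOp (m4 (-1)) (i4 (-1))]
  rfl

theorem stepFunctional_eq (ε δ : ℝ) (u : R3) : stepFunctional ε δ u
    = (ε * (-1 + (δ ^ 2 * (⌊u.2.2 / δ ^ 2⌋ : ℝ)) ^ 2 / 2), 0, 0) := by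
  rw [stepFunctional, mul_pow, ← pow_mul]

/-- Off two null sets every point far out lies in exactly one of S_{δ,1}, S_{δ,2}, the union of the
S_{δ,3,k}, S_{δ,4,±}, or the leftover set where e^{-b} > δ^{-5/4}, and one estimate applies on each.
-/
theorem exists_norm_sub_symbolDelta_le {ε η M ρ g : ℝ} (hε : ε = 1 ∨ ε = -1) (hη : 0 < η)
    (hM : 1 ≤ M) (hρ : 0 < ρ) {B : Set R3} (hψM : ∀ l, M ≤ ‖l‖ → ‖charInt B l‖ ≤ η / 2)
    (hψρ : ∀ l l', ‖l - l'‖ ≤ ρ → ‖charInt B l - charInt B l'‖ ≤ η)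
    {φ : ℝ → ℝ} (hφ_supp : tsupport φ ⊆ Icc (-1) 1)
    (hφ_one : ∀ x ∈ Icc (-(1 / 2) : ℝ) (1 / 2), φ x = 1) (hφ_le : ∀ x, |φ x| ≤ 1)
    (hg : 0 < g) (hg2 : g ≤ 1 / 2) (hgρ : 16 * M * g ≤ ρ) (hgM : M ^ 2 * g ≤ 1) :
    ∃ R : ℝ, ∀ u : R3, R < ‖u‖ → u.2.2 ≠ 0 → Real.exp (-u.1) ≠ (g ^ 4) ^ 6 →
      ‖charInt B (coad u (-ε, 0, ε)) - symbolDelta ε φ (g ^ 4) B u‖ ≤ η := by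
  have hδ : 0 < g ^ 4 := by positivity
  have hgρ' : g ≤ ρ := by nlinarith
  have hg4 : g ^ 4 ≤ g := by
    have := pow_le_pow_of_le_one hg.le (by linarith) (show 1 ≤ 4 by norm_num)
    rwa [pow_one] at this
  have hroot : (g ^ 4) ^ (1 / 2 : ℝ) = g ^ 2 := by
    rw [← Real.sqrt_eq_rpow, show g ^ 4 = (g ^ 2) ^ 2 by ring, Real.sqrt_sq (by positivity)]
  have hroot5 : (g ^ 4) ^ (5 / 4 : ℝ) = g ^ 5 := by
    rw [← Real.rpow_natCast g 4, ← Real.rpow_mul hg.le, ← Real.rpow_natCast g 5]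
    norm_num
  obtain ⟨R, hR⟩ := norm_symbol_sub_le_of_S1 hε hη hM hρ hψM hψρ hφ_supp hφ_one hφ_le hδ
  refine ⟨R, fun u hu hp ha => ?_⟩
  by_cases h1 : u ∈ S1 (g ^ 4)
  · have h1' : (g ^ 4) ^ 6 < Real.exp (-u.1) := h1
    have h2 : u ∉ S2 (g ^ 4) := fun h => not_lt.2 h.1 h1'
    have h3 : u ∉ S3total (g ^ 4) := fun h => not_lt.2 h.1 h1'
    have h4 (τ : ℝ) : u ∉ S4 τ (g ^ 4) := fun h => lt_asymm h.1 h1'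
    simpa [symbolDelta, h1, h2, h3, h4] using hR u hu h1
  have h1' : Real.exp (-u.1) ≤ (g ^ 4) ^ 6 := not_lt.1 h1
  by_cases h2 : u ∈ S2 (g ^ 4)
  · have h3 : u ∉ S3total (g ^ 4) := fun h => not_lt.2 h.2.1 h2.2
    have h4 (τ : ℝ) : u ∉ S4 τ (g ^ 4) := fun h => not_lt.2 h.2.1 h2.2
    simpa [symbolDelta, h1, h2, h3, h4] using
      norm_symbol_sub_le_of_S2 hε hψρ hδ (hg4.trans hgρ') h2
  have h2' : g ^ 4 ≤ Real.exp (-u.2.1) := not_lt.1 fun h => h2 ⟨h1', h⟩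
  by_cases h5 : (g ^ 4) ^ (1 / 2 : ℝ) < Real.exp (-u.2.1 / 2) * |u.2.2 ^ 2 / 2 - 1|
  · have h4 (τ : ℝ) : u ∉ S4 τ (g ^ 4) := fun h => not_lt.2 h.2.2.1 h5
    by_cases h6 : Real.exp (-u.2.1) ≤ 1 / (g ^ 4) ^ (5 / 4 : ℝ)
    · have h3 : u ∈ S3total (g ^ 4) := ⟨h1', h2', h5, h6⟩
      obtain ⟨f1, f2⟩ := Int.floor_eq_iff.1 (rfl : ⌊u.2.2 / (g ^ 4) ^ 2⌋ = _)
      rw [le_div_iff₀ (by positivity)] at f1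
      rw [div_lt_iff₀ (by positivity)] at f2
      rw [hroot5, le_div_iff₀ (by positivity)] at h6
      have h7 := norm_symbol_sub_le_of_S3 hε hM hψM hψρ hg hg2 hgρ (a := u.1) (b := u.2.1)
        (p := u.2.2) (q := (g ^ 4) ^ 2 * (⌊u.2.2 / (g ^ 4) ^ 2⌋ : ℝ)) h1' h6 (by linarith)
        (by nlinarith)
      simpa [symbolDelta, h1, h2, h3, h4, stepFunctional_eq] using h7
    · have h3 : u ∉ S3total (g ^ 4) := fun h => h6 h.2.2.2
      rw [not_le, hroot5, div_lt_iff₀ (by positivity)] at h6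
      rw [hroot] at h5
      have h7 := norm_symbol_le_of_large hε hψM hg hgM (a := u.1) h6.le h5.le
      have h8 : ‖charInt B (coad u (-ε, 0, ε))‖ ≤ η := by linarith
      simpa [symbolDelta, h1, h2, h3, h4] using h8
  -- Here the null sets matter: both S_{δ,4,±} allow p = 0, where their terms would be added twice,
  -- and both omit e^{-a} = δ⁶.
  · have h3 : u ∉ S3total (g ^ 4) := fun h => h5 h.2.2.1
    have hmem (τ : ℝ) : u ∈ S4 τ (g ^ 4) ↔ τ * u.2.2 ≤ 0 :=
      ⟨fun h => h.2.2.2, fun h => ⟨lt_of_le_of_ne h1' ha, h2', not_lt.1 h5, h⟩⟩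
    rcases lt_or_gt_of_ne hp with h | h
    · have m1 : u ∈ S4 1 (g ^ 4) := (hmem 1).2 (by linarith)
      have m2 : u ∉ S4 (-1) (g ^ 4) := fun hh => by linarith [(hmem (-1)).1 hh]
      simpa [symbolDelta, h1, h2, h3, m1, m2] using
        norm_symbol_sub_le_of_S4 hε hψρ hg hg2 hgρ' (Or.inl rfl) m1
    · have m1 : u ∉ S4 1 (g ^ 4) := fun hh => by linarith [(hmem 1).1 hh]
      have m2 : u ∈ S4 (-1) (g ^ 4) := (hmem (-1)).2 (by linarith)
      simpa [symbolDelta, h1, h2, h3, m1, m2] using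
        norm_symbol_sub_le_of_S4 hε hψρ hg hg2 hgρ' (Or.inr rfl) m2

theorem ae_snd_snd_ne_zero : ∀ᵐ u : R3, u.2.2 ≠ 0 :=
  (Measure.quasiMeasurePreserving_snd.comp Measure.quasiMeasurePreserving_snd).ae
    (compl_mem_ae_iff.2 (measure_singleton (0 : ℝ)))

theorem ae_exp_neg_fst_ne (c : ℝ) : ∀ᵐ u : R3, Real.exp (-u.1) ≠ c := by
  have h : ∀ᵐ a : ℝ, a ≠ -Real.log c := compl_mem_ae_iff.2 (measure_singleton _)
  filter_upwards [Measure.quasiMeasurePreserving_fst.ae h] with u hu huc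
  exact hu (by rw [← huc, Real.log_exp, neg_neg])

/-! ## The distance to the compact operators -/

/-- The distance is the norm in the quotient by the compact operators, so it is a seminorm. -/
theorem distCompact_eq_norm (T : L2R3 →L[ℂ] L2R3) :
    distCompact T = ‖(Submodule.Quotient.mk T :
      (L2R3 →L[ℂ] L2R3) ⧸ compactOperator (RingHom.id ℂ) L2R3 L2R3)‖ :=
  (QuotientAddGroup.norm_mk
    (S := (compactOperator (RingHom.id ℂ) L2R3 L2R3).toAddSubgroup) T).symm

theorem distCompact_nonneg (T : L2R3 →L[ℂ] L2R3) : 0 ≤ distCompact T := Metric.infDist_nonneg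

theorem distCompact_add_le (S T : L2R3 →L[ℂ] L2R3) :
    distCompact (S + T) ≤ distCompact S + distCompact T := by
  simp only [distCompact_eq_norm, Submodule.Quotient.mk_add]
  exact norm_add_le (Submodule.Quotient.mk S : (L2R3 →L[ℂ] L2R3) ⧸
    compactOperator (RingHom.id ℂ) L2R3 L2R3) (Submodule.Quotient.mk T)

theorem distCompact_smul_le (c : ℂ) (T : L2R3 →L[ℂ] L2R3) :
    distCompact (c • T) ≤ ‖c‖ * distCompact T := by
  simp only [distCompact_eq_norm, Submodule.Quotient.mk_smul]
  exact norm_smul_le c (Submodule.Quotient.mk T : (L2R3 →L[ℂ] L2R3) ⧸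
    compactOperator (RingHom.id ℂ) L2R3 L2R3)

theorem distCompact_le_norm_sub (T : L2R3 →L[ℂ] L2R3) {K : L2R3 →L[ℂ] L2R3}
    (hK : IsCompactOperator K) : distCompact T ≤ ‖T - K‖ := by
  rw [← dist_eq_norm]
  exact Metric.infDist_le_dist_of_mem hK

theorem distCompact_le_norm (T : L2R3 →L[ℂ] L2R3) : distCompact T ≤ ‖T‖ := by
  have h := distCompact_le_norm_sub T (K := 0) isCompactOperator_zero
  rwa [sub_zero] at h

/-- Cutting θ off to the ball leaves a compact operator, and the remainder has a multiplier bounded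
by η. -/
theorem distCompact_transInt_mulOp_le_of_measurable {A : Set R3} (hAm : MeasurableSet A) (hA : volume A ≠ ⊤)
    {θ : R3 → ℂ} (hθ : Measurable θ) {C : ℝ} (hC : ∀ u, ‖θ u‖ ≤ C) {R η : ℝ} (hη : 0 ≤ η)
    (h : ∀ᵐ u, R < ‖u‖ → ‖θ u‖ ≤ η) :
    distCompact (transInt hA ∘L mulOp θ) ≤ ‖transInt hA‖ * η := by
  have hball : MeasurableSet (Metric.closedBall (0 : R3) R) :=
    Metric.isClosed_closedBall.measurableSet
  have hC' (u : R3) : ‖(Metric.closedBall 0 R).indicator θ u‖ ≤ C :=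
    (norm_indicator_le_norm_self _ _).trans (hC u)
  have hK := isCompactOperator_transInt_mulOp hAm hA (hθ.indicator hball) hC' (R := R)
    fun u hu => indicator_of_notMem (by simpa using hu) _
  refine (distCompact_le_norm_sub _ hK).trans ?_
  rw [← ContinuousLinearMap.comp_sub, mulOp_sub (memLp_top_of_measurable hθ hC)
    (memLp_top_of_measurable (hθ.indicator hball) hC')]
  refine (ContinuousLinearMap.opNorm_comp_le _ _).trans ?_
  gcongr
  refine norm_mulOp_le ((memLp_top_of_measurable hθ hC).sub
    (memLp_top_of_measurable (hθ.indicator hball) hC')) hη ?_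
  filter_upwards [h] with u hu
  by_cases hb : u ∈ Metric.closedBall (0 : R3) R
  · simpa [hb] using hη
  · rw [Pi.sub_apply]
    rw [indicator_of_notMem hb, sub_zero]
    exact hu (by simpa using hb)

/-- Reduces to the everywhere bounded Borel case by truncating a measurable version of θ at its
essential supremum. -/
theorem distCompact_transInt_mulOp_le {A : Set R3} (hAm : MeasurableSet A) (hA : volume A ≠ ⊤)
    {θ : R3 → ℂ} (hθ : MemLp θ ∞ (volume : Measure R3)) {R η : ℝ} (hη : 0 ≤ η)
    (h : ∀ᵐ u, R < ‖u‖ → ‖θ u‖ ≤ η) :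
    distCompact (transInt hA ∘L mulOp θ) ≤ ‖transInt hA‖ * η := by
  set C := (eLpNorm θ ∞ (volume : Measure R3)).toReal
  have hC : ∀ᵐ u, ‖θ u‖ ≤ C := by
    filter_upwards [ae_le_eLpNormEssSup (f := θ) (μ := (volume : Measure R3))] with u hu
    rw [← toReal_enorm]
    exact ENNReal.toReal_mono hθ.2.ne (by rwa [eLpNorm_exponent_top])
  set f := hθ.1.mk θ
  have hf : Measurable f := hθ.1.stronglyMeasurable_mk.measurable
  set f' := {u | ‖f u‖ ≤ C}.indicator f
  have hf' : Measurable f' := hf.indicator (measurableSet_le hf.norm measurable_const)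
  have hf'C (u : R3) : ‖f' u‖ ≤ C := by
    by_cases hu : u ∈ {u | ‖f u‖ ≤ C}
    · have e : f' u = f u := indicator_of_mem hu f
      rw [e]
      exact hu
    · have e : f' u = 0 := indicator_of_notMem hu f
      rw [e, norm_zero]
      exact ENNReal.toReal_nonneg
  have hθf : θ =ᵐ[volume] f' := by
    filter_upwards [hθ.1.ae_eq_mk, hC] with u h1 h2
    rw [h1] at h2 ⊢
    exact (indicator_of_mem (s := {u | ‖f u‖ ≤ C}) h2 f).symm
  rw [mulOp_congr hθ hθf]
  refine distCompact_transInt_mulOp_le_of_measurable hAm hA hf' hf'C (R := R) hη ?_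
  filter_upwards [h, hθf] with u h1 h2
  rwa [← h2]

theorem tendsto_distCompact_rect {ε : ℝ} (hε : ε = 1 ∨ ε = -1) {φ : ℝ → ℝ} (hφ : Continuous φ)
    (hφ_supp : tsupport φ ⊆ Icc (-1) 1)
    (hφ_one : ∀ x ∈ Icc (-(1 / 2) : ℝ) (1 / 2), φ x = 1) (hφ_le : ∀ x, |φ x| ≤ 1)
    {A B : Set R3} (hAm : MeasurableSet A) (hBm : MeasurableSet B) {R : ℝ}
    (hAR : ∀ x ∈ A, ‖x‖ ≤ R) (hBR : ∀ x ∈ B, ‖x‖ ≤ R)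
    (hs : MeasurableSet (rect A B)) (hv : volume (rect A B) ≠ ⊤) :
    Tendsto (fun δ : ℝ => distCompact (sigma (-ε, 0, ε) (ofL1 (indicatorConstLp 1 hs hv (1 : ℂ)))
      - sigmaDelta ε φ δ (ofL1 (indicatorConstLp 1 hs hv (1 : ℂ))))) (𝓝[>] 0) (𝓝 0) := by
  have hfin (D : Set R3) (hD : ∀ x ∈ D, ‖x‖ ≤ R) : volume D ≠ ⊤ :=
    ((measure_mono fun x hx => by simpa using hD x hx).trans_lt
      (isCompact_closedBall (0 : R3) R).measure_lt_top).ne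
  have hA := hfin A hAR
  have hB := hfin B hBR
  rw [Metric.tendsto_nhds]
  intro e he
  -- The 1 and the factor 1/2 give ‖Λ_A‖η < e even when Λ_A = 0.
  set η := e / (‖transInt hA‖ + 1) / 2 with hη_def
  have hη : 0 < η := by positivity
  obtain ⟨M₀, hM₀⟩ := exists_norm_charInt_le hBm (half_pos hη)
  set M := max M₀ 1
  have hM : 1 ≤ M := le_max_right _ _
  have hψM (l : R3) (hl : M ≤ ‖l‖) : ‖charInt B l‖ ≤ η / 2 := hM₀ l ((le_max_left _ _).trans hl)
  set L := |3 * R * volume.real B| + 1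
  have hL : 0 < L := by positivity
  set ρ := η / L
  have hρ : 0 < ρ := by positivity
  have hψρ (l l' : R3) (hl : ‖l - l'‖ ≤ ρ) : ‖charInt B l - charInt B l'‖ ≤ η := by
    refine (norm_charInt_sub_le hB hBR l l').trans ?_
    have h1 : 3 * R * volume.real B ≤ L := (le_abs_self _).trans (by linarith)
    calc 3 * R * volume.real B * ‖l - l'‖ ≤ L * ρ := by gcongr
      _ = η := mul_div_cancel₀ _ hL.ne'
  -- The first three bounds are those of the region estimates; the last gives δR² ≤ 1, needed to
  -- absorb the strip cutoffs.
  set g₀ := min (min (1 / 2) (ρ / (16 * M))) (min (1 / M ^ 2) (1 / (R ^ 2 + 1)))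
  have hg₀ : 0 < g₀ := by positivity
  filter_upwards [Ioo_mem_nhdsGT (show (0 : ℝ) < g₀ ^ 4 by positivity)] with δ hδ
  obtain ⟨g, hg, rfl⟩ : ∃ g : ℝ, 0 < g ∧ δ = g ^ 4 := by
    refine ⟨δ ^ (1 / 4 : ℝ), Real.rpow_pos_of_pos hδ.1 _, ?_⟩
    rw [← Real.rpow_natCast, ← Real.rpow_mul hδ.1.le]
    norm_num
  have hgg : g ≤ g₀ := (lt_of_pow_lt_pow_left₀ 4 hg₀.le hδ.2).le
  have hg2 : g ≤ 1 / 2 := hgg.trans ((min_le_left _ _).trans (min_le_left _ _))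
  have hgρ : 16 * M * g ≤ ρ := by
    have := hgg.trans ((min_le_left _ _).trans (min_le_right _ _))
    rwa [le_div_iff₀ (by positivity), mul_comm] at this
  have hgM : M ^ 2 * g ≤ 1 := by
    have := hgg.trans ((min_le_right _ _).trans (min_le_left _ _))
    rwa [le_div_iff₀ (by positivity), mul_comm] at this
  have hgR : g ^ 4 * R ^ 2 ≤ 1 := by
    have h1 := hgg.trans ((min_le_right _ _).trans (min_le_right _ _))
    rw [le_div_iff₀ (by positivity)] at h1
    have h2 : g ^ 4 ≤ g := by
      have := pow_le_pow_of_le_one hg.le (by linarith) (show 1 ≤ 4 by norm_num)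
      rwa [pow_one] at this
    nlinarith [sq_nonneg R]
  obtain ⟨R', hR'⟩ := exists_norm_sub_symbolDelta_le hε hη hM hρ hψM hψρ hφ_supp hφ_one hφ_le
    hg hg2 hgρ hgM
  rw [sigmaDelta_rect hε hφ hφ_le hδ.1 hAm hA hB hAR hgR, sigma_ofL1_indicator _ hA hB,
    ← ContinuousLinearMap.comp_sub, mulOp_sub (memLp_charInt_coad hB _)
      (memLp_symbolDelta ε hφ hφ_le hδ.1 hB), Real.dist_eq, sub_zero,
    abs_of_nonneg (distCompact_nonneg _)]
  refine (distCompact_transInt_mulOp_le hAm hA ((memLp_charInt_coad hB _).sub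
    (memLp_symbolDelta ε hφ hφ_le hδ.1 hB)) hη.le (R := R') ?_).trans_lt ?_
  · filter_upwards [ae_snd_snd_ne_zero, ae_exp_neg_fst_ne ((g ^ 4) ^ 6)] with u h1 h2 h3
    exact hR' u h3 h1 h2
  · have h1 : (‖transInt hA‖ + 1) * η = e / 2 := by
      rw [hη_def]
      field_simp
    linarith [norm_nonneg (transInt hA)]

/-! ## Density of the characteristic functions of rectangles -/

theorem indicatorConstLp_mem_of_monotone {α : Type*} [MeasurableSpace α] {μ : Measure α}
    {V : Submodule ℂ (Lp ℂ 1 μ)} (hV : IsClosed (V : Set (Lp ℂ 1 μ))) {t : ℕ → Set α}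
    (ht : ∀ n, MeasurableSet (t n)) (hμt : ∀ n, μ (t n) ≠ ⊤) (hmono : Monotone t)
    (hmem : ∀ n, indicatorConstLp 1 (ht n) (hμt n) (1 : ℂ) ∈ V) {s : Set α}
    (hs : MeasurableSet s) (hμs : μ s ≠ ⊤) (hst : s = ⋃ n, t n) :
    indicatorConstLp 1 hs hμs (1 : ℂ) ∈ V := by
  refine hV.mem_of_tendsto (b := atTop) (tendsto_indicatorConstLp_set (t := t) (ht := ht) (hμt := hμt)
    (by simp) ?_) (Eventually.of_forall hmem)
  have h1 (n : ℕ) : symmDiff (t n) s = s \ t n := by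
    rw [Set.symmDiff_def, sdiff_eq_empty.2 (hst ▸ subset_iUnion t n), empty_union]
  have h2 : Tendsto (μ ∘ fun n => s \ t n) atTop (𝓝 (μ (⋂ n, s \ t n))) :=
    tendsto_measure_iInter_atTop (fun n => (hs.diff (ht n)).nullMeasurableSet)
      (fun m n hmn => sdiff_subset_sdiff_right (hmono hmn))
      ⟨0, measure_ne_top_of_subset sdiff_subset hμs⟩
  have h3 : ⋂ n, s \ t n = ∅ := by
    rw [← sdiff_iUnion, ← hst, Set.sdiff_self]
  rw [h3, measure_empty] at h2
  simpa only [h1, Function.comp_def] using h2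

theorem indicatorConstLp_eq_add {α : Type*} [MeasurableSpace α] {μ : Measure α} {s t u : Set α}
    (hs : MeasurableSet s) (hμs : μ s ≠ ⊤) (ht : MeasurableSet t) (hμt : μ t ≠ ⊤)
    (hu : MeasurableSet u) (hμu : μ u ≠ ⊤) (hst : Disjoint s t) (h : u = s ∪ t) :
    indicatorConstLp 1 hu hμu (1 : ℂ)
      = indicatorConstLp 1 hs hμs (1 : ℂ) + indicatorConstLp 1 ht hμt (1 : ℂ) := by
  subst h
  exact indicatorConstLp_disjoint_union hs ht hμs hμt hst 1

theorem indicatorConstLp_eq_smul {α : Type*} [MeasurableSpace α] {μ : Measure α} {s : Set α}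
    (hs : MeasurableSet s) (hμs : μ s ≠ ⊤) (c : ℂ) :
    indicatorConstLp 1 hs hμs c = c • indicatorConstLp 1 hs hμs (1 : ℂ) := by
  refine Lp.ext ?_
  filter_upwards [indicatorConstLp_coeFn (p := 1) (hs := hs) (hμs := hμs) (c := c),
    indicatorConstLp_coeFn (p := 1) (hs := hs) (hμs := hμs) (c := (1 : ℂ)),
    Lp.coeFn_smul c (indicatorConstLp 1 hs hμs (1 : ℂ))] with x h1 h2 h3
  rw [h1, h3, Pi.smul_apply, h2]
  by_cases hx : x ∈ s <;> simp [hx]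

/-- The set of all `E(x) exp(y)` with `‖x‖, ‖y‖ ≤ n`. -/
def box (n : ℕ) : Set G6 := rect (Metric.closedBall 0 n) (Metric.closedBall 0 n)

theorem measurableSet_box (n : ℕ) : MeasurableSet (box n) :=
  measurableSet_rect Metric.isClosed_closedBall.measurableSet
    Metric.isClosed_closedBall.measurableSet

theorem volume_box_ne_top (n : ℕ) : volume (box n) ≠ ⊤ := by
  rw [box, volume_rect]
  exact ENNReal.mul_ne_top (isCompact_closedBall _ _).measure_lt_top.ne
    (isCompact_closedBall _ _).measure_lt_top.ne

theorem volume_inter_box_ne_top (E : Set G6) (n : ℕ) : volume (E ∩ box n) ≠ ⊤ :=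
  measure_ne_top_of_subset inter_subset_right (volume_box_ne_top n)

theorem monotone_box : Monotone box := fun _ _ hmn _ hg =>
  ⟨Metric.closedBall_subset_closedBall (by exact_mod_cast hmn) hg.1,
    Metric.closedBall_subset_closedBall (by exact_mod_cast hmn) hg.2⟩

theorem iUnion_box : ⋃ n, box n = univ := by
  refine eq_univ_of_forall fun g => mem_iUnion.2 ?_
  obtain ⟨n, hn⟩ := exists_nat_ge (max ‖g.x‖ ‖g.y‖)
  exact ⟨n, by simpa using (le_max_left _ _).trans hn, by simpa using (le_max_right _ _).trans hn⟩

section Density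

variable {V : Submodule ℂ (Lp ℂ 1 (volume : Measure G6))}

/-- The π-λ theorem inside a box, where all measures are finite and complements stay in V.
Measurable rectangles form the generating π-system. -/
theorem indicatorConstLp_inter_box_mem (hV : IsClosed (V : Set (Lp ℂ 1 (volume : Measure G6))))
    (h : ∀ (A B : Set R3) (hs : MeasurableSet (rect A B)) (hv : volume (rect A B) ≠ ⊤) (R : ℝ),
      MeasurableSet A → MeasurableSet B → (∀ x ∈ A, ‖x‖ ≤ R) → (∀ x ∈ B, ‖x‖ ≤ R) →
      indicatorConstLp 1 hs hv (1 : ℂ) ∈ V) (n : ℕ) (E : Set G6) (hE : MeasurableSet E) :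
    indicatorConstLp 1 (hE.inter (measurableSet_box n)) (volume_inter_box_ne_top E n) (1 : ℂ) ∈ V := by
  have hball : MeasurableSet (Metric.closedBall (0 : R3) n) :=
    Metric.isClosed_closedBall.measurableSet
  have hgen : (inferInstance : MeasurableSpace G6) = MeasurableSpace.generateFrom
      (image2 rect {A | MeasurableSet A} {B | MeasurableSet B}) :=
    (generateFrom_prod (α := R3) (β := R3)).symm
  have hpi : IsPiSystem (image2 rect {A | MeasurableSet A} {B | MeasurableSet B}) :=
    isPiSystem_prod (α := R3) (β := R3)
  have hrect (A B : Set R3) (hA : MeasurableSet A) (hB : MeasurableSet B)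
      (hs : MeasurableSet (rect A B ∩ box n)) (hv : volume (rect A B ∩ box n) ≠ ⊤) :
      indicatorConstLp 1 hs hv (1 : ℂ) ∈ V := by
    have e : rect A B ∩ box n
        = rect (A ∩ Metric.closedBall 0 n) (B ∩ Metric.closedBall 0 n) := by
      ext g
      simp only [rect, box, mem_inter_iff, mem_ofPred_eq]
      tauto
    have := h (A ∩ Metric.closedBall 0 n) (B ∩ Metric.closedBall 0 n) (e ▸ hs) (e ▸ hv) n
      (hA.inter hball) (hB.inter hball) (fun x hx => by simpa using hx.2)
      (fun x hx => by simpa using hx.2)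
    simpa only [e] using this
  have hdiff (s : Set G6) (hs : MeasurableSet s)
      (hm : indicatorConstLp 1 (hs.inter (measurableSet_box n)) (volume_inter_box_ne_top s n)
        (1 : ℂ) ∈ V) :
      indicatorConstLp 1 (hs.compl.inter (measurableSet_box n)) (volume_inter_box_ne_top sᶜ n)
        (1 : ℂ) ∈ V := by
    have hb : indicatorConstLp 1 (measurableSet_box n) (volume_box_ne_top n) (1 : ℂ) ∈ V :=
      h _ _ _ _ n hball hball (fun x hx => by simpa using hx) (fun x hx => by simpa using hx)
    rw [indicatorConstLp_eq_add (hs.inter (measurableSet_box n)) (volume_inter_box_ne_top s n)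
      (hs.compl.inter (measurableSet_box n)) (volume_inter_box_ne_top sᶜ n) _ _
      (disjoint_compl_right.mono inter_subset_left inter_subset_left)
      (by rw [← union_inter_distrib_right, union_compl_self, univ_inter])] at hb
    exact (V.add_mem_iff_right hm).1 hb
  induction E, hE using MeasurableSpace.induction_on_inter hgen hpi with
  | empty =>
    have e : (∅ : Set G6) = rect ∅ ∅ := by
      ext g
      simp [rect]
    simp only [e]
    exact hrect ∅ ∅ .empty .empty _ _
  | basic t ht =>
    obtain ⟨A, hA, B, hB, rfl⟩ := ht
    exact hrect A B hA hB _ _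
  | compl t htm ht => exact hdiff t htm ht
  | iUnion f hd hfm ih =>
    have hm (N : ℕ) : MeasurableSet (⋃ i < N, f i) :=
      .iUnion fun i => .iUnion fun _ => hfm i
    -- A disjoint countable union is the increasing limit of its finite partial unions, which lie in
    -- V by additivity.
    refine indicatorConstLp_mem_of_monotone hV (t := fun N => (⋃ i < N, f i) ∩ box n)
      (fun N => (hm N).inter (measurableSet_box n)) (fun N => volume_inter_box_ne_top _ n)
      (fun M N hMN => inter_subset_inter_left _
        (biUnion_subset_biUnion_left fun i (hi : i < M) => hi.trans_le hMN)) (fun N => ?_) _ _ ?_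
    · induction N with
      | zero =>
        have e : (⋃ i < 0, f i) = rect ∅ ∅ := by
          ext g
          simp [rect]
        simp only [e]
        exact hrect ∅ ∅ .empty .empty _ _
      | succ N hN =>
        rw [indicatorConstLp_eq_add ((hm N).inter (measurableSet_box n))
          (volume_inter_box_ne_top _ n) ((hfm N).inter (measurableSet_box n))
          (volume_inter_box_ne_top _ n) _ _ ?_ ?_]
        · exact V.add_mem hN (ih N)
        · refine Disjoint.mono inter_subset_left inter_subset_left ?_
          simp only [disjoint_iUnion_left]
          exact fun i hi => hd hi.ne
        · rw [← union_inter_distrib_right, biUnion_lt_succ]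
    · rw [← iUnion_inter, biUnion_lt_eq_iUnion]

/-- Exhausting by boxes gives all sets of finite measure, hence simple functions, hence L¹(G) since
V is closed. -/
theorem mem_of_forall_rect_mem (hV : IsClosed (V : Set (Lp ℂ 1 (volume : Measure G6))))
    (h : ∀ (A B : Set R3) (hs : MeasurableSet (rect A B)) (hv : volume (rect A B) ≠ ⊤) (R : ℝ),
      MeasurableSet A → MeasurableSet B → (∀ x ∈ A, ‖x‖ ≤ R) → (∀ x ∈ B, ‖x‖ ≤ R) →
      indicatorConstLp 1 hs hv (1 : ℂ) ∈ V) (f : Lp ℂ 1 (volume : Measure G6)) : f ∈ V := by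
  refine Lp.induction (p := 1) (by norm_num)
    (motive := fun f : Lp ℂ 1 (volume : Measure G6) => f ∈ V) ?_ ?_ ?_ f
  · intro c s hs hμs
    have h1 : indicatorConstLp 1 hs hμs.ne (1 : ℂ) ∈ V :=
      indicatorConstLp_mem_of_monotone hV (fun n => hs.inter (measurableSet_box n))
        (volume_inter_box_ne_top s) (fun m n hmn => inter_subset_inter_right s (monotone_box hmn))
        (fun n => indicatorConstLp_inter_box_mem hV h n s hs) hs hμs.ne
        (by rw [← inter_iUnion, iUnion_box, inter_univ])
    have h2 := V.smul_mem c h1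
    rwa [Lp.simpleFunc.coe_indicatorConst, indicatorConstLp_eq_smul]
  · intro f g hf hg _ h1 h2
    exact V.add_mem h1 h2
  · exact hV

end Density

/-! ## Proof of the theorem -/

/-- An estimate uniform in δ makes the set of good F closed. Used twice: inside L¹(G) and from L¹(G)
to C*(G). -/
theorem tendsto_distCompact_of_approx {D : ℝ → CStarG6 → (L2R3 →L[ℂ] L2R3)} {C : ℝ} (hC : 0 ≤ C)
    (hD : ∀ δ, 0 < δ → ∀ F F', distCompact (D δ F) ≤ distCompact (D δ F') + C * ‖F - F'‖)
    {F : CStarG6} (hF : F ∈ closure {F | Tendsto (fun δ => distCompact (D δ F)) (𝓝[>] 0) (𝓝 0)}) :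
    Tendsto (fun δ => distCompact (D δ F)) (𝓝[>] 0) (𝓝 0) := by
  refine tendsto_order.2 ⟨fun a ha => Eventually.of_forall fun δ =>
    ha.trans_le (distCompact_nonneg _), fun a ha => ?_⟩
  obtain ⟨F', hF', hFF'⟩ := Metric.mem_closure_iff.1 hF (a / (2 * (C + 1))) (by positivity)
  rw [dist_eq_norm] at hFF'
  have h1 : C * ‖F - F'‖ ≤ a / 2 := by
    calc C * ‖F - F'‖ ≤ (C + 1) * (a / (2 * (C + 1))) := by gcongr; linarith
      _ = a / 2 := by field_simp
  filter_upwards [(tendsto_order.1 hF').2 (a / 2) (by positivity), self_mem_nhdsWithin] with δ h2 hδ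
  linarith [hD δ hδ F F']

section Approximation

variable {ε : ℝ} {φ : ℝ → ℝ}

theorem distCompact_sub_sigmaDelta_add_le (hε : ε = 1 ∨ ε = -1) (hφ : Continuous φ)
    (hφ_le : ∀ x, |φ x| ≤ 1) {δ : ℝ} (hδ : 0 < δ) (F F' : CStarG6) :
    distCompact (sigma (-ε, 0, ε) (F + F') - sigmaDelta ε φ δ (F + F'))
      ≤ distCompact (sigma (-ε, 0, ε) F - sigmaDelta ε φ δ F)
        + distCompact (sigma (-ε, 0, ε) F' - sigmaDelta ε φ δ F') := by
  have h : sigmaDelta ε φ δ (F + F') = sigmaDelta ε φ δ F + sigmaDelta ε φ δ F' :=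
    map_add (sigmaDeltaCLM hε hφ hφ_le hδ) F F'
  rw [h, sigma_add, add_sub_add_comm]
  exact distCompact_add_le _ _

theorem distCompact_sub_sigmaDelta_smul_le (hε : ε = 1 ∨ ε = -1) (hφ : Continuous φ)
    (hφ_le : ∀ x, |φ x| ≤ 1) {δ : ℝ} (hδ : 0 < δ) (c : ℂ) (F : CStarG6) :
    distCompact (sigma (-ε, 0, ε) (c • F) - sigmaDelta ε φ δ (c • F))
      ≤ ‖c‖ * distCompact (sigma (-ε, 0, ε) F - sigmaDelta ε φ δ F) := by
  have h : sigmaDelta ε φ δ (c • F) = c • sigmaDelta ε φ δ F :=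
    map_smul (sigmaDeltaCLM hε hφ hφ_le hδ) c F
  rw [h, sigma_smul, ← smul_sub]
  exact distCompact_smul_le _ _

/-- The constant is 8 = 1 + 7, from ‖σ_l(F)‖ ≤ ‖F‖ and the uniform bound for σ_{ε,-ε,δ}. -/
theorem distCompact_sub_sigmaDelta_le (hε : ε = 1 ∨ ε = -1) (hφ : Continuous φ)
    (hφ_le : ∀ x, |φ x| ≤ 1) {δ : ℝ} (hδ : 0 < δ) (F F' : CStarG6) :
    distCompact (sigma (-ε, 0, ε) F - sigmaDelta ε φ δ F)
      ≤ distCompact (sigma (-ε, 0, ε) F' - sigmaDelta ε φ δ F') + 8 * ‖F - F'‖ := by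
  have h1 := distCompact_sub_sigmaDelta_add_le hε hφ hφ_le hδ F' (F - F')
  rw [add_sub_cancel] at h1
  have h2 := (distCompact_le_norm (sigma (-ε, 0, ε) (F - F') - sigmaDelta ε φ δ (F - F'))).trans
    (norm_sub_le _ _)
  linarith [norm_sigma_le (-ε, 0, ε) (F - F'), norm_sigmaDelta_le_mul hε hφ hφ_le hδ (F - F')]

/-- The integrable functions `f` for which `σ_{ε(S*-Q*)}(f)` is approximated by the operators
`σ_{ε,-ε,δ}(f)` modulo compact operators. -/
def approxSubmodule (hε : ε = 1 ∨ ε = -1) (hφ : Continuous φ) (hφ_le : ∀ x, |φ x| ≤ 1) :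
    Submodule ℂ (Lp ℂ 1 (volume : Measure G6)) where
  carrier := {f | Tendsto (fun δ : ℝ =>
    distCompact (sigma (-ε, 0, ε) (ofL1 f) - sigmaDelta ε φ δ (ofL1 f))) (𝓝[>] 0) (𝓝 0)}
  add_mem' {f g} hf hg := by
    refine tendsto_of_tendsto_of_tendsto_of_le_of_le' tendsto_const_nhds
      (by simpa only [add_zero] using Tendsto.add hf hg)
      (Eventually.of_forall fun δ => distCompact_nonneg _) ?_
    filter_upwards [self_mem_nhdsWithin] with δ hδ
    rw [map_add]
    exact distCompact_sub_sigmaDelta_add_le hε hφ hφ_le hδ _ _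
  zero_mem' := by
    refine tendsto_of_tendsto_of_tendsto_of_le_of_le' tendsto_const_nhds tendsto_const_nhds
      (Eventually.of_forall fun δ => distCompact_nonneg _) ?_
    filter_upwards [self_mem_nhdsWithin] with δ hδ
    have h := distCompact_sub_sigmaDelta_smul_le hε hφ hφ_le hδ 0 (ofL1 0)
    rwa [← map_smul, smul_zero, norm_zero, zero_mul] at h
  smul_mem' c f hf := by
    refine tendsto_of_tendsto_of_tendsto_of_le_of_le' tendsto_const_nhds
      (by simpa only [mul_zero] using Tendsto.const_mul ‖c‖ hf)
      (Eventually.of_forall fun δ => distCompact_nonneg _) ?_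
    filter_upwards [self_mem_nhdsWithin] with δ hδ
    rw [map_smul]
    exact distCompact_sub_sigmaDelta_smul_le hε hφ hφ_le hδ _ _

theorem isClosed_approxSubmodule (hε : ε = 1 ∨ ε = -1) (hφ : Continuous φ)
    (hφ_le : ∀ x, |φ x| ≤ 1) :
    IsClosed (approxSubmodule hε hφ hφ_le : Set (Lp ℂ 1 (volume : Measure G6))) := by
  refine isClosed_of_closure_subset fun f hf => ?_
  exact tendsto_distCompact_of_approx
    (D := fun δ F => sigma (-ε, 0, ε) F - sigmaDelta ε φ δ F) (by norm_num : (0 : ℝ) ≤ 8)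
    (fun δ hδ => distCompact_sub_sigmaDelta_le hε hφ hφ_le hδ)
    (map_mem_closure ofL1.continuous hf fun g hg => hg)

theorem tendsto_distCompact_sub_sigmaDelta (hε : ε = 1 ∨ ε = -1) (hφ : Continuous φ)
    (hφ_supp : tsupport φ ⊆ Icc (-1) 1)
    (hφ_one : ∀ x ∈ Icc (-(1 / 2) : ℝ) (1 / 2), φ x = 1) (hφ_le : ∀ x, |φ x| ≤ 1)
    (F : CStarG6) :
    Tendsto (fun δ : ℝ => distCompact (sigma (-ε, 0, ε) F - sigmaDelta ε φ δ F))
      (𝓝[>] 0) (𝓝 0) := by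
  refine tendsto_distCompact_of_approx
    (D := fun δ F => sigma (-ε, 0, ε) F - sigmaDelta ε φ δ F) (by norm_num : (0 : ℝ) ≤ 8)
    (fun δ hδ => distCompact_sub_sigmaDelta_le hε hφ hφ_le hδ)
    (closure_mono ?_ (denseRange_ofL1 F))
  rintro _ ⟨f, rfl⟩
  exact mem_of_forall_rect_mem (isClosed_approxSubmodule hε hφ hφ_le)
    (fun A B hs hv R hA hB hAR hBR =>
      tendsto_distCompact_rect hε hφ hφ_supp hφ_one hφ_le hA hB hAR hBR hs hv) f

end Approximation

end

theorem proposition5p4 (ε : ℝ) (hε : ε = 1 ∨ ε = -1) (φ : ℝ → ℝ) (hφ : ContDiff ℝ ∞ φ)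
    (hφ_supp : tsupport φ ⊆ Icc (-1) 1) (hφ_one : ∀ x ∈ Icc (-(1 / 2) : ℝ) (1 / 2), φ x = 1)
    (hφ_le : ∀ x, |φ x| ≤ 1) :
    -- the constant of the norm estimate
    (∃ C : ℕ, C ≤ 9 ∧
      (∀ δ : ℝ, 0 < δ →
        IsGreatest (range fun m : ℤ => {k : ℤ | (T3 δ k ∩ T3 δ m).Nonempty}.encard) (C : ℕ∞)) ∧
      ∀ δ : ℝ, 0 < δ → ∀ F : CStarG6,
        ‖sigmaDelta ε φ δ F‖ ≤ 2 * ‖sigma (0, 0, ε) F‖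
          + C * max ‖sigma (ε, 0, 0) F‖ ‖sigma (-ε, 0, 0) F‖
          + (‖sigma (0, ε, 0) F‖ + ‖sigma (0, -ε, 0) F‖)) ∧
    -- the series defining the operators converges strongly
    (∀ δ : ℝ, 0 < δ → ∀ (F : CStarG6) (ξ : L2R3),
      HasSum (fun k : ℤ => sigma3Term ε δ F k ξ) (strongSum (sigma3Term ε δ F) ξ)) ∧
    -- the operators define a bounded linear map on the C*-algebra
    (∀ δ : ℝ, 0 < δ → ∃ Φ : CStarG6 →L[ℂ] (L2R3 →L[ℂ] L2R3), ∀ F, Φ F = sigmaDelta ε φ δ F) ∧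
    -- approximation of the irreducible representation modulo compact operators
    ∀ F : CStarG6,
      Tendsto (fun δ : ℝ => distCompact (sigma (-ε, 0, ε) F - sigmaDelta ε φ δ F))
        (𝓝[>] 0) (𝓝 0) := by
  -- Every T_{δ,3,m} meets exactly five T_{δ,3,k}, so C = 5; the norm estimate already holds with 3
  -- in its place.
  refine ⟨⟨5, by norm_num, fun δ hδ => ?_, fun δ hδ F => ?_⟩, fun δ hδ F ξ =>
    hasSum_sigma3Term hε hδ F ξ, fun δ hδ =>
    ⟨sigmaDeltaCLM hε hφ.continuous hφ_le hδ, fun _ => rfl⟩,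
    tendsto_distCompact_sub_sigmaDelta hε hφ.continuous hφ_supp hφ_one hφ_le⟩
  · simp only [encard_T3_inter_nonempty hδ, range_const]
    exact isGreatest_singleton
  · have h1 := norm_sigmaDelta_le hε hφ.continuous hφ_le hδ F
    have h2 : 0 ≤ max ‖sigma (ε, 0, 0) F‖ ‖sigma (-ε, 0, 0) F‖ :=
      le_max_of_le_left (norm_nonneg _)
    push_cast
    linarith
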